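/- **Non-abelian Stokes Theorem.** Let $L\xrightarrow{\delta}E\xrightarrow{\partial}G$ be a 2-crossed module of (finite-dimensional) Lie groups: $\delta,\partial$ are Lie group maps with $\partial\delta=1$, $G$ acts smoothly on the left on $E$ and $L$ by automorphisms ($\triangleright$) and on itself by conjugation, $\delta,\partial$ and the smooth Peiffer lifting $\{\,,\}\colon E\times E\to L$ are $G$-equivariant, and, with $\langle e,f\rangle=efe^{-1}\,(\partial(e)\triangleright f^{-1})$, for all $e,f,g\in E$ and $k,l\in L$: $\delta\{e,f\}=\langle e,f\rangle$; $\{\delta(l),\delta(k)\}=lkl^{-1}k^{-1}$; $\{ef,g\}=\{e,fgf^{-1}\}\,\partial(e)\triangleright\{f,g\}$; $\{e,fg\}=\{e,f\}\{e,g\}\{\langle e,g\rangle^{-1},\partial(e)\triangleright f\}$; $\{\delta(l),e\}\{e,\delta(l)\}=l\,(\partial(e)\triangleright l^{-1})$. Let $E$ act on $L$ by $e\triangleright' l=l\,\{\delta(l)^{-1},e\}$. Let $\mathfrak l\xrightarrow{\delta}\mathfrak e\xrightarrow{\partial}\mathfrak g$ be the associated differential 2-crossed module; its actions are obtained by differentiation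 and its bilinear Peiffer lifting $\{\,,\}\colon\mathfrak e\times\mathfrak e\to\mathfrak l$ is the mixed second differential at the identity of the Peiffer lifting. Let $M$ be a smooth manifold and let $\omega\in\mathcal A^1(M,\mathfrak g)$, $m\in\mathcal A^2(M,\mathfrak e)$, $\theta\in\mathcal A^3(M,\mathfrak l)$ be smooth forms with $$\partial(m)=\Omega:=d\omega+[\omega,\omega],\qquad \delta(\theta)=\mathcal M:=dm+\omega\wedge^{\triangleright}m ,$$ where $[\omega,\omega](X,Y)=[\omega(X),\omega(Y)]$ and $(\omega\wedge^\triangleright m)(X,Y,Z)=\omega(X)\triangleright m(Y,Z)-\omega(Y)\triangleright m(X,Z)+\omega(Z)\triangleright m(X,Y)$. Let $J\colon[0,1]^3\to M$, $(t,s,x)\mapsto J(t,s,x)=\Gamma_x(t,s)=\gamma^x_s(t)$, be a good 3-path. This means: $J$ is smooth; there is $\epsilon>0$ such that, for each of the three coordinates, $J$ does not depend on that coordinate within distance $\epsilon$ of either of its two end values; $J$ is constant on the face $t=0$ and on the face $t=1$; and $J(t,0,x)$ and $J(t,1,x)$ do not depend on $x$. Define: * $g_{\gamma}(t_0,t)\in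 G$ by $\frac{\partial}{\partial t}g_{\gamma}(t_0,t)=g_{\gamma}(t_0,t)\,\omega(\dot\gamma(t))$, $g_\gamma(t_0,t_0)=1$, for $\gamma=\gamma^x_s$; * $n_s(t,s,x)=g_{\gamma^x_s}(0,t)\triangleright m(\partial_tJ,\partial_sJ)$ and $n_x(t,s,x)=g_{\gamma^x_s}(0,t)\triangleright m(\partial_tJ,\partial_xJ)$, both with values in $\mathfrak e$; * $e_{\Gamma_x}(s_0,s)\in E$ by $\frac{\partial}{\partial s}e_{\Gamma_x}(s_0,s)=e_{\Gamma_x}(s_0,s)\int_0^1 n_s(t,s,x)\,dt$, $e_{\Gamma_x}(s_0,s_0)=1$, and $e_{\Gamma_x}:=e_{\Gamma_x}(0,1)$; * $l_J(x_0,x)\in L$ by $l_J(x_0,x_0)=1$ and $$\frac{\partial}{\partial x}l_J(x_0,x)=-\,l_J(x_0,x)\int_0^1 e_{\Gamma_x}(0,s)\triangleright' B(s,x)\,ds,$$ where $$B(s,x)=\int_0^1 g_{\gamma^x_s}(0,t)\triangleright\theta(\partial_tJ,\partial_sJ,\partial_xJ)\,dt-\int_0^1\Big(\Big\{\int_0^t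 n_s(t',s,x)\,dt',\,n_x(t,s,x)\Big\}-\Big\{\int_0^t n_x(t',s,x)\,dt',\,n_s(t,s,x)\Big\}\Big)dt .$$ Then these initial value problems have unique solutions on $[0,1]$ (for all initial parameters in $[0,1]$ and all values in $[0,1]$ of the remaining variables), and $$\delta\big(l_J(x,x')\big)^{-1}\,e_{\Gamma_x}=e_{\Gamma_{x'}}\qquad\text{for all }x,x'\in[0,1].$$ -/

import Mathlib

open Set
open scoped Manifold ContDiff

noncomputable section

namespace HigherHolonomy

/-! ## Differential forms on a manifold modelled on a vector space `VM` -/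

section Forms

variable {VM : Type*} [NormedAddCommGroup VM] [NormedSpace ℝ VM]
  {M : Type*} [TopologicalSpace M] [ChartedSpace VM M]
  {V : Type*} [NormedAddCommGroup V] [NormedSpace ℝ V] {k : ℕ}

/-- The expression of a field of alternating `k`-forms in the preferred chart at `p₀`: its pull-back
along the inverse of the chart. -/
def chartForm (α : (p : M) → (TangentSpace 𝓘(ℝ, VM) p) [⋀^Fin k]→L[ℝ] V) (p₀ : M) (y : VM) :
    VM [⋀^Fin k]→L[ℝ] V :=
  (α ((extChartAt 𝓘(ℝ, VM) p₀).symm y)).compContinuousLinearMap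
    (mfderiv 𝓘(ℝ, VM) 𝓘(ℝ, VM) (extChartAt 𝓘(ℝ, VM) p₀).symm y)

variable (VM M V k) in
/-- Smooth `V`-valued differential `k`-forms on `M`. -/
structure DiffForm where
  /-- the value of the form at a point -/
  toFun : (p : M) → (TangentSpace 𝓘(ℝ, VM) p) [⋀^Fin k]→L[ℝ] V
  smooth : ∀ p₀ : M, ContDiffOn ℝ ∞ (chartForm toFun p₀) (extChartAt 𝓘(ℝ, VM) p₀).target

instance : CoeFun (DiffForm VM M V k)
    (fun _ => (p : M) → (TangentSpace 𝓘(ℝ, VM) p) [⋀^Fin k]→L[ℝ] V) :=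
  ⟨DiffForm.toFun⟩

/-- The exterior derivative of a form, at the point `p`: computed in the preferred chart at `p`
with the normalisation `dα(v₀,…,vₖ) = ∑ᵢ (-1)ⁱ vᵢ(α(v₀,…,v̂ᵢ,…,vₖ))` in coordinates. -/
def extD (α : DiffForm VM M V k) (p : M) :
    (TangentSpace 𝓘(ℝ, VM) p) [⋀^Fin (k + 1)]→L[ℝ] V :=
  (extDeriv (chartForm α.toFun p) (extChartAt 𝓘(ℝ, VM) p p)).compContinuousLinearMap
    (mfderiv 𝓘(ℝ, VM) 𝓘(ℝ, VM) (extChartAt 𝓘(ℝ, VM) p) p)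

variable (VM) in
/-- The velocity at time `t` of a curve defined on `[0,1]`. -/
def velocity (γ : ℝ → M) (t : ℝ) : TangentSpace 𝓘(ℝ, VM) (γ t) :=
  mfderivWithin 𝓘(ℝ, ℝ) 𝓘(ℝ, VM) γ (Icc 0 1) t (1 : ℝ)

end Forms

/-! ## Path-ordered exponentials in a Lie group

The tangent space of a Lie group at the identity is, as a vector space, the model space `V`; it
carries the bracket of left-invariant vector fields. -/

section Hol

variable {V : Type*} [NormedAddCommGroup V] [NormedSpace ℝ V]
  {G : Type*} [TopologicalSpace G] [ChartedSpace V G] [Group G]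

/-- `F` solves `F'(t) = F(t) A(t)` on `[0,1]`, with `F(t₀) = 1`; here `F(t) A(t)` is the image of
`A(t)` under the derivative at `1` of the left translation by `F(t)`. -/
def IsOrderedExp (A : ℝ → V) (t₀ : ℝ) (F : ℝ → G) : Prop :=
  F t₀ = 1 ∧ ∀ t ∈ Icc (0 : ℝ) 1,
    HasMFDerivWithinAt 𝓘(ℝ, ℝ) 𝓘(ℝ, V) F (Icc 0 1) t
      ((1 : ℝ →L[ℝ] ℝ).smulRight
        (mulInvariantVectorField (I := 𝓘(ℝ, V)) (G := G) (A t) (F t)))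

variable (G) in
/-- The initial value problem `F' = F A` on `[0,1]`, `F(t₀) = 1`, has exactly one solution
(as a function on `[0,1]`). -/
def WellPosed (A : ℝ → V) (t₀ : ℝ) : Prop :=
  ∃ F : ℝ → G, IsOrderedExp A t₀ F ∧
    ∀ F' : ℝ → G, IsOrderedExp A t₀ F' → EqOn F' F (Icc 0 1)

open Classical in
variable (G) in
/-- The solution on `[0,1]` of `F' = F A`, `F(t₀) = 1`. -/
def orderedExp (A : ℝ → V) (t₀ : ℝ) : ℝ → G :=
  if h : ∃ F : ℝ → G, IsOrderedExp A t₀ F then h.choose else fun _ => 1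

variable (G) in
/-- The bracket of the Lie algebra of `G`, on the tangent space at the identity. -/
def lieBr (X Y : V) : V :=
  @Bracket.bracket (GroupLieAlgebra 𝓘(ℝ, V) G) (GroupLieAlgebra 𝓘(ℝ, V) G) _ X Y

end Hol

/-! ## 2-crossed modules of Lie groups -/

/-- A 2-crossed module of Lie groups `L → E → G`; `VG`, `VE`, `VL` are the model spaces. -/
structure LieTwoCrossedModule
    (VG VE VL : Type*)
    [NormedAddCommGroup VG] [NormedSpace ℝ VG]
    [NormedAddCommGroup VE] [NormedSpace ℝ VE]
    [NormedAddCommGroup VL] [NormedSpace ℝ VL]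
    (G E L : Type*)
    [TopologicalSpace G] [ChartedSpace VG G] [Group G]
    [TopologicalSpace E] [ChartedSpace VE E] [Group E]
    [TopologicalSpace L] [ChartedSpace VL L] [Group L] where
  /-- the boundary map `δ : L → E` -/
  bdL : L →* E
  /-- the boundary map `∂ : E → G` -/
  bdE : E →* G
  /-- the left action of `G` on `E` by automorphisms -/
  actE : G →* MulAut E
  /-- the left action of `G` on `L` by automorphisms -/
  actL : G →* MulAut L
  /-- the Peiffer lifting `{e, f}` -/
  lift : E → E → L
  smooth_bdL : ContMDiff 𝓘(ℝ, VL) 𝓘(ℝ, VE) ∞ bdL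
  smooth_bdE : ContMDiff 𝓘(ℝ, VE) 𝓘(ℝ, VG) ∞ bdE
  smooth_actE : ContMDiff (𝓘(ℝ, VG).prod 𝓘(ℝ, VE)) 𝓘(ℝ, VE) ∞ (fun p : G × E => actE p.1 p.2)
  smooth_actL : ContMDiff (𝓘(ℝ, VG).prod 𝓘(ℝ, VL)) 𝓘(ℝ, VL) ∞ (fun p : G × L => actL p.1 p.2)
  smooth_lift : ContMDiff (𝓘(ℝ, VE).prod 𝓘(ℝ, VE)) 𝓘(ℝ, VL) ∞ (fun p : E × E => lift p.1 p.2)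
  bdE_bdL : ∀ l, bdE (bdL l) = 1
  bdE_act : ∀ g e, bdE (actE g e) = g * bdE e * g⁻¹
  bdL_act : ∀ g l, bdL (actL g l) = actE g (bdL l)
  lift_act : ∀ g e f, actL g (lift e f) = lift (actE g e) (actE g f)
  bdL_lift : ∀ e f, bdL (lift e f) = e * f * e⁻¹ * actE (bdE e) f⁻¹
  lift_bdL : ∀ l k, lift (bdL l) (bdL k) = l * k * l⁻¹ * k⁻¹
  lift_mul_left : ∀ e f g, lift (e * f) g = lift e (f * g * f⁻¹) * actL (bdE e) (lift f g)
  lift_mul_right : ∀ e f g, lift e (f * g) =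
    lift e f * lift e g * lift (e * g * e⁻¹ * actE (bdE e) g⁻¹)⁻¹ (actE (bdE e) f)
  lift_bdL_mul : ∀ e l, lift (bdL l) e * lift e (bdL l) = l * actL (bdE e) l⁻¹

namespace LieTwoCrossedModule

variable {VG VE VL : Type*}
    [NormedAddCommGroup VG] [NormedSpace ℝ VG]
    [NormedAddCommGroup VE] [NormedSpace ℝ VE]
    [NormedAddCommGroup VL] [NormedSpace ℝ VL]
    {G E L : Type*}
    [TopologicalSpace G] [ChartedSpace VG G] [Group G]
    [TopologicalSpace E] [ChartedSpace VE E] [Group E]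
    [TopologicalSpace L] [ChartedSpace VL L] [Group L]
    (H : LieTwoCrossedModule VG VE VL G E L)

/-- The left action of `E` on `L`: `e ▷' l = l {δ(l)⁻¹, e}`. -/
def actEL (e : E) (l : L) : L := l * H.lift (H.bdL l)⁻¹ e

/-! ### The derived structure on tangent spaces at the identity

All the maps differentiated below preserve the identity, so the derivatives take values in the
tangent spaces at the identity. -/

/-- The differential `δ : 𝔩 → 𝔢` of `δ : L → E`. -/
def dBdL (x : VL) : VE := mfderiv 𝓘(ℝ, VL) 𝓘(ℝ, VE) H.bdL 1 x

/-- The differential `∂ : 𝔢 → 𝔤` of `∂ : E → G`. -/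
def dBdE (u : VE) : VG := mfderiv 𝓘(ℝ, VE) 𝓘(ℝ, VG) H.bdE 1 u

/-- The action of the group `G` on the Lie algebra `𝔢`: `g ▷ u`. -/
def grpActE (g : G) (u : VE) : VE := mfderiv 𝓘(ℝ, VE) 𝓘(ℝ, VE) (fun e : E => H.actE g e) 1 u

/-- The action of the group `G` on the Lie algebra `𝔩`: `g ▷ x`. -/
def grpActL (g : G) (x : VL) : VL := mfderiv 𝓘(ℝ, VL) 𝓘(ℝ, VL) (fun l : L => H.actL g l) 1 x

/-- The action of the Lie algebra `𝔤` on the Lie algebra `𝔢`: `X ▷ u`. -/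
def algActE (X : VG) (u : VE) : VE :=
  mfderiv 𝓘(ℝ, VG) 𝓘(ℝ, VE) (fun g : G => H.grpActE g u) 1 X

/-- The action of the group `E` on the Lie algebra `𝔩`: `e ▷' x`. -/
def grpActEL (e : E) (x : VL) : VL := mfderiv 𝓘(ℝ, VL) 𝓘(ℝ, VL) (fun l : L => H.actEL e l) 1 x

/-- The Peiffer lifting `{u, v}` of the differential 2-crossed module: the second (mixed)
differential at `(1, 1)` of the Peiffer lifting `E × E → L`. -/
def algLift (u v : VE) : VL :=
  mfderiv 𝓘(ℝ, VE) 𝓘(ℝ, VL)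
    (fun e : E => (mfderiv 𝓘(ℝ, VE) 𝓘(ℝ, VL) (fun f : E => H.lift e f) 1 v : VL)) 1 u

/-! ### Connection forms, curvatures and holonomies -/

variable {VM : Type*} [NormedAddCommGroup VM] [NormedSpace ℝ VM]
  {M : Type*} [TopologicalSpace M] [ChartedSpace VM M]
  (om : DiffForm VM M VG 1) (m : DiffForm VM M VE 2) (θ : DiffForm VM M VL 3)

variable (G) in
/-- The curvature `Ω = dω + [ω, ω]` of `ω`, with `[ω, ω](X, Y) = [ω(X), ω(Y)]`. -/
def curvature (p : M) (X Y : TangentSpace 𝓘(ℝ, VM) p) : VG :=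
  extD om p ![X, Y] + lieBr G (om p ![X]) (om p ![Y])

/-- The 2-curvature `dm + ω ∧^▷ m` of `(ω, m)`, where
`ω ∧^▷ m = 3!/(1! 2!) Alt (ω ⊗^▷ m)` is written out as a sum over the three shuffles. -/
def twoCurvature (p : M) (X Y Z : TangentSpace 𝓘(ℝ, VM) p) : VE :=
  extD m p ![X, Y, Z] +
    (H.algActE (om p ![X]) (m p ![Y, Z]) - H.algActE (om p ![Y]) (m p ![X, Z])
      + H.algActE (om p ![Z]) (m p ![X, Y]))

/-- The pair of conditions `∂(m) = Ω` and `δ(θ) = dm + ω ∧^▷ m`. -/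
def IsConnection : Prop :=
  (∀ (p : M) (X Y : TangentSpace 𝓘(ℝ, VM) p),
      H.dBdE (m p ![X, Y]) = curvature G om p X Y) ∧
    ∀ (p : M) (X Y Z : TangentSpace 𝓘(ℝ, VM) p),
      H.dBdL (θ p ![X, Y, Z]) = H.twoCurvature om m p X Y Z

/-- The pull-back `A(t) = ω(γ'(t))` of `ω` along a path. -/
def coeff₁ (γ : ℝ → M) (t : ℝ) : VG := om (γ t) ![velocity VM γ t]

variable (G) in
/-- The holonomy `g_γ(t₀, t)` of a path: `∂g/∂t = g ω(γ')`, `g(t₀, t₀) = 1`. -/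
def hol₁ (γ : ℝ → M) (t₀ t : ℝ) : G := orderedExp G (coeff₁ om γ) t₀ t

/-- For a 2-path `Γ(t, s) = γ_s(t)`, the integrand `g_{γ_s}(0, t) ▷ m(∂γ_s(t)/∂t, ∂γ_s(t)/∂s)`
at `(t, s)`. -/
def density₂ (Γ : ℝ → ℝ → M) (t s : ℝ) : VE :=
  H.grpActE (hol₁ G om (fun t' => Γ t' s) 0 t)
    (m (Γ t s) ![velocity VM (fun t' => Γ t' s) t, velocity VM (fun s' => Γ t s') s])

/-- The value on `∂/∂s` of the pull-back of `∮_ω m` to the parameter space of a 2-path. -/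
def coeff₂ (Γ : ℝ → ℝ → M) (s : ℝ) : VE := ∫ t in (0 : ℝ)..1, H.density₂ om m Γ t s

/-- The 2-dimensional holonomy `e_Γ(s₀, s)`: `∂e/∂s = e ∮_ω m (∂/∂s)`, `e(s₀, s₀) = 1`. -/
def hol₂ (Γ : ℝ → ℝ → M) (s₀ s : ℝ) : E := orderedExp E (H.coeff₂ om m Γ) s₀ s

/-- For `J(t, s, x) = γ_s^x(t)`, the integrand `g(0, t) ▷ θ(∂J/∂t, ∂J/∂s, ∂J/∂x)` at `(t, s, x)`,
where `g(0, t)` is the holonomy of `γ_s^x`. -/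
def density₃ (J : ℝ → ℝ → ℝ → M) (t s x : ℝ) : VL :=
  H.grpActL (hol₁ G om (fun t' => J t' s x) 0 t)
    (θ (J t s x) ![velocity VM (fun t' => J t' s x) t, velocity VM (fun s' => J t s' x) s,
      velocity VM (fun x' => J t s x') x])

/-- The integral `(∮_ω θ)(∂/∂s, ∂/∂x)` at `(s, x)`. -/
def loopθ (J : ℝ → ℝ → ℝ → M) (s x : ℝ) : VL := ∫ t in (0 : ℝ)..1, H.density₃ om θ J t s x

/-- The iterated integral `(∮_ω m *^{,} m)(∂/∂s, ∂/∂x)` at `(s, x)`, i.e.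
`∫₀¹ (∮₀ᵗ g ▷ m) ∧^{,} ι_{∂/∂t} (g ▷ m) dt` evaluated on `(∂/∂s, ∂/∂x)`. -/
def loopmm (J : ℝ → ℝ → ℝ → M) (s x : ℝ) : VL :=
  ∫ t in (0 : ℝ)..1,
    (H.algLift (∫ t' in (0 : ℝ)..t, H.density₂ om m (fun a b => J a b x) t' s)
        (H.density₂ om m (fun a b => J a s b) t x)
      - H.algLift (∫ t' in (0 : ℝ)..t, H.density₂ om m (fun a b => J a s b) t' x)
        (H.density₂ om m (fun a b => J a b x) t s))

/-- The coefficient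
`- ∫₀¹ e_{Γ_x}(0, s) ▷' (∮_ω θ - ∮_ω m *^{,} m)(∂/∂s, ∂/∂x) ds`, where `Γ_x(t, s) = J(t, s, x)`. -/
def coeff₃ (J : ℝ → ℝ → ℝ → M) (x : ℝ) : VL :=
  -∫ s in (0 : ℝ)..1,
    H.grpActEL (H.hol₂ om m (fun t' s' => J t' s' x) 0 s) (H.loopθ om θ J s x - H.loopmm om m J s x)

/-- The 3-dimensional holonomy `l_J(x₀, x)`. -/
def hol₃ (J : ℝ → ℝ → ℝ → M) (x₀ x : ℝ) : L := orderedExp L (H.coeff₃ om m θ J) x₀ x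

end LieTwoCrossedModule

/-! ## Good 3-paths -/

section Paths

variable (VM : Type*) [NormedAddCommGroup VM] [NormedSpace ℝ VM]
  {M : Type*} [TopologicalSpace M] [ChartedSpace VM M]

/-- 3-paths `J(t, s, x)`: smooth maps `[0,1]³ → M` which have a product structure close to the
boundary of the cube, and which are constant on each of the faces `t = 0` and `t = 1`. (Values
outside the cube are irrelevant.) -/
structure IsThreePath (J : ℝ → ℝ → ℝ → M) : Prop where
  smooth : ContMDiffOn 𝓘(ℝ, ℝ × ℝ × ℝ) 𝓘(ℝ, VM) ∞ (fun p : ℝ × ℝ × ℝ => J p.1 p.2.1 p.2.2)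
    (Icc 0 1 ×ˢ Icc 0 1 ×ˢ Icc 0 1)
  product : ∃ ε > 0, ∀ t ∈ Icc (0 : ℝ) 1, ∀ s ∈ Icc (0 : ℝ) 1, ∀ x ∈ Icc (0 : ℝ) 1,
    (t ≤ ε → J t s x = J 0 s x) ∧ (1 - ε ≤ t → J t s x = J 1 s x) ∧
    (s ≤ ε → J t s x = J t 0 x) ∧ (1 - ε ≤ s → J t s x = J t 1 x) ∧
    (x ≤ ε → J t s x = J t s 0) ∧ (1 - ε ≤ x → J t s x = J t s 1)
  source : ∀ s ∈ Icc (0 : ℝ) 1, ∀ x ∈ Icc (0 : ℝ) 1, J 0 s x = J 0 0 0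
  target : ∀ s ∈ Icc (0 : ℝ) 1, ∀ x ∈ Icc (0 : ℝ) 1, J 1 s x = J 1 0 0

/-- A 3-path is good if its restrictions to the faces `s = 0` and `s = 1` are independent
of `x`. -/
structure IsGoodThreePath (J : ℝ → ℝ → ℝ → M) : Prop extends IsThreePath VM J where
  good_zero : ∀ t ∈ Icc (0 : ℝ) 1, ∀ x ∈ Icc (0 : ℝ) 1, J t 0 x = J t 0 0
  good_one : ∀ t ∈ Icc (0 : ℝ) 1, ∀ x ∈ Icc (0 : ℝ) 1, J t 1 x = J t 1 0

end Paths

end HigherHolonomy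

end

/-! Write A, m, θ for the components of the forms pulled back to the cube. The proof differentiates
each holonomy with respect to the next parameter and uses the curvature conditions to rewrite the
derivative.

One dimension. For a parameter y (s or x), the right logarithmic derivative of g in y is ∫ Ad_g(∂_y
A_t). Since ∂(m) is the curvature, this equals Ad_g(A_y) − ∂(∫₀ᵗ g ▷ m(∂_t, ∂_y)); the boundary term
at t = 0 vanishes because J is constant on that face (`integral_Ad_variation`). Hence the
y-derivative of a transported density is the transported covariant derivative minus the action of ∂
of the running integral (`hasDerivAt_transport`).

Two dimensions. Put a = ∫ n_s dt and b = ∫ n_x dt. In ∂_x n_s − ∂_s n_x the condition on δ(θ)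
produces g ▷ δ(θ) minus the t-derivative of g ▷ m(∂_s, ∂_x). The remaining action terms become
brackets through δ{u, v} = [u, v] − ∂(u) ▷ v (`tdL_dlift`), and those brackets add up to the
t-derivative of a single one. Integration over t gives δ(B) = ∂_x a − ∂_s b − [a, b] (`tdL_B`): a ds
+ b dx is a connection on the (s, x)-square, and δ(B) is its curvature up to the sign convention.

Three dimensions. The right logarithmic derivative of e_{Γ_x} in x is ∫ Ad_e(∂_x a) ds. The
contribution of ∂_s b + [a, b] is the integral of the s-derivative of Ad_e(b), which is zero because
b vanishes at s = 0 and s = 1 for a good path. What remains is δ(∫ e ▷' B ds), because e ▷' lies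
over conjugation by e (`integral_Ad_a'`). The minus sign in the equation for l_J makes δ(l_J)
e_{Γ_x} independent of x, which is the theorem (`CubeForms.stokes`).

The analytic basis is a comparison principle. If F and K have coefficients A and B, then K F⁻¹
solves the same kind of equation with the coefficient Ad_F(B − A). When this is small the quotient
stays in the chart at 1 and equals the integral of its coefficient up to a quadratic error
(`exists_orderedExp_quotient`). This gives both continuity and differentiability in parameters.
Existence comes from gluing short solutions; uniqueness from the vanishing logarithmic derivative of
F K⁻¹. -/

noncomputable section

namespace HigherHolonomy

set_option linter.unusedSectionVars false

/-! ## Derivatives of maps between manifolds as maps of model spaces -/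

section Calculus

variable (V W U : Type*)
  [NormedAddCommGroup V] [NormedSpace ℝ V]
  [NormedAddCommGroup W] [NormedSpace ℝ W]
  [NormedAddCommGroup U] [NormedSpace ℝ U]
  {M N P : Type*} [TopologicalSpace M] [ChartedSpace V M]
  [TopologicalSpace N] [ChartedSpace W N]
  [TopologicalSpace P] [ChartedSpace U P]

/-- The derivative of a map between manifolds, as a linear map between the model spaces. -/
def td (f : M → N) (x : M) : V →L[ℝ] W := mfderiv 𝓘(ℝ, V) 𝓘(ℝ, W) f x

/-- The curve `F` has velocity `v` at `t` within `s`. -/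
def HasVel (F : ℝ → M) (s : Set ℝ) (t : ℝ) (v : V) : Prop :=
  HasMFDerivWithinAt 𝓘(ℝ, ℝ) 𝓘(ℝ, V) F s t ((1 : ℝ →L[ℝ] ℝ).smulRight v)

variable {V W U}

theorem td_comp {g : N → P} {f : M → N} {x : M}
    (hg : MDifferentiableAt 𝓘(ℝ, W) 𝓘(ℝ, U) g (f x))
    (hf : MDifferentiableAt 𝓘(ℝ, V) 𝓘(ℝ, W) f x) (v : V) :
    td V U (fun y => g (f y)) x v = td W U g (f x) (td V W f x v) := by
  have := mfderiv_comp x hg hf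
  exact DFunLike.congr_fun this v

theorem td_id (x : M) (v : V) : td V V (fun y : M => y) x v = v := by
  have : mfderiv 𝓘(ℝ, V) 𝓘(ℝ, V) (fun y : M => y) x = ContinuousLinearMap.id ℝ _ := mfderiv_id
  exact DFunLike.congr_fun this v

theorem td_const (x : M) (c : N) (v : V) : td V W (fun _ : M => c) x v = 0 := by
  have : mfderiv 𝓘(ℝ, V) 𝓘(ℝ, W) (fun _ : M => c) x = 0 := mfderiv_const
  exact DFunLike.congr_fun this v

theorem td_eq_fderiv (f : V → W) (x : V) : td V W f x = fderiv ℝ f x := mfderiv_eq_fderiv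

theorem hasVel_of_hasMFDerivWithinAt {F : ℝ → M} {s : Set ℝ} {t : ℝ} {v : V} {D : ℝ →L[ℝ] V}
    (h : HasMFDerivWithinAt 𝓘(ℝ, ℝ) 𝓘(ℝ, V) F s t D) (hv : D 1 = v) : HasVel V F s t v := by
  have e : ((1 : ℝ →L[ℝ] ℝ).smulRight v) = D := by
    ext; simp [hv]
  exact (congrArg (fun D' : ℝ →L[ℝ] V =>
    HasMFDerivWithinAt 𝓘(ℝ, ℝ) 𝓘(ℝ, V) F s t D') e).mpr h

theorem HasVel.continuousWithinAt {F : ℝ → M} {s : Set ℝ} {t : ℝ} {v : V}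
    (h : HasVel V F s t v) : ContinuousWithinAt F s t := h.1

theorem HasVel.mono {F : ℝ → M} {s s' : Set ℝ} {t : ℝ} {v : V}
    (h : HasVel V F s t v) (hs : s' ⊆ s) : HasVel V F s' t v := HasMFDerivWithinAt.mono h hs

theorem HasVel.union {F : ℝ → M} {s s' : Set ℝ} {t : ℝ} {v : V}
    (h : HasVel V F s t v) (h' : HasVel V F s' t v) : HasVel V F (s ∪ s') t v :=
  HasMFDerivWithinAt.union h h'

theorem HasVel.congr {F F' : ℝ → M} {s : Set ℝ} {t : ℝ} {v : V}
    (h : HasVel V F s t v) (hs : ∀ τ ∈ s, F' τ = F τ) (ht : F' t = F t) : HasVel V F' s t v :=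
  hasVel_of_hasMFDerivWithinAt (D := (1 : ℝ →L[ℝ] ℝ).smulRight v)
    (HasMFDerivWithinAt.congr_mono (f := F) (f' := (1 : ℝ →L[ℝ] ℝ).smulRight v) h hs ht subset_rfl)
    (by simp)

theorem HasVel.congr_nhds {F : ℝ → M} {s s' : Set ℝ} {t : ℝ} {v : V}
    (h : HasVel V F s t v) (hs : s ∈ nhdsWithin t s') : HasVel V F s' t v :=
  HasMFDerivWithinAt.mono_of_mem_nhdsWithin h hs

theorem hasVel_const (c : M) (s : Set ℝ) (t : ℝ) : HasVel V (fun _ => c) s t 0 :=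
  hasVel_of_hasMFDerivWithinAt (D := 0) (hasMFDerivAt_const c t).hasMFDerivWithinAt rfl

theorem hasVel_iff_hasDerivWithinAt {F : ℝ → V} {s : Set ℝ} {t : ℝ} {v : V} :
    HasVel V F s t v ↔ HasDerivWithinAt F v s t := by
  unfold HasVel
  rw [hasDerivWithinAt_iff_hasFDerivWithinAt]
  exact hasMFDerivWithinAt_iff_hasFDerivWithinAt

theorem HasVel.comp {f : M → N} {F : ℝ → M} {s : Set ℝ} {t : ℝ} {v : V}
    (hf : MDifferentiableAt 𝓘(ℝ, V) 𝓘(ℝ, W) f (F t)) (h : HasVel V F s t v) :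
    HasVel W (fun τ => f (F τ)) s t (td V W f (F t) v) := by
  refine hasVel_of_hasMFDerivWithinAt (D := (td V W f (F t)).comp
    ((1 : ℝ →L[ℝ] ℝ).smulRight v)) (hf.hasMFDerivAt.comp_hasMFDerivWithinAt t h) ?_
  simp

theorem HasVel.comp₂ {f : M → N → P} {F : ℝ → M} {K : ℝ → N} {s : Set ℝ} {t : ℝ} {v : V} {w : W}
    (hf : MDifferentiableAt (𝓘(ℝ, V).prod 𝓘(ℝ, W)) 𝓘(ℝ, U) (fun p : M × N => f p.1 p.2) (F t, K t))
    (hF : HasVel V F s t v) (hK : HasVel W K s t w) :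
    HasVel U (fun τ => f (F τ) (K τ)) s t
      (td V U (fun x => f x (K t)) (F t) v + td W U (fun y => f (F t) y) (K t) w) := by
  refine hasVel_of_hasMFDerivWithinAt (D := ContinuousLinearMap.comp (M₂ := V × W)
    (mfderiv (𝓘(ℝ, V).prod 𝓘(ℝ, W)) 𝓘(ℝ, U) (fun p : M × N => f p.1 p.2) (F t, K t))
    (((1 : ℝ →L[ℝ] ℝ).smulRight v).prod ((1 : ℝ →L[ℝ] ℝ).smulRight w)))
    (HasMFDerivAt.comp_hasMFDerivWithinAt (I' := 𝓘(ℝ, V).prod 𝓘(ℝ, W)) t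
    (g := fun p : M × N => f p.1 p.2) hf.hasMFDerivAt (HasMFDerivWithinAt.prodMk hF hK)) ?_
  have h3 := mfderiv_prod_eq_add_apply hf (v := ((1 : ℝ) • v, (1 : ℝ) • w))
  refine Eq.trans h3 ?_
  rw [one_smul, one_smul]
  rfl

/-- The derivative of a two-variable map along a pair of maps. -/
theorem td_comp₂ {X : Type*} [NormedAddCommGroup X] [NormedSpace ℝ X]
    {Q : Type*} [TopologicalSpace Q] [ChartedSpace X Q]
    {f : M → N → P} {F : Q → M} {K : Q → N} {q : Q}
    (hf : MDifferentiableAt (𝓘(ℝ, V).prod 𝓘(ℝ, W)) 𝓘(ℝ, U) (fun p : M × N => f p.1 p.2) (F q, K q))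
    (hF : MDifferentiableAt 𝓘(ℝ, X) 𝓘(ℝ, V) F q) (hK : MDifferentiableAt 𝓘(ℝ, X) 𝓘(ℝ, W) K q)
    (x : X) :
    td X U (fun q => f (F q) (K q)) q x =
      td V U (fun y => f y (K q)) (F q) (td X V F q x)
        + td W U (fun y => f (F q) y) (K q) (td X W K q x) := by
  have h1 := (HasMFDerivAt.comp (I' := 𝓘(ℝ, V).prod 𝓘(ℝ, W)) q
    (g := fun p : M × N => f p.1 p.2) hf.hasMFDerivAt
    (HasMFDerivAt.prodMk hF.hasMFDerivAt hK.hasMFDerivAt)).mfderiv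
  have h3 := mfderiv_prod_eq_add_apply hf (v := (td X V F q x, td X W K q x))
  exact (DFunLike.congr_fun h1 x).trans h3

end Calculus

/-! ## Logarithmic derivatives of curves in a Lie group -/

section LogDeriv

variable (V W : Type*)
  [NormedAddCommGroup V] [NormedSpace ℝ V]
  [NormedAddCommGroup W] [NormedSpace ℝ W]
  {G : Type*} [TopologicalSpace G] [ChartedSpace V G] [Group G]
  {G' : Type*} [TopologicalSpace G'] [ChartedSpace W G'] [Group G']

/-- The adjoint representation of a Lie group. -/
def Ad (g : G) : V →L[ℝ] V := td V V (fun h : G => g * h * g⁻¹) 1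

/-- The curve `F` satisfies `F' = F a` at `t` within `s`. -/
def HasLD (F : ℝ → G) (s : Set ℝ) (t : ℝ) (a : V) : Prop :=
  HasVel V F s t (td V V (fun h : G => F t * h) 1 a)

variable {V W}

/-- Near each time the curve stays in the chart at its current point, where the mean value
inequality makes it constant; connectedness of the interval makes this global. Only one chart is
used at a time, so no separation axiom on the manifold is needed. -/
theorem eq_of_hasVel_zero {M : Type*} [TopologicalSpace M] [ChartedSpace V M]
    [IsManifold 𝓘(ℝ, V) ∞ M] {F : ℝ → M} {s : Set ℝ} (hs : Convex ℝ s)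
    (h : ∀ t ∈ s, HasVel V F s t 0) {t t' : ℝ} (ht : t ∈ s) (ht' : t' ∈ s) : F t = F t' := by
  have : IsManifold 𝓘(ℝ, V) 1 M := IsManifold.of_le (n := ∞) (by norm_cast)
  refine hs.isPreconnected.induction₂ (fun x y => F x = F y) ?_
    (fun x y z _ _ _ hxy hyz => hxy.trans hyz) (fun x y _ _ hxy => hxy.symm) ht ht'
  intro x hx
  have h1 : ∀ᶠ y in nhdsWithin x s, F y ∈ (chartAt V (F x)).source :=
    (h x hx).continuousWithinAt.eventually
      ((chartAt V (F x)).open_source.mem_nhds (mem_chart_source V (F x)))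
  obtain ⟨δ, hδ, hball⟩ := Metric.mem_nhdsWithin_iff.1 h1
  filter_upwards [inter_mem_nhdsWithin s (Metric.ball_mem_nhds x hδ)] with y hy
  have hyu : y ∈ Metric.ball x δ ∩ s := ⟨hy.2, hy.1⟩
  have hxu : x ∈ Metric.ball x δ ∩ s := ⟨Metric.mem_ball_self hδ, hx⟩
  have hconv : Convex ℝ (Metric.ball x δ ∩ s) := (convex_ball x δ).inter hs
  have hd : ∀ τ ∈ Metric.ball x δ ∩ s,
      HasDerivWithinAt (fun τ => extChartAt 𝓘(ℝ, V) (F x) (F τ)) 0 (Metric.ball x δ ∩ s) τ := by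
    intro τ hτ
    have h2 := ((h τ hτ.2).mono (inter_subset_right (s := Metric.ball x δ))).comp
      (mdifferentiableAt_extChartAt (I := 𝓘(ℝ, V)) (hball hτ))
    rw [map_zero] at h2
    exact hasVel_iff_hasDerivWithinAt.1 h2
  have h3 := hconv.norm_image_sub_le_of_norm_hasDerivWithin_le (C := 0) hd (by simp) hxu hyu
  have h4 : extChartAt 𝓘(ℝ, V) (F x) (F y) = extChartAt 𝓘(ℝ, V) (F x) (F x) := by
    rw [← sub_eq_zero, ← norm_le_zero_iff]; simpa using h3
  refine ((extChartAt 𝓘(ℝ, V) (F x)).injOn ?_ ?_ h4).symm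
  · rw [extChartAt_source]; exact hball hyu
  · exact mem_extChartAt_source _

variable [LieGroup 𝓘(ℝ, V) ∞ G] [LieGroup 𝓘(ℝ, W) ∞ G']

theorem isManifold_of_lieGroup : IsManifold 𝓘(ℝ, V) ∞ G :=
  (‹LieGroup 𝓘(ℝ, V) ∞ G›).toContMDiffMul.toIsManifold

theorem mdifferentiableAt_mul (p : G × G) :
    MDifferentiableAt (𝓘(ℝ, V).prod 𝓘(ℝ, V)) 𝓘(ℝ, V) (fun p : G × G => p.1 * p.2) p :=
  (contMDiff_mul 𝓘(ℝ, V) ∞).mdifferentiable (by simp) p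

theorem mdifferentiableAt_mul_left (g h : G) :
    MDifferentiableAt 𝓘(ℝ, V) 𝓘(ℝ, V) (fun h : G => g * h) h :=
  (contMDiff_mul_left (n := ∞)).mdifferentiable (by simp) h

theorem mdifferentiableAt_mul_right (g h : G) :
    MDifferentiableAt 𝓘(ℝ, V) 𝓘(ℝ, V) (fun h : G => h * g) h :=
  (contMDiff_mul_right (n := ∞)).mdifferentiable (by simp) h

theorem mdifferentiableAt_inv (g : G) :
    MDifferentiableAt 𝓘(ℝ, V) 𝓘(ℝ, V) (fun h : G => h⁻¹) g :=
  (contMDiff_inv 𝓘(ℝ, V) ∞).mdifferentiable (by simp) g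

theorem mdifferentiableAt_conj (g h : G) :
    MDifferentiableAt 𝓘(ℝ, V) 𝓘(ℝ, V) (fun h : G => g * h * g⁻¹) h :=
  (mdifferentiableAt_mul_right g⁻¹ (g * h)).comp h (mdifferentiableAt_mul_left g h)

theorem td_mul_left_mul (g h : G) (a : V) :
    td V V (fun k : G => g * k) h (td V V (fun k : G => h * k) 1 a)
      = td V V (fun k : G => g * h * k) 1 a := by
  have := td_comp (x := (1 : G)) (f := fun k : G => h * k) (g := fun k : G => g * k)
    (mdifferentiableAt_mul_left (V := V) g _) (mdifferentiableAt_mul_left (V := V) h _) a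
  simp only [mul_one, ← mul_assoc] at this
  exact this.symm

/-- Differentiates g(g⁻¹kg) = kg at k = 1. It is the dictionary between the right translates
produced by variation of parameters and the left translates in the definition of the holonomies. -/
theorem td_mul_left_Ad (g : G) (a : V) :
    td V V (fun k : G => g * k) 1 (Ad V g⁻¹ a) = td V V (fun k : G => k * g) 1 a := by
  have := td_comp (x := (1 : G)) (f := fun k : G => g⁻¹ * k * g⁻¹⁻¹) (g := fun k : G => g * k)
    (mdifferentiableAt_mul_left (V := V) g _) (mdifferentiableAt_conj (V := V) g⁻¹ _) a
  simp only [inv_inv, mul_one, inv_mul_cancel, mul_assoc, mul_inv_cancel_left] at this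
  rw [this]
  simp only [Ad, inv_inv, mul_assoc]

theorem Ad_mul (g h : G) (a : V) : Ad V (g * h) a = Ad V g (Ad V h a) := by
  have := td_comp (x := (1 : G)) (f := fun k : G => h * k * h⁻¹) (g := fun k : G => g * k * g⁻¹)
    (mdifferentiableAt_conj (V := V) g _) (mdifferentiableAt_conj (V := V) h _) a
  simp only [mul_one, mul_inv_cancel] at this
  rw [Ad, Ad, Ad, ← this]
  simp only [mul_inv_rev, mul_assoc]

omit [LieGroup 𝓘(ℝ, V) ∞ G] in
theorem Ad_one (a : V) : Ad V (1 : G) a = a := by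
  simp only [Ad, one_mul, inv_one, mul_one]
  exact td_id _ _

theorem Ad_inv_Ad (g : G) (a : V) : Ad V g⁻¹ (Ad V g a) = a := by
  rw [← Ad_mul, inv_mul_cancel, Ad_one]

theorem hasVel_mul_right_iff {F : ℝ → G} {s : Set ℝ} {t : ℝ} {a : V} :
    HasVel V F s t (td V V (fun h : G => h * F t) 1 a) ↔ HasLD V F s t (Ad V (F t)⁻¹ a) := by
  rw [HasLD, td_mul_left_Ad]

/-- The term b comes from K directly; moving a from the left of K to its right conjugates it by K⁻¹.
The computation compares the two orders of left and right translation, which commute. -/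
theorem HasLD.mul {F K : ℝ → G} {s : Set ℝ} {t : ℝ} {a b : V}
    (hF : HasLD V F s t a) (hK : HasLD V K s t b) :
    HasLD V (fun τ => F τ * K τ) s t (Ad V (K t)⁻¹ a + b) := by
  have h := HasVel.comp₂ (f := fun x y : G => x * y) (mdifferentiableAt_mul _) hF hK
  have e : td V V (fun k : G => k * K t) (F t) (td V V (fun k : G => F t * k) 1 a)
      = td V V (fun k : G => F t * K t * k) 1 (Ad V (K t)⁻¹ a) := by
    rw [← td_mul_left_mul, td_mul_left_Ad]
    have h1 := td_comp (x := (1 : G)) (f := fun k : G => F t * k) (g := fun k : G => k * K t)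
      (mdifferentiableAt_mul_right (V := V) (K t) _) (mdifferentiableAt_mul_left (V := V) (F t) _) a
    have h2 := td_comp (x := (1 : G)) (f := fun k : G => k * K t) (g := fun k : G => F t * k)
      (mdifferentiableAt_mul_left (V := V) (F t) _) (mdifferentiableAt_mul_right (V := V) (K t) _) a
    simp only [mul_one, one_mul, mul_assoc] at h1 h2
    rw [← h1, ← h2]
  rw [e, td_mul_left_mul, ← map_add] at h
  exact h

/-- Differentiates h h⁻¹ = 1. -/
theorem td_inv_one (a : V) : td V V (fun h : G => h⁻¹) 1 a = -a := by
  have h := td_comp₂ (f := fun x y : G => x * y) (F := fun x : G => x) (K := fun x : G => x⁻¹)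
    (q := (1 : G)) (mdifferentiableAt_mul _) mdifferentiableAt_id (mdifferentiableAt_inv (V := V) _) a
  simp only [mul_inv_cancel, inv_one, mul_one, one_mul] at h
  rw [td_const, td_id, td_id, td_id] at h
  exact (neg_eq_of_add_eq_zero_right h.symm).symm

theorem HasLD.inv {F : ℝ → G} {s : Set ℝ} {t : ℝ} {a : V} (hF : HasLD V F s t a) :
    HasLD V (fun τ => (F τ)⁻¹) s t (-Ad V (F t) a) := by
  have h := HasVel.comp (f := fun x : G => x⁻¹) (mdifferentiableAt_inv _) hF
  have h1 := td_comp (x := (1 : G)) (f := fun k : G => F t * k) (g := fun k : G => k⁻¹)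
      (mdifferentiableAt_inv (V := V) _) (mdifferentiableAt_mul_left (V := V) (F t) _) a
  have h2 := td_comp (x := (1 : G)) (f := fun k : G => k⁻¹) (g := fun k : G => k * (F t)⁻¹)
      (mdifferentiableAt_mul_right (V := V) _ _) (mdifferentiableAt_inv (V := V) _) a
  simp only [mul_one, mul_inv_rev, inv_one, td_inv_one] at h1 h2
  rw [← h1, h2, ← td_mul_left_Ad, inv_inv, map_neg] at h
  exact h

omit [LieGroup 𝓘(ℝ, V) ∞ G] in
theorem HasLD.mono {F : ℝ → G} {s s' : Set ℝ} {t : ℝ} {a : V}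
    (hF : HasLD V F s t a) (hs : s' ⊆ s) : HasLD V F s' t a :=
  HasVel.mono hF hs

omit [LieGroup 𝓘(ℝ, V) ∞ G] in
theorem HasLD.congr {F F' : ℝ → G} {s : Set ℝ} {t : ℝ} {a : V}
    (hF : HasLD V F s t a) (hs : ∀ τ ∈ s, F' τ = F τ) (ht : F' t = F t) : HasLD V F' s t a := by
  unfold HasLD
  rw [ht]
  exact HasVel.congr hF hs ht

omit [LieGroup 𝓘(ℝ, V) ∞ G] in
theorem hasLD_const (g : G) (s : Set ℝ) (t : ℝ) : HasLD V (fun _ => g) s t 0 := by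
  unfold HasLD
  rw [map_zero]
  exact hasVel_const g s t

theorem HasLD.mul_const_left {F : ℝ → G} {s : Set ℝ} {t : ℝ} {a : V} (hF : HasLD V F s t a)
    (g : G) : HasLD V (fun τ => g * F τ) s t a := by
  simpa using (hasLD_const g s t).mul hF

theorem HasLD.map {F : ℝ → G} {s : Set ℝ} {t : ℝ} {a : V} (hF : HasLD V F s t a)
    (f : G →* G') (hf : MDifferentiable 𝓘(ℝ, V) 𝓘(ℝ, W) f) :
    HasLD W (fun τ => f (F τ)) s t (td V W f 1 a) := by
  have h := HasVel.comp (f := f) (hf _) hF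
  have h1 := td_comp (x := (1 : G)) (f := fun k : G => F t * k) (g := f)
    (hf _) (mdifferentiableAt_mul_left (V := V) (F t) _) a
  have h2 := td_comp (x := (1 : G)) (f := f) (g := fun k : G' => f (F t) * k)
    (mdifferentiableAt_mul_left (V := W) _ _) (hf _) a
  simp only [mul_one, map_mul, map_one] at h1 h2
  rw [← h1, h2] at h
  exact h

/-- The logarithmic derivative of F K⁻¹ is Ad_K(A) − Ad_K(A) = 0, so this quotient is constant. -/
theorem eqOn_of_hasLD {A : ℝ → V} {F K : ℝ → G} {s : Set ℝ} (hs : Convex ℝ s)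
    (hF : ∀ t ∈ s, HasLD V F s t (A t)) (hK : ∀ t ∈ s, HasLD V K s t (A t))
    {t₀ : ℝ} (ht₀ : t₀ ∈ s) (h0 : F t₀ = K t₀) : EqOn F K s := by
  intro t ht
  have : IsManifold 𝓘(ℝ, V) ∞ G := isManifold_of_lieGroup
  have h : ∀ t ∈ s, HasVel V (fun τ => F τ * (K τ)⁻¹) s t 0 := by
    intro t ht
    have h1 := (hF t ht).mul (hK t ht).inv
    rw [inv_inv, add_neg_cancel] at h1
    unfold HasLD at h1
    rwa [map_zero] at h1
  have h2 := eq_of_hasVel_zero hs h ht ht₀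
  simp only [h0, mul_inv_cancel] at h2
  exact mul_inv_eq_one.1 h2

end LogDeriv

/-! ### Picard–Lindelöf for small coefficients, with a quadratic error bound -/

section SmallODE

open Metric
open scoped NNReal

variable {V : Type*} [NormedAddCommGroup V] [NormedSpace ℝ V] [CompleteSpace V]

/-- Solutions of `y' = P(y) c(t)`, with `P` of class `C¹` near `e` and `P(e) = 1`, for small
coefficients `c`. -/
theorem exists_smallODE {P : V → V →L[ℝ] V} {e : V} (hP : ContDiffAt ℝ 1 P e)
    (hPe : P e = ContinuousLinearMap.id ℝ V) {T : Set V} (hT : T ∈ nhds e) :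
    ∃ η > 0, ∃ C ≥ 0, ∀ (a b : ℝ) (_ : a ≤ b) (c : ℝ → V) (_ : Continuous c) (κ : ℝ),
      0 ≤ κ → (∀ t ∈ Icc a b, ‖c t‖ ≤ κ) → κ * (b - a) ≤ η →
      ∃ y : ℝ → V, y a = e ∧ ∀ t ∈ Icc a b, y t ∈ T ∧
        HasDerivWithinAt y (P (y t) (c t)) (Icc a b) t ∧
        ‖y t - e - ∫ τ in a..t, c τ‖ ≤ C * (κ * (b - a)) ^ 2 := by
  obtain ⟨K, s, hs, hK⟩ := hP.exists_lipschitzOnWith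
  obtain ⟨r, hr, hball⟩ := Metric.nhds_basis_closedBall.mem_iff.1 (Filter.inter_mem hs hT)
  have hsub : closedBall e (min r (1 / (K + 1))) ⊆ s ∩ T :=
    (closedBall_subset_closedBall (min_le_left _ _)).trans hball
  set ρ : ℝ := min r (1 / (K + 1)) with hρ
  have hρ0 : 0 < ρ := lt_min hr (by positivity)
  have hPlip : ∀ y ∈ closedBall e ρ, ‖P y - P e‖ ≤ K * ‖y - e‖ := fun y hy =>
    hK.norm_sub_le (hsub hy).1 (hsub (mem_closedBall_self hρ0.le)).1
  have hPnorm : ∀ y ∈ closedBall e ρ, ‖P y‖ ≤ 2 := by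
    intro y hy
    have h1 := hPlip y hy
    have h2 : ‖y - e‖ ≤ 1 / (K + 1) := (mem_closedBall_iff_norm.1 hy).trans (min_le_right _ _)
    have h3 : (K : ℝ) * ‖y - e‖ ≤ 1 := by
      calc (K : ℝ) * ‖y - e‖ ≤ K * (1 / (K + 1)) := by gcongr
        _ ≤ 1 := by rw [mul_one_div, div_le_one (by positivity)]; linarith
    have h4 : ‖P e‖ ≤ 1 := by rw [hPe]; exact ContinuousLinearMap.norm_id_le
    calc ‖P y‖ = ‖(P y - P e) + P e‖ := by rw [sub_add_cancel]
      _ ≤ ‖P y - P e‖ + ‖P e‖ := norm_add_le _ _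
      _ ≤ 2 := by linarith
  -- With speed at most 2κ the solution moves at most 2κ(b − a) ≤ ρ, so it remains in the ball. The
  -- error integrand is at most K · 2κ(b − a) · κ, whence the constant 2K.
  refine ⟨ρ / 2, by positivity, 2 * K, by positivity, ?_⟩
  intro a b hab c hc κ hκ hcκ hη
  lift κ to ℝ≥0 using hκ
  lift ρ to ℝ≥0 using hρ0.le with ρ' hρ'
  have hf : IsPicardLindelof (fun t y => P y (c t)) (⟨a, left_mem_Icc.2 hab⟩ : Icc a b) e
      ρ' 0 (2 * κ) (K * κ) := by
    refine ⟨fun t ht => ?_, fun y _ => ((P y).continuous.comp hc).continuousOn, fun t ht y hy => ?_,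
      ?_⟩
    · refine LipschitzOnWith.of_dist_le_mul fun y hy z hz => ?_
      rw [dist_eq_norm, dist_eq_norm]
      calc ‖P y (c t) - P z (c t)‖ = ‖(P y - P z) (c t)‖ := rfl
        _ ≤ ‖P y - P z‖ * ‖c t‖ := ContinuousLinearMap.le_opNorm _ _
        _ ≤ (K * ‖y - z‖) * κ := by
          gcongr
          · exact hK.norm_sub_le (hsub hy).1 (hsub hz).1
          · exact hcκ t ht
        _ = ↑(K * κ) * ‖y - z‖ := by push_cast; ring
    · calc ‖P y (c t)‖ ≤ ‖P y‖ * ‖c t‖ := ContinuousLinearMap.le_opNorm _ _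
        _ ≤ 2 * κ := by
          gcongr
          · exact hPnorm y hy
          · exact hcκ t ht
        _ = ↑(2 * κ) := by push_cast; ring
    · simp only [sub_self, NNReal.coe_zero, sub_zero]
      rw [max_eq_left (sub_nonneg.2 hab)]
      push_cast
      linarith
  -- Working with the fixed point itself, and not just with the existence of a solution, keeps the
  -- information that the solution never leaves the closed ball.
  obtain ⟨α, hα⟩ := ODE.FunSpace.exists_isFixedPt_next hf (mem_closedBall_self le_rfl)
  have hy0 : α.compProj a = e := by
    have := ODE.FunSpace.compProj_val (α := α) (t := ⟨a, left_mem_Icc.2 hab⟩)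
    exact this.trans α.apply_of_zero
  have hmem : ∀ t, α.compProj t ∈ closedBall e ρ' := fun t =>
    α.compProj_mem_closedBall hf.mul_max_le
  have hderiv : ∀ t ∈ Icc a b,
      HasDerivWithinAt α.compProj (P (α.compProj t) (c t)) (Icc a b) t := by
    intro t ht
    apply ODE.hasDerivWithinAt_picard_Icc (left_mem_Icc.2 hab) hf.continuousOn_uncurry
      α.continuous_compProj.continuousOn (fun _ _ => hmem _) e ht |>.congr_of_mem _ ht
    intro t' ht'
    nth_rw 1 [← hα]
    rw [ODE.FunSpace.compProj_of_mem ht', ODE.FunSpace.next_apply]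
  refine ⟨α.compProj, hy0, fun t ht => ⟨(hsub (hmem t)).2, hderiv t ht, ?_⟩⟩
  have ha : a ∈ Icc a b := left_mem_Icc.2 hab
  have hdist : ∀ τ ∈ Icc a b, ‖α.compProj τ - e‖ ≤ 2 * (κ * (b - a)) := by
    intro τ hτ
    have h := (convex_Icc a b).norm_image_sub_le_of_norm_hasDerivWithin_le (C := 2 * κ) hderiv
      (fun x hx => hf.norm_le x hx _ (hmem x)) ha hτ
    rw [hy0, Real.norm_of_nonneg (sub_nonneg.2 hτ.1)] at h
    refine h.trans ?_
    have : (κ : ℝ) * (τ - a) ≤ κ * (b - a) := by gcongr; exact hτ.2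
    linarith
  have hd2 : ∀ τ ∈ Icc a b, HasDerivWithinAt (fun τ => α.compProj τ - ∫ σ in a..τ, c σ)
      (P (α.compProj τ) (c τ) - c τ) (Icc a b) τ := fun τ hτ =>
    (hderiv τ hτ).sub (hc.integral_hasStrictDerivAt a τ).hasDerivAt.hasDerivWithinAt
  have hbd : ∀ τ ∈ Icc a b, ‖P (α.compProj τ) (c τ) - c τ‖ ≤ K * (2 * (κ * (b - a))) * κ := by
    intro τ hτ
    calc ‖P (α.compProj τ) (c τ) - c τ‖ = ‖(P (α.compProj τ) - P e) (c τ)‖ := by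
          rw [hPe]; rfl
      _ ≤ ‖P (α.compProj τ) - P e‖ * ‖c τ‖ := ContinuousLinearMap.le_opNorm _ _
      _ ≤ K * (2 * (κ * (b - a))) * κ := by
          gcongr
          · exact (hPlip _ (hmem τ)).trans (by gcongr; exact hdist τ hτ)
          · exact hcκ τ hτ
  have h := (convex_Icc a b).norm_image_sub_le_of_norm_hasDerivWithin_le hd2 hbd ha ht
  simp only [hy0, intervalIntegral.integral_same, sub_zero] at h
  rw [Real.norm_of_nonneg (sub_nonneg.2 ht.1)] at h
  have h5 : K * (2 * (κ * (b - a))) * κ * (t - a) ≤ K * (2 * (κ * (b - a))) * κ * (b - a) := by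
    have : 0 ≤ b - a := sub_nonneg.2 hab
    gcongr
    exact ht.2
  calc ‖α.compProj t - e - ∫ τ in a..t, c τ‖ = ‖α.compProj t - (∫ τ in a..t, c τ) - e‖ := by
        congr 1; abel
    _ ≤ _ := h.trans h5
    _ = _ := by ring

end SmallODE

/-! ### Derivatives of charts, and smooth dependence of derivatives on parameters -/

section Charts

variable {V : Type*} [NormedAddCommGroup V] [NormedSpace ℝ V]
  {M : Type*} [TopologicalSpace M] [ChartedSpace V M] [IsManifold 𝓘(ℝ, V) ∞ M]

theorem mdifferentiableAt_chart {p₀ g : M} (hg : g ∈ (extChartAt 𝓘(ℝ, V) p₀).source) :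
    MDifferentiableAt 𝓘(ℝ, V) 𝓘(ℝ, V) (extChartAt 𝓘(ℝ, V) p₀) g := by
  have : IsManifold 𝓘(ℝ, V) 1 M := IsManifold.of_le (n := ∞) (by norm_cast)
  rw [extChartAt_source] at hg
  exact mdifferentiableAt_extChartAt hg

theorem contMDiffAt_chart_symm {p₀ : M} {y : V} (hy : y ∈ (extChartAt 𝓘(ℝ, V) p₀).target) :
    ContMDiffAt 𝓘(ℝ, V) 𝓘(ℝ, V) ∞ (extChartAt 𝓘(ℝ, V) p₀).symm y :=
  (contMDiffOn_extChartAt_symm p₀).contMDiffAt ((isOpen_extChartAt_target p₀).mem_nhds hy)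

theorem mdifferentiableAt_chart_symm {p₀ : M} {y : V}
    (hy : y ∈ (extChartAt 𝓘(ℝ, V) p₀).target) :
    MDifferentiableAt 𝓘(ℝ, V) 𝓘(ℝ, V) (extChartAt 𝓘(ℝ, V) p₀).symm y :=
  (contMDiffAt_chart_symm hy).mdifferentiableAt (by simp)

theorem td_chart_symm_td_chart {p₀ : M} {y : V} (hy : y ∈ (extChartAt 𝓘(ℝ, V) p₀).target)
    (v : V) : td V V (extChartAt 𝓘(ℝ, V) p₀).symm y
      (td V V (extChartAt 𝓘(ℝ, V) p₀) ((extChartAt 𝓘(ℝ, V) p₀).symm y) v) = v := by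
  have : IsManifold 𝓘(ℝ, V) 1 M := IsManifold.of_le (n := ∞) (by norm_cast)
  have h := mfderivWithin_extChartAt_symm_comp_mfderiv_extChartAt hy
  rw [modelWithCornersSelf_coe, range_id, mfderivWithin_univ] at h
  exact DFunLike.congr_fun h v

theorem td_chart_self (p₀ : M) (v : V) : td V V (extChartAt 𝓘(ℝ, V) p₀) p₀ v = v := by
  have : IsManifold 𝓘(ℝ, V) 1 M := IsManifold.of_le (n := ∞) (by norm_cast)
  exact DFunLike.congr_fun (mfderiv_extChartAt_self (I := 𝓘(ℝ, V)) (x := p₀)) v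

theorem td_chart_symm_self (p₀ : M) (v : V) :
    td V V (extChartAt 𝓘(ℝ, V) p₀).symm (extChartAt 𝓘(ℝ, V) p₀ p₀) v = v := by
  have h := td_chart_symm_td_chart (mem_extChartAt_target (I := 𝓘(ℝ, V)) p₀) v
  rwa [extChartAt_to_inv, td_chart_self] at h

/-- If all the maps `Φ n` agree at `x₀`, their derivatives at `x₀` depend smoothly on `n`. -/
theorem contMDiff_td {W U : Type*} [NormedAddCommGroup W] [NormedSpace ℝ W]
    [NormedAddCommGroup U] [NormedSpace ℝ U]
    {N P : Type*} [TopologicalSpace N] [ChartedSpace W N] [IsManifold 𝓘(ℝ, W) ∞ N]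
    [TopologicalSpace P] [ChartedSpace U P] [IsManifold 𝓘(ℝ, U) ∞ P]
    {Φ : N → M → P} {x₀ : M} {c : P}
    (hΦ : ContMDiff (𝓘(ℝ, W).prod 𝓘(ℝ, V)) 𝓘(ℝ, U) ∞ (fun p : N × M => Φ p.1 p.2))
    (hc : ∀ n, Φ n x₀ = c) :
    ContMDiff 𝓘(ℝ, W) 𝓘(ℝ, V →L[ℝ] U) ∞ (fun n => td V U (Φ n) x₀) := by
  have : IsManifold 𝓘(ℝ, V) 1 M := IsManifold.of_le (n := ∞) (by norm_cast)
  have : IsManifold 𝓘(ℝ, U) 1 P := IsManifold.of_le (n := ∞) (by norm_cast)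
  have : IsManifold 𝓘(ℝ, W) 1 N := IsManifold.of_le (n := ∞) (by norm_cast)
  intro n₀
  have h := ContMDiffAt.mfderiv (I := 𝓘(ℝ, V)) (I' := 𝓘(ℝ, U)) (J := 𝓘(ℝ, W)) (n := ∞) (m := ∞)
    (x₀ := n₀) Φ (fun _ => x₀) (hΦ (n₀, x₀)) contMDiffAt_const (by norm_cast)
  refine h.congr_of_eventuallyEq (Filter.Eventually.of_forall fun n => ?_)
  refine Eq.trans ?_ (inTangentCoordinates_eq (f := fun _ => x₀) (g := fun n => Φ n x₀)
    (ϕ := fun n => td V U (Φ n) x₀) (mem_chart_source V x₀)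
    (by simp only [hc]; exact mem_chart_source U c)).symm
  ext v
  -- Base point and image point do not depend on n, so the coordinate changes of the two tangent
  -- bundles are those from a chart to itself.
  have h1 : ∀ v, (tangentBundleCore 𝓘(ℝ, V) M).coordChange (achart V x₀) (achart V x₀) x₀ v = v :=
    (tangentBundleCore 𝓘(ℝ, V) M).coordChange_self (achart V x₀) x₀ (mem_chart_source V x₀)
  have h2 : ∀ v, (tangentBundleCore 𝓘(ℝ, U) P).coordChange (achart U c) (achart U c) c v = v :=
    (tangentBundleCore 𝓘(ℝ, U) P).coordChange_self (achart U c) c (mem_chart_source U c)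
  simp only [hc, ContinuousLinearMap.comp_apply, h1, h2]

end Charts

/-! ### The group law in the chart at the identity; the Lie bracket as the derivative of `Ad` -/

section GroupChart

variable {V : Type*} [NormedAddCommGroup V] [NormedSpace ℝ V]
  (G : Type*) [TopologicalSpace G] [ChartedSpace V G] [Group G]

/-- The multiplication of a Lie group in the preferred chart at the identity. -/
def chartMul (y z : V) : V :=
  extChartAt 𝓘(ℝ, V) (1 : G)
    ((extChartAt 𝓘(ℝ, V) (1 : G)).symm y * (extChartAt 𝓘(ℝ, V) (1 : G)).symm z)

/-- The derivative at the identity of left multiplication, in the preferred chart. -/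
def chartL (y : V) : V →L[ℝ] V := fderiv ℝ (chartMul G y) (extChartAt 𝓘(ℝ, V) (1 : G) 1)

/-- The derivative at the identity of right multiplication, in the preferred chart. -/
def chartR (y : V) : V →L[ℝ] V :=
  fderiv ℝ (fun z => chartMul G z y) (extChartAt 𝓘(ℝ, V) (1 : G) 1)

variable [LieGroup 𝓘(ℝ, V) ∞ G]

theorem contDiffAt_chartMul :
    ContDiffAt ℝ ∞ (fun p : V × V => chartMul G p.1 p.2)
      (extChartAt 𝓘(ℝ, V) (1 : G) 1, extChartAt 𝓘(ℝ, V) (1 : G) 1) := by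
  have : IsManifold 𝓘(ℝ, V) ∞ G := isManifold_of_lieGroup
  have hs := contMDiffAt_chart_symm (mem_extChartAt_target (I := 𝓘(ℝ, V)) (1 : G))
  have h1 : ContMDiffAt 𝓘(ℝ, V × V) 𝓘(ℝ, V) ∞
      (fun p : V × V => (extChartAt 𝓘(ℝ, V) (1 : G)).symm p.1)
      (extChartAt 𝓘(ℝ, V) (1 : G) 1, extChartAt 𝓘(ℝ, V) (1 : G) 1) :=
    ContMDiffAt.comp (I' := 𝓘(ℝ, V)) _ hs contDiff_fst.contMDiff.contMDiffAt
  have h2 : ContMDiffAt 𝓘(ℝ, V × V) 𝓘(ℝ, V) ∞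
      (fun p : V × V => (extChartAt 𝓘(ℝ, V) (1 : G)).symm p.2)
      (extChartAt 𝓘(ℝ, V) (1 : G) 1, extChartAt 𝓘(ℝ, V) (1 : G) 1) :=
    ContMDiffAt.comp (I' := 𝓘(ℝ, V)) _ hs contDiff_snd.contMDiff.contMDiffAt
  have h3 := h1.mul h2
  refine contMDiffAt_iff_contDiffAt.1 (ContMDiffAt.comp (I' := 𝓘(ℝ, V)) _
    (g := extChartAt 𝓘(ℝ, V) (1 : G)) ?_ h3)
  rw [extChartAt_to_inv, mul_one]
  exact contMDiffAt_extChartAt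

theorem contDiffAt_chartL : ContDiffAt ℝ ∞ (chartL G) (extChartAt 𝓘(ℝ, V) (1 : G) 1) :=
  ContDiffAt.fderiv (f := chartMul G) (g := fun _ => extChartAt 𝓘(ℝ, V) (1 : G) 1) (n := ∞)
    (contDiffAt_chartMul G) contDiffAt_const (by norm_cast)

theorem contDiffAt_chartR : ContDiffAt ℝ ∞ (chartR G) (extChartAt 𝓘(ℝ, V) (1 : G) 1) := by
  refine ContDiffAt.fderiv (f := fun y z => chartMul G z y)
    (g := fun _ => extChartAt 𝓘(ℝ, V) (1 : G) 1) (n := ∞) ?_ contDiffAt_const (by norm_cast)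
  have h : ContDiffAt ℝ ∞ (fun p : V × V => (p.2, p.1))
    (extChartAt 𝓘(ℝ, V) (1 : G) 1, extChartAt 𝓘(ℝ, V) (1 : G) 1) := by fun_prop
  exact ContDiffAt.comp (g := fun p : V × V => chartMul G p.1 p.2)
    (extChartAt 𝓘(ℝ, V) (1 : G) 1, extChartAt 𝓘(ℝ, V) (1 : G) 1) (contDiffAt_chartMul G) h

variable {G}

theorem td_chart_mul_left {g : G} (hg : g ∈ (extChartAt 𝓘(ℝ, V) (1 : G)).source) (a : V) :
    td V V (extChartAt 𝓘(ℝ, V) (1 : G)) g (td V V (fun h : G => g * h) 1 a)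
      = chartL G (extChartAt 𝓘(ℝ, V) (1 : G) g) a := by
  have : IsManifold 𝓘(ℝ, V) ∞ G := isManifold_of_lieGroup
  have hs := mdifferentiableAt_chart_symm (mem_extChartAt_target (I := 𝓘(ℝ, V)) (1 : G))
  have h1 := td_comp (x := extChartAt 𝓘(ℝ, V) (1 : G) 1)
    (f := (extChartAt 𝓘(ℝ, V) (1 : G)).symm) (g := fun h : G => g * h)
    (mdifferentiableAt_mul_left g _) hs a
  have hc : MDifferentiableAt 𝓘(ℝ, V) 𝓘(ℝ, V) (fun y => g * (extChartAt 𝓘(ℝ, V) (1 : G)).symm y)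
      (extChartAt 𝓘(ℝ, V) (1 : G) 1) := (mdifferentiableAt_mul_left g _).comp _ hs
  have h2 := td_comp (x := extChartAt 𝓘(ℝ, V) (1 : G) 1)
    (f := fun y => g * (extChartAt 𝓘(ℝ, V) (1 : G)).symm y) (g := extChartAt 𝓘(ℝ, V) (1 : G))
    (by rw [extChartAt_to_inv, mul_one]; exact mdifferentiableAt_chart hg) hc a
  rw [h1, extChartAt_to_inv, mul_one, td_chart_symm_self, td_eq_fderiv] at h2
  rw [← h2]
  unfold chartL chartMul
  rw [(extChartAt 𝓘(ℝ, V) (1 : G)).left_inv hg]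

theorem td_chart_mul_right {g : G} (hg : g ∈ (extChartAt 𝓘(ℝ, V) (1 : G)).source) (a : V) :
    td V V (extChartAt 𝓘(ℝ, V) (1 : G)) g (td V V (fun h : G => h * g) 1 a)
      = chartR G (extChartAt 𝓘(ℝ, V) (1 : G) g) a := by
  have : IsManifold 𝓘(ℝ, V) ∞ G := isManifold_of_lieGroup
  have hs := mdifferentiableAt_chart_symm (mem_extChartAt_target (I := 𝓘(ℝ, V)) (1 : G))
  have h1 := td_comp (x := extChartAt 𝓘(ℝ, V) (1 : G) 1)
    (f := (extChartAt 𝓘(ℝ, V) (1 : G)).symm) (g := fun h : G => h * g)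
    (mdifferentiableAt_mul_right g _) hs a
  have hc : MDifferentiableAt 𝓘(ℝ, V) 𝓘(ℝ, V) (fun y => (extChartAt 𝓘(ℝ, V) (1 : G)).symm y * g)
      (extChartAt 𝓘(ℝ, V) (1 : G) 1) := (mdifferentiableAt_mul_right g _).comp _ hs
  have h2 := td_comp (x := extChartAt 𝓘(ℝ, V) (1 : G) 1)
    (f := fun y => (extChartAt 𝓘(ℝ, V) (1 : G)).symm y * g) (g := extChartAt 𝓘(ℝ, V) (1 : G))
    (by rw [extChartAt_to_inv, one_mul]; exact mdifferentiableAt_chart hg) hc a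
  rw [h1, extChartAt_to_inv, one_mul, td_chart_symm_self, td_eq_fderiv] at h2
  rw [← h2]
  unfold chartR chartMul
  rw [(extChartAt 𝓘(ℝ, V) (1 : G)).left_inv hg]

theorem chartL_one (a : V) : chartL G (extChartAt 𝓘(ℝ, V) (1 : G) 1) a = a := by
  have : IsManifold 𝓘(ℝ, V) ∞ G := isManifold_of_lieGroup
  rw [← td_chart_mul_left (mem_extChartAt_source _), td_chart_self]
  simp only [one_mul]
  exact td_id _ _

theorem chartR_one (a : V) : chartR G (extChartAt 𝓘(ℝ, V) (1 : G) 1) a = a := by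
  have : IsManifold 𝓘(ℝ, V) ∞ G := isManifold_of_lieGroup
  rw [← td_chart_mul_right (mem_extChartAt_source _), td_chart_self]
  simp only [mul_one]
  exact td_id _ _

/-- A solution of the equation in the chart gives a curve with the prescribed logarithmic
derivative. -/
theorem hasLD_of_chart {y : ℝ → V} {s : Set ℝ} {t : ℝ} {a : V}
    (hy : y t ∈ (extChartAt 𝓘(ℝ, V) (1 : G)).target)
    (h : HasDerivWithinAt y (chartL G (y t) a) s t) :
    HasLD V (fun τ => (extChartAt 𝓘(ℝ, V) (1 : G)).symm (y τ)) s t a := by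
  have : IsManifold 𝓘(ℝ, V) ∞ G := isManifold_of_lieGroup
  have h1 := HasVel.comp (mdifferentiableAt_chart_symm hy) (hasVel_iff_hasDerivWithinAt.2 h)
  have h2 := td_chart_mul_left ((extChartAt 𝓘(ℝ, V) (1 : G)).map_target hy) a
  rw [(extChartAt 𝓘(ℝ, V) (1 : G)).right_inv hy] at h2
  rwa [← h2, td_chart_symm_td_chart hy] at h1

/-! ### The differential of the adjoint representation -/

variable (V) in
/-- The derivative of the adjoint representation. -/
def adV (X Y : V) : V := td V V (fun g : G => Ad V g Y) 1 X

theorem contMDiff_Ad : ContMDiff 𝓘(ℝ, V) 𝓘(ℝ, V →L[ℝ] V) ∞ (fun g : G => Ad V g) := by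
  have : IsManifold 𝓘(ℝ, V) ∞ G := isManifold_of_lieGroup
  refine contMDiff_td (Φ := fun g h : G => g * h * g⁻¹) (c := 1) ?_ (by simp)
  exact (contMDiff_fst.mul contMDiff_snd).mul contMDiff_fst.inv

theorem mdifferentiable_Ad_apply (Y : V) :
    MDifferentiable 𝓘(ℝ, V) 𝓘(ℝ, V) (fun g : G => Ad V g Y) := fun g =>
  (((contMDiff_Ad (G := G) (V := V)) g).clm_apply contMDiffAt_const).mdifferentiableAt (by simp)

/-- Both sides are mixed second derivatives of the multiplication at (e, e), taken in opposite
orders. -/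
theorem fderiv_chartR (X Y : V) :
    fderiv ℝ (chartR G) (extChartAt 𝓘(ℝ, V) (1 : G) 1) X Y
      = fderiv ℝ (chartL G) (extChartAt 𝓘(ℝ, V) (1 : G) 1) Y X := by
  set e := extChartAt 𝓘(ℝ, V) (1 : G) 1
  set μ : V × V → V := fun p => chartMul G p.1 p.2
  have hμ : ContDiffAt ℝ ∞ μ (e, e) := contDiffAt_chartMul G
  have hev : ∀ᶠ p in nhds (e, e), DifferentiableAt ℝ μ p := by
    have h1 : ContDiffAt ℝ 1 μ (e, e) := hμ.of_le (by norm_cast)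
    filter_upwards [h1.eventually (by simp)] with p hp using hp.differentiableAt (by simp)
  have hd : DifferentiableAt ℝ (fderiv ℝ μ) (e, e) :=
    (hμ.fderiv_right (m := 1) (by norm_cast)).differentiableAt (by simp)
  have hL : chartL G =ᶠ[nhds e] fun y => (fderiv ℝ μ (y, e)).comp (ContinuousLinearMap.inr ℝ V V) := by
    have : Filter.Tendsto (fun y : V => (y, e)) (nhds e) (nhds (e, e)) :=
      (Continuous.prodMk_left e).tendsto e
    filter_upwards [this.eventually hev] with y hy
    exact (HasFDerivAt.comp (g := μ) (f := fun z => (y, z)) e hy.hasFDerivAt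
      (hasFDerivAt_prodMk_right y e)).fderiv
  have hR : chartR G =ᶠ[nhds e] fun y => (fderiv ℝ μ (e, y)).comp (ContinuousLinearMap.inl ℝ V V) := by
    have : Filter.Tendsto (fun y : V => (e, y)) (nhds e) (nhds (e, e)) :=
      (Continuous.prodMk_right e).tendsto e
    filter_upwards [this.eventually hev] with y hy
    exact (HasFDerivAt.comp (g := μ) (f := fun z => (z, y)) e hy.hasFDerivAt
      (hasFDerivAt_prodMk_left e y)).fderiv
  have hL' : fderiv ℝ (chartL G) e Y X = fderiv ℝ (fderiv ℝ μ) (e, e) (Y, 0) (0, X) := by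
    rw [hL.fderiv_eq]
    have hc : HasFDerivAt (fun y => fderiv ℝ μ (y, e)) _ e :=
      HasFDerivAt.comp (g := fderiv ℝ μ) (f := fun z => (z, e)) e hd.hasFDerivAt
        (hasFDerivAt_prodMk_left e e)
    have h := hc.clm_comp
      (hasFDerivAt_const (ContinuousLinearMap.inr ℝ V V) e)
    rw [HasFDerivAt.fderiv h]
    simp
  have hR' : fderiv ℝ (chartR G) e X Y = fderiv ℝ (fderiv ℝ μ) (e, e) (0, X) (Y, 0) := by
    rw [hR.fderiv_eq]
    have hc : HasFDerivAt (fun y => fderiv ℝ μ (e, y)) _ e :=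
      HasFDerivAt.comp (g := fderiv ℝ μ) (f := fun z => (e, z)) e hd.hasFDerivAt
        (hasFDerivAt_prodMk_right e e)
    have h := hc.clm_comp
      (hasFDerivAt_const (ContinuousLinearMap.inl ℝ V V) e)
    rw [HasFDerivAt.fderiv h]
    simp
  rw [hL', hR']
  exact (hμ.isSymmSndFDerivAt (by simp only [minSmoothness_of_isRCLikeNormedField]; norm_cast)) _ _

/-- Reads g · Y = (Ad_g Y) · g in the chart as an identity between `chartL` and `chartR`, and
differentiates it at the identity; `fderiv_chartR` then eliminates the right translation. -/
theorem adV_eq (X Y : V) :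
    adV V (G := G) X Y = fderiv ℝ (chartL G) (extChartAt 𝓘(ℝ, V) (1 : G) 1) X Y
      - fderiv ℝ (chartL G) (extChartAt 𝓘(ℝ, V) (1 : G) 1) Y X := by
  have : IsManifold 𝓘(ℝ, V) ∞ G := isManifold_of_lieGroup
  have ht := mem_extChartAt_target (I := 𝓘(ℝ, V)) (1 : G)
  have hev : (fun y => chartL G y Y) =ᶠ[nhds (extChartAt 𝓘(ℝ, V) (1 : G) 1)]
      fun y => chartR G y (Ad V ((extChartAt 𝓘(ℝ, V) (1 : G)).symm y) Y) := by
    filter_upwards [(isOpen_extChartAt_target (I := 𝓘(ℝ, V)) (1 : G)).mem_nhds ht] with y hy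
    have hg := (extChartAt 𝓘(ℝ, V) (1 : G)).map_target hy
    have h1 := td_chart_mul_left hg Y
    have h2 := td_chart_mul_right hg (Ad V ((extChartAt 𝓘(ℝ, V) (1 : G)).symm y) Y)
    rw [← td_mul_left_Ad, Ad_inv_Ad, h1, (extChartAt 𝓘(ℝ, V) (1 : G)).right_inv hy] at h2
    exact h2
  have hm : MDifferentiableAt 𝓘(ℝ, V) 𝓘(ℝ, V)
      (fun y => Ad V ((extChartAt 𝓘(ℝ, V) (1 : G)).symm y) Y) (extChartAt 𝓘(ℝ, V) (1 : G) 1) :=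
    (mdifferentiable_Ad_apply (G := G) Y _).comp _ (mdifferentiableAt_chart_symm ht)
  have h3 := td_comp (f := (extChartAt 𝓘(ℝ, V) (1 : G)).symm) (g := fun g : G => Ad V g Y)
    (mdifferentiable_Ad_apply (G := G) Y _) (mdifferentiableAt_chart_symm ht) X
  rw [td_eq_fderiv, extChartAt_to_inv, td_chart_symm_self] at h3
  have hR := ((contDiffAt_chartR (V := V) G).differentiableAt (by simp)).hasFDerivAt
  have h4 := hR.clm_apply (mdifferentiableAt_iff_differentiableAt.1 hm).hasFDerivAt
  have h5 := (((contDiffAt_chartL (V := V) G).differentiableAt (by simp)).hasFDerivAt.clm_apply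
    (hasFDerivAt_const Y _)).fderiv
  rw [hev.fderiv_eq, h4.fderiv] at h5
  have h6 := DFunLike.congr_fun h5 X
  simp only [_root_.add_apply, ContinuousLinearMap.comp_apply,
    ContinuousLinearMap.flip_apply, _root_.zero_apply, map_zero, zero_add,
    extChartAt_to_inv, Ad_one, chartR_one, h3, fderiv_chartR] at h6
  rw [adV, ← h6]
  abel

/-- In the chart the left-invariant field of Z is y ↦ `chartL` y Z, so the bracket of vector fields
at the identity is the antisymmetrised derivative of `chartL` found in `adV_eq`. -/
theorem lieBr_eq_adV (X Y : V) : lieBr G X Y = adV V (G := G) X Y := by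
  have : IsManifold 𝓘(ℝ, V) ∞ G := isManifold_of_lieGroup
  have : IsManifold 𝓘(ℝ, V) 1 G := IsManifold.of_le (n := ∞) (by norm_cast)
  have hL := ((contDiffAt_chartL (V := V) G).differentiableAt (by simp)).hasFDerivAt
  have key : ∀ Z : V, (fun y => (VectorField.mpullbackWithin 𝓘(ℝ, V) 𝓘(ℝ, V)
        (extChartAt 𝓘(ℝ, V) (1 : G)).symm
        (mulInvariantVectorField (I := 𝓘(ℝ, V)) (G := G) Z) (range 𝓘(ℝ, V)) y : V))
      =ᶠ[nhds (extChartAt 𝓘(ℝ, V) (1 : G) 1)] fun y => chartL G y Z := by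
    intro Z
    filter_upwards [(isOpen_extChartAt_target (I := 𝓘(ℝ, V)) (1 : G)).mem_nhds
      (mem_extChartAt_target (I := 𝓘(ℝ, V)) (1 : G))] with y hy
    have hg := (extChartAt 𝓘(ℝ, V) (1 : G)).map_target hy
    have h1 := td_chart_mul_left hg Z
    rw [(extChartAt 𝓘(ℝ, V) (1 : G)).right_inv hy] at h1
    rw [← h1]
    have h2 := ContinuousLinearMap.inverse_eq
      (mfderivWithin_extChartAt_symm_comp_mfderiv_extChartAt (I := 𝓘(ℝ, V)) hy)
      (mfderiv_extChartAt_comp_mfderivWithin_extChartAt_symm (I := 𝓘(ℝ, V)) hy)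
    exact DFunLike.congr_fun h2 _
  have hfd : ∀ Z W : V, fderiv ℝ (fun y => chartL G y Z) (extChartAt 𝓘(ℝ, V) (1 : G) 1) W
      = fderiv ℝ (chartL G) (extChartAt 𝓘(ℝ, V) (1 : G) 1) W Z := by
    intro Z W
    rw [(hL.clm_apply (hasFDerivAt_const Z _)).fderiv]
    simp
  have h := VectorField.mlieBracketWithin_apply (I := 𝓘(ℝ, V)) (s := univ) (x₀ := (1 : G))
    (V := mulInvariantVectorField (I := 𝓘(ℝ, V)) (G := G) X)
    (W := mulInvariantVectorField (I := 𝓘(ℝ, V)) (G := G) Y)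
  -- The preferred chart has identity derivative at its base point, so carrying the bracket back to
  -- the group changes nothing.
  have hinv : (mfderiv 𝓘(ℝ, V) 𝓘(ℝ, V) (extChartAt 𝓘(ℝ, V) (1 : G)) 1).inverse
      = ContinuousLinearMap.id ℝ V := by
    rw [mfderiv_extChartAt_self]
    exact ContinuousLinearMap.inverse_id
  have h' : lieBr G X Y = (VectorField.lieBracketWithin ℝ
      (VectorField.mpullbackWithin 𝓘(ℝ, V) 𝓘(ℝ, V) (extChartAt 𝓘(ℝ, V) (1 : G)).symm
        (mulInvariantVectorField (I := 𝓘(ℝ, V)) (G := G) X) (range 𝓘(ℝ, V)))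
      (VectorField.mpullbackWithin 𝓘(ℝ, V) 𝓘(ℝ, V) (extChartAt 𝓘(ℝ, V) (1 : G)).symm
        (mulInvariantVectorField (I := 𝓘(ℝ, V)) (G := G) Y) (range 𝓘(ℝ, V)))
      ((extChartAt 𝓘(ℝ, V) (1 : G)).symm ⁻¹' univ ∩ range 𝓘(ℝ, V))
      (extChartAt 𝓘(ℝ, V) (1 : G) 1) : V) :=
    h.trans (DFunLike.congr_fun hinv _)
  have gen : ∀ (f g : V → V) (S : Set V), S = univ →
      f =ᶠ[nhds (extChartAt 𝓘(ℝ, V) (1 : G) 1)] (fun y => chartL G y X) →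
      g =ᶠ[nhds (extChartAt 𝓘(ℝ, V) (1 : G) 1)] (fun y => chartL G y Y) →
      VectorField.lieBracketWithin ℝ f g S (extChartAt 𝓘(ℝ, V) (1 : G) 1)
        = adV V (G := G) X Y := by
    intro f g S hS hf hg
    rw [hS, VectorField.lieBracketWithin, fderivWithin_univ, fderivWithin_univ, hf.fderiv_eq,
      hg.fderiv_eq, hf.self_of_nhds, hg.self_of_nhds, hfd, hfd, adV_eq]
    simp only [chartL_one]
  exact h'.trans (gen _ _ _ (by simp) (key X) (key Y))

theorem adV_swap (X Y : V) : adV V (G := G) X Y = -adV V (G := G) Y X := by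
  rw [adV_eq, adV_eq]; abel

end GroupChart

/-! ### Differentiation under the integral and the fundamental theorem on an interval -/

section ParametricIntegral

variable {V : Type*} [NormedAddCommGroup V] [NormedSpace ℝ V] [CompleteSpace V]

omit [CompleteSpace V] in
theorem hasDerivAt_integral_of_continuous {f f' : ℝ → ℝ → V}
    (hf : Continuous (fun p : ℝ × ℝ => f p.1 p.2)) (hf' : Continuous (fun p : ℝ × ℝ => f' p.1 p.2))
    (hd : ∀ τ x, HasDerivAt (fun x => f τ x) (f' τ x) x) (a b x₀ : ℝ) :
    HasDerivAt (fun x => ∫ τ in a..b, f τ x) (∫ τ in a..b, f' τ x₀) x₀ := by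
  have hcomp : IsCompact (uIcc a b ×ˢ Metric.closedBall x₀ 1) :=
    isCompact_uIcc.prod (isCompact_closedBall x₀ 1)
  obtain ⟨C, hC⟩ := hcomp.exists_bound_of_continuousOn hf'.continuousOn
  have h1 : ∀ g : ℝ → ℝ → V, Continuous (fun p : ℝ × ℝ => g p.1 p.2) → ∀ x,
      Continuous (fun τ => g τ x) := fun g hg x => hg.comp (Continuous.prodMk_left x)
  refine (intervalIntegral.hasDerivAt_integral_of_dominated_loc_of_deriv_le
    (F := fun x τ => f τ x) (F' := fun x τ => f' τ x) (bound := fun _ => C)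
    (Metric.ball_mem_nhds x₀ one_pos)
    (Filter.Eventually.of_forall fun x => (h1 f hf x).aestronglyMeasurable)
    ((h1 f hf x₀).intervalIntegrable _ _) (h1 f' hf' x₀).aestronglyMeasurable
    (Filter.Eventually.of_forall fun τ hτ x hx => ?_) intervalIntegrable_const
    (Filter.Eventually.of_forall fun τ _ x _ => hd τ x)).2
  exact hC (τ, x) ⟨uIoc_subset_uIcc hτ, Metric.ball_subset_closedBall hx⟩

theorem integral_eq_sub_of_hasDerivWithinAt {f f' : ℝ → V} {a b : ℝ} (hab : a ≤ b)
    (hd : ∀ t ∈ Icc a b, HasDerivWithinAt f (f' t) (Icc a b) t)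
    (hf' : ContinuousOn f' (Icc a b)) : ∫ t in a..b, f' t = f b - f a := by
  refine intervalIntegral.integral_eq_sub_of_hasDerivAt_of_le hab
    (fun t ht => (hd t ht).continuousWithinAt)
    (fun t ht => (hd t (Ioo_subset_Icc_self ht)).hasDerivAt (Icc_mem_nhds ht.1 ht.2)) ?_
  exact ContinuousOn.intervalIntegrable (by rwa [uIcc_of_le hab])

end ParametricIntegral

/-- The retraction of the real line onto the unit interval. -/
def clamp (t : ℝ) : ℝ := projIcc (0 : ℝ) 1 zero_le_one t

theorem continuous_clamp : Continuous clamp := continuous_subtype_val.comp continuous_projIcc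

theorem clamp_mem (t : ℝ) : clamp t ∈ Icc (0 : ℝ) 1 := (projIcc (0 : ℝ) 1 zero_le_one t).2

theorem clamp_of_mem {t : ℝ} (ht : t ∈ Icc (0 : ℝ) 1) : clamp t = t := by
  rw [clamp, projIcc_of_mem zero_le_one ht]

/-! ### Existence, uniqueness and comparison of ordered exponentials -/

section Existence

variable {V : Type*} [NormedAddCommGroup V] [NormedSpace ℝ V] [CompleteSpace V]
  (G : Type*) [TopologicalSpace G] [ChartedSpace V G] [Group G] [LieGroup 𝓘(ℝ, V) ∞ G]

/-- Carries `exists_smallODE` to the group with P = `chartL`. The constants do not depend on the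
interval, which allows gluing; the quadratic error is what later identifies derivatives in
parameters. -/
theorem exists_hasLD_small :
    ∃ η > 0, ∃ C ≥ 0, ∀ (a b : ℝ) (_ : a ≤ b) (c : ℝ → V) (_ : Continuous c) (κ : ℝ),
      0 ≤ κ → (∀ t ∈ Icc a b, ‖c t‖ ≤ κ) → κ * (b - a) ≤ η →
      ∃ F : ℝ → G, F a = 1 ∧ ∀ t ∈ Icc a b, HasLD V F (Icc a b) t (c t) ∧
        F t ∈ (extChartAt 𝓘(ℝ, V) (1 : G)).source ∧
        ‖extChartAt 𝓘(ℝ, V) (1 : G) (F t) - extChartAt 𝓘(ℝ, V) (1 : G) 1 - ∫ τ in a..t, c τ‖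
          ≤ C * (κ * (b - a)) ^ 2 := by
  obtain ⟨η, hη, C, hC, h⟩ := exists_smallODE (V := V) (P := chartL G)
    (e := extChartAt 𝓘(ℝ, V) (1 : G) 1) ((contDiffAt_chartL G).of_le (by norm_cast))
    (by ext a; exact chartL_one a)
    ((isOpen_extChartAt_target (I := 𝓘(ℝ, V)) (1 : G)).mem_nhds (mem_extChartAt_target _))
  refine ⟨η, hη, C, hC, fun a b hab c hc κ hκ hcκ hκη => ?_⟩
  obtain ⟨y, hy0, hy⟩ := h a b hab c hc κ hκ hcκ hκη
  refine ⟨fun τ => (extChartAt 𝓘(ℝ, V) (1 : G)).symm (y τ), ?_, fun t ht => ?_⟩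
  · simp only [hy0, extChartAt_to_inv]
  · obtain ⟨h1, h2, h3⟩ := hy t ht
    refine ⟨hasLD_of_chart h1 h2, (extChartAt 𝓘(ℝ, V) (1 : G)).map_target h1, ?_⟩
    rwa [(extChartAt 𝓘(ℝ, V) (1 : G)).right_inv h1]

variable {G}

omit [CompleteSpace V] in
-- The equation is invariant under left translation, so a second solution that starts at 1 can be
-- continued from F b.
theorem exists_hasLD_glue {A : ℝ → V} {a b c : ℝ} (hab : a ≤ b) (hbc : b ≤ c) {F K : ℝ → G}
    (hF : ∀ t ∈ Icc a b, HasLD V F (Icc a b) t (A t))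
    (hK : ∀ t ∈ Icc b c, HasLD V K (Icc b c) t (A t)) (hKb : K b = 1) :
    ∃ F' : ℝ → G, F' a = F a ∧ ∀ t ∈ Icc a c, HasLD V F' (Icc a c) t (A t) := by
  classical
  set F' : ℝ → G := fun t => if t ≤ b then F t else F b * K t with hF'
  have e1 : ∀ t ∈ Icc a b, F' t = F t := fun t ht => if_pos ht.2
  have e2 : ∀ t ∈ Icc b c, F' t = F b * K t := by
    intro t ht
    rcases eq_or_lt_of_le ht.1 with h | h
    · subst h; simp [hF', hKb]
    · exact if_neg (not_le.2 h)
  have h1 : ∀ t ∈ Icc a b, HasLD V F' (Icc a b) t (A t) := fun t ht =>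
    (hF t ht).congr e1 (e1 t ht)
  have h2 : ∀ t ∈ Icc b c, HasLD V F' (Icc b c) t (A t) := fun t ht =>
    ((hK t ht).mul_const_left (F b)).congr e2 (e2 t ht)
  refine ⟨F', e1 a (left_mem_Icc.2 hab), fun t ht => ?_⟩
  rcases lt_trichotomy t b with h | h | h
  · refine HasVel.congr_nhds (h1 t ⟨ht.1, h.le⟩) ?_
    filter_upwards [self_mem_nhdsWithin, mem_nhdsWithin_of_mem_nhds (Iio_mem_nhds h)] with x hx hx'
    exact ⟨hx.1, le_of_lt hx'⟩
  · subst h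
    have := HasVel.union (h1 t ⟨hab, le_rfl⟩) (h2 t ⟨le_rfl, hbc⟩)
    rwa [Icc_union_Icc_eq_Icc hab hbc] at this
  · refine HasVel.congr_nhds (h2 t ⟨h.le, ht.2⟩) ?_
    filter_upwards [self_mem_nhdsWithin, mem_nhdsWithin_of_mem_nhds (Ioi_mem_nhds h)] with x hx hx'
    exact ⟨le_of_lt hx', hx.2⟩

theorem exists_hasLD_unitInterval {A : ℝ → V} (hA : Continuous A) :
    ∃ F : ℝ → G, F 0 = 1 ∧ ∀ t ∈ Icc (0 : ℝ) 1, HasLD V F (Icc 0 1) t (A t) := by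
  obtain ⟨η, hη, C, -, h⟩ := exists_hasLD_small (V := V) G
  obtain ⟨κ, hκ⟩ := (isCompact_Icc (a := (0 : ℝ)) (b := 1)).exists_bound_of_continuousOn
    hA.continuousOn
  have hκ0 : 0 ≤ κ := (norm_nonneg _).trans (hκ 0 (by simp))
  -- Steps of length 1/N satisfy the smallness condition κ/N ≤ η.
  obtain ⟨N, hN⟩ := exists_nat_gt (κ / η)
  have hN0 : (0 : ℝ) < N := lt_of_le_of_lt (by positivity) hN
  have step : ∀ k : ℕ, k ≤ N → ∃ F : ℝ → G, F 0 = 1 ∧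
      ∀ t ∈ Icc (0 : ℝ) (k / N), HasLD V F (Icc 0 (k / N)) t (A t) := by
    intro k
    induction k with
    | zero =>
      intro _
      obtain ⟨F, h0, hF⟩ := h 0 0 le_rfl A hA κ hκ0
        (fun t ht => hκ t ⟨ht.1, ht.2.trans zero_le_one⟩) (by simpa using hη.le)
      refine ⟨F, h0, fun t ht => ?_⟩
      rw [Nat.cast_zero, zero_div] at ht ⊢
      exact (hF t ht).1
    | succ k ih =>
      intro hk
      obtain ⟨F, h0, hF⟩ := ih (Nat.le_of_succ_le hk)
      have hk1 : ((k + 1 : ℕ) : ℝ) / N ≤ 1 := by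
        rw [div_le_one hN0]; exact_mod_cast hk
      have hle : (k : ℝ) / N ≤ ((k + 1 : ℕ) : ℝ) / N := by gcongr; norm_num
      have hk0 : (0 : ℝ) ≤ k / N := by positivity
      obtain ⟨K, hK0, hK⟩ := h (k / N) ((k + 1 : ℕ) / N) hle A hA κ hκ0
        (fun t ht => hκ t ⟨hk0.trans ht.1, ht.2.trans hk1⟩) (by
          rw [← sub_div, Nat.cast_succ, add_sub_cancel_left, mul_one_div, div_le_iff₀ hN0]
          rw [div_lt_iff₀ hη] at hN
          linarith)
      obtain ⟨F', hF'0, hF'⟩ := exists_hasLD_glue hk0 hle hF (fun t ht => (hK t ht).1) hK0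
      exact ⟨F', hF'0.trans h0, hF'⟩
  obtain ⟨F, h0, hF⟩ := step N le_rfl
  rw [div_self hN0.ne'] at hF
  exact ⟨F, h0, hF⟩

omit [CompleteSpace V] [LieGroup 𝓘(ℝ, V) ∞ G] in
theorem IsOrderedExp.congr_coeff {A B : ℝ → V} {t₀ : ℝ} {F : ℝ → G} (h : IsOrderedExp A t₀ F)
    (hAB : EqOn A B (Icc 0 1)) : IsOrderedExp B t₀ F :=
  ⟨h.1, fun t ht => by rw [← hAB ht]; exact h.2 t ht⟩

omit [CompleteSpace V] in
theorem IsOrderedExp.eqOn {A : ℝ → V} {t₀ : ℝ} {F K : ℝ → G} (ht₀ : t₀ ∈ Icc (0 : ℝ) 1)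
    (hF : IsOrderedExp A t₀ F) (hK : IsOrderedExp A t₀ K) : EqOn F K (Icc 0 1) :=
  eqOn_of_hasLD (convex_Icc 0 1) hF.2 hK.2 ht₀ (hF.1.trans hK.1.symm)

variable (G) in
theorem wellPosed_of_continuousOn {A : ℝ → V} (hA : ContinuousOn A (Icc 0 1)) {t₀ : ℝ}
    (ht₀ : t₀ ∈ Icc (0 : ℝ) 1) : WellPosed G A t₀ := by
  -- Clamping makes the coefficient continuous on the whole line without changing it on [0,1]; left
  -- translation by (F t₀)⁻¹ then moves the initial time from 0 to t₀.
  have hB : Continuous (fun t => A (clamp t)) :=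
    hA.comp_continuous continuous_clamp clamp_mem
  obtain ⟨F, -, hF⟩ := exists_hasLD_unitInterval (G := G) hB
  have h : IsOrderedExp A t₀ (fun t => (F t₀)⁻¹ * F t) := by
    refine ⟨inv_mul_cancel _, fun t ht => ?_⟩
    have := (hF t ht).mul_const_left (F t₀)⁻¹
    rw [clamp_of_mem ht] at this
    exact this
  exact ⟨_, h, fun F' hF' => hF'.eqOn ht₀ h⟩

omit [CompleteSpace V] [LieGroup 𝓘(ℝ, V) ∞ G] in
theorem WellPosed.isOrderedExp {A : ℝ → V} {t₀ : ℝ} (h : WellPosed G A t₀) :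
    IsOrderedExp A t₀ (orderedExp G A t₀) := by
  have h' : ∃ F : ℝ → G, IsOrderedExp A t₀ F := ⟨h.choose, h.choose_spec.1⟩
  rw [orderedExp, dif_pos h']
  exact h'.choose_spec

theorem isOrderedExp_orderedExp {A : ℝ → V} (hA : ContinuousOn A (Icc 0 1)) {t₀ : ℝ}
    (ht₀ : t₀ ∈ Icc (0 : ℝ) 1) : IsOrderedExp A t₀ (orderedExp G A t₀) :=
  (wellPosed_of_continuousOn G hA ht₀).isOrderedExp

theorem orderedExp_congr {A B : ℝ → V} (hA : ContinuousOn A (Icc 0 1))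
    (hAB : EqOn A B (Icc 0 1)) {t₀ : ℝ} (ht₀ : t₀ ∈ Icc (0 : ℝ) 1) :
    EqOn (orderedExp G A t₀) (orderedExp G B t₀) (Icc 0 1) :=
  ((isOrderedExp_orderedExp hA ht₀).congr_coeff hAB).eqOn ht₀
    (isOrderedExp_orderedExp (hA.congr hAB.symm) ht₀)

omit [CompleteSpace V] [LieGroup 𝓘(ℝ, V) ∞ G] in
theorem IsOrderedExp.continuousOn {A : ℝ → V} {t₀ : ℝ} {F : ℝ → G} (h : IsOrderedExp A t₀ F) :
    ContinuousOn F (Icc 0 1) := fun t ht => HasVel.continuousWithinAt (h.2 t ht)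

omit [CompleteSpace V] [LieGroup 𝓘(ℝ, V) ∞ G] in
theorem IsOrderedExp.continuous_clamp {A : ℝ → V} {t₀ : ℝ} {F : ℝ → G} (h : IsOrderedExp A t₀ F) :
    Continuous (fun t => F (clamp t)) :=
  h.continuousOn.comp_continuous HigherHolonomy.continuous_clamp clamp_mem

omit [CompleteSpace V] in
theorem continuous_Ad : Continuous (fun g : G => Ad V g) := contMDiff_Ad.continuous

variable (V G) in
/-- Comparison of the ordered exponentials of two nearby coefficients. -/
theorem exists_orderedExp_quotient :
    ∃ η > 0, ∃ C ≥ 0, ∀ (A B : ℝ → V) (_ : Continuous A) (_ : Continuous B) (F K : ℝ → G)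
      (_ : IsOrderedExp A 0 F) (_ : IsOrderedExp B 0 K) (κ : ℝ), 0 ≤ κ → κ ≤ η →
      (∀ t ∈ Icc (0 : ℝ) 1, ‖Ad V (F (clamp t)) (B t - A t)‖ ≤ κ) → ∀ t ∈ Icc (0 : ℝ) 1,
        K t * (F t)⁻¹ ∈ (extChartAt 𝓘(ℝ, V) (1 : G)).source ∧
        ‖extChartAt 𝓘(ℝ, V) (1 : G) (K t * (F t)⁻¹) - extChartAt 𝓘(ℝ, V) (1 : G) 1
          - ∫ τ in (0 : ℝ)..t, Ad V (F (clamp τ)) (B τ - A τ)‖ ≤ C * κ ^ 2 := by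
  obtain ⟨η, hη, C, hC, h⟩ := exists_hasLD_small (V := V) G
  refine ⟨η, hη, C, hC, fun A B hA hB F K hF hK κ hκ hκη hbd t ht => ?_⟩
  have hc : Continuous (fun τ => Ad V (F (clamp τ)) (B τ - A τ)) :=
    (continuous_Ad.comp hF.continuous_clamp).clm_apply (hB.sub hA)
  obtain ⟨q, hq0, hq⟩ := h 0 1 zero_le_one _ hc κ hκ hbd (by simpa using hκη)
  -- The product rule gives q F the coefficient Ad_{F⁻¹} Ad_F (B − A) + A = B, so uniqueness
  -- identifies q with K F⁻¹.
  have hqF : IsOrderedExp B 0 (fun τ => q τ * F τ) := by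
    refine ⟨by simp [hq0, hF.1], fun τ hτ => ?_⟩
    have h1 := (hq τ hτ).1.mul (hF.2 τ hτ)
    rw [clamp_of_mem hτ, Ad_inv_Ad] at h1
    rw [show B τ = B τ - A τ + A τ by abel]
    exact h1
  have h2 : K t = q t * F t := hK.eqOn (left_mem_Icc.2 zero_le_one) hqF ht
  have h3 := (hq t ht).2
  rw [h2, mul_inv_cancel_right]
  rwa [sub_zero, mul_one] at h3

end Existence

/-! ### Continuity and differentiability of ordered exponentials in parameters -/

section Parameters

variable {V : Type*} [NormedAddCommGroup V] [NormedSpace ℝ V] [CompleteSpace V]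
  {G : Type*} [TopologicalSpace G] [ChartedSpace V G] [Group G] [LieGroup 𝓘(ℝ, V) ∞ G]

omit [NormedSpace ℝ V] [CompleteSpace V] in
-- Compactness of the time interval makes pointwise smallness near p₀ uniform in time.
theorem eventually_forall_norm_lt {P : Type*} [TopologicalSpace P] {f : ℝ → P → V} {p₀ : P}
    (hf : Continuous (fun q : ℝ × P => f q.1 q.2)) (h0 : ∀ t, f t p₀ = 0) {ε : ℝ} (hε : 0 < ε) :
    ∀ᶠ p in nhds p₀, ∀ t ∈ Icc (0 : ℝ) 1, ‖f t p‖ < ε := by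
  refine isCompact_Icc.eventually_forall_of_forall_eventually fun t _ => ?_
  have h1 : Continuous (fun q : P × ℝ => ‖f q.2 q.1‖) := (hf.comp continuous_swap).norm
  exact h1.continuousAt.eventually_lt continuousAt_const (by simpa [h0] using hε)

/-- Ordered exponentials depend continuously on parameters. -/
theorem continuous_orderedExp_param {P : Type*} [TopologicalSpace P] {A : ℝ → P → V}
    (hA : Continuous (fun q : ℝ × P => A q.1 q.2)) {F : P → ℝ → G}
    (hF : ∀ p, IsOrderedExp (fun t => A t p) 0 (F p)) :
    Continuous (fun q : ℝ × P => F q.2 (clamp q.1)) := by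
  have : IsManifold 𝓘(ℝ, V) ∞ G := isManifold_of_lieGroup
  obtain ⟨η, hη, C, hC, h⟩ := exists_orderedExp_quotient V G
  rw [continuous_iff_continuousAt]
  rintro ⟨t₀, p₀⟩
  have hAp : ∀ p, Continuous (fun t => A t p) := fun p => hA.comp (Continuous.prodMk_left p)
  have hcont : Continuous (fun q : ℝ × P => Ad V (F p₀ (clamp q.1)) (A q.1 q.2 - A q.1 p₀)) :=
    ((continuous_Ad.comp (hF p₀).continuous_clamp).comp continuous_fst).clm_apply
      (hA.sub ((hAp p₀).comp continuous_fst))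
  set φ := extChartAt 𝓘(ℝ, V) (1 : G)
  have hq : Filter.Tendsto (fun q : ℝ × P => φ (F q.2 (clamp q.1) * (F p₀ (clamp q.1))⁻¹))
      (nhds (t₀, p₀)) (nhds (φ 1)) := by
    rw [Metric.tendsto_nhds]
    intro ε hε
    -- κ bounds the integral of the coefficient and C κ² the deviation from it; their sum must stay
    -- below ε.
    obtain ⟨κ, hκ0, hκη, hκε⟩ : ∃ κ, 0 < κ ∧ κ ≤ η ∧ κ + C * κ ^ 2 < ε := by
      have hl : Filter.Tendsto (fun κ : ℝ => κ + C * κ ^ 2) (nhdsWithin 0 (Ioi 0)) (nhds 0) := by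
        have : Continuous (fun κ : ℝ => κ + C * κ ^ 2) := by fun_prop
        simpa using (this.tendsto 0).mono_left nhdsWithin_le_nhds
      obtain ⟨κ, h1, h2, h3⟩ := ((hl.eventually_lt_const hε).and
        (Ioc_mem_nhdsGT hη)).exists
      exact ⟨κ, h2, h3, h1⟩
    have hev := eventually_forall_norm_lt (f := fun t p => Ad V (F p₀ (clamp t)) (A t p - A t p₀))
      hcont (p₀ := p₀) (by simp) hκ0
    filter_upwards [(continuous_snd.tendsto (t₀, p₀)).eventually hev] with q hq
    have h1 := (h _ _ (hAp p₀) (hAp q.2) _ _ (hF p₀) (hF q.2) κ hκ0.le hκη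
      (fun t ht => (hq t ht).le) (clamp q.1) (clamp_mem q.1)).2
    have h2 : ‖∫ τ in (0 : ℝ)..clamp q.1, Ad V (F p₀ (clamp τ)) (A τ q.2 - A τ p₀)‖ ≤ κ := by
      have hc := clamp_mem q.1
      have h3 := intervalIntegral.norm_integral_le_of_norm_le_const (a := 0) (b := clamp q.1)
        (C := κ) (f := fun τ => Ad V (F p₀ (clamp τ)) (A τ q.2 - A τ p₀)) (fun τ hτ => by
          rw [uIoc_of_le hc.1] at hτ
          exact (hq τ ⟨hτ.1.le, hτ.2.trans hc.2⟩).le)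
      refine h3.trans ?_
      rw [sub_zero, abs_of_nonneg hc.1]
      exact mul_le_of_le_one_right hκ0.le hc.2
    rw [dist_eq_norm]
    calc _ ≤ _ + _ := norm_le_norm_sub_add _
            (∫ τ in (0 : ℝ)..clamp q.1, Ad V (F p₀ (clamp τ)) (A τ q.2 - A τ p₀))
      _ ≤ C * κ ^ 2 + κ := add_le_add h1 h2
      _ < ε := by linarith
  have hsymm : ContinuousAt φ.symm (φ 1) := continuousAt_extChartAt_symm (1 : G)
  -- Applying the inverse chart recovers the quotient only where it lies in the chart domain, which
  -- the comparison lemma guarantees for nearby parameters.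
  have hq1 : Filter.Tendsto (fun q : ℝ × P => F q.2 (clamp q.1) * (F p₀ (clamp q.1))⁻¹)
      (nhds (t₀, p₀)) (nhds 1) := by
    have h1 := hsymm.tendsto.comp hq
    rw [extChartAt_to_inv] at h1
    refine h1.congr' ?_
    have hev := eventually_forall_norm_lt (f := fun t p => Ad V (F p₀ (clamp t)) (A t p - A t p₀))
      hcont (p₀ := p₀) (by simp) hη
    filter_upwards [(continuous_snd.tendsto (t₀, p₀)).eventually hev] with q hq
    have h1 := (h _ _ (hAp p₀) (hAp q.2) _ _ (hF p₀) (hF q.2) η hη.le le_rfl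
      (fun t ht => (hq t ht).le) (clamp q.1) (clamp_mem q.1)).1
    exact φ.left_inv h1
  have hF0 : Filter.Tendsto (fun q : ℝ × P => F p₀ (clamp q.1)) (nhds (t₀, p₀))
      (nhds (F p₀ (clamp t₀))) :=
    ((hF p₀).continuous_clamp.comp continuous_fst).tendsto (t₀, p₀)
  have hmul := ((contMDiff_mul 𝓘(ℝ, V) ∞ (G := G)).continuous.tendsto (1, F p₀ (clamp t₀))).comp
    (hq1.prodMk_nhds hF0)
  simp only [one_mul] at hmul
  refine hmul.congr fun q => ?_
  simp

/-- The derivative of an ordered exponential with respect to a parameter. -/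
theorem hasVel_orderedExp_param {A A' : ℝ → ℝ → V}
    (hA : Continuous (fun q : ℝ × ℝ => A q.1 q.2)) (hA' : Continuous (fun q : ℝ × ℝ => A' q.1 q.2))
    (hd : ∀ t x, HasDerivAt (fun x => A t x) (A' t x) x) {F : ℝ → ℝ → G}
    (hF : ∀ x, IsOrderedExp (fun t => A t x) 0 (F x)) {t : ℝ} (ht : t ∈ Icc (0 : ℝ) 1) (x₀ : ℝ) :
    HasVel V (fun x => F x t) univ x₀ (td V V (fun h : G => h * F x₀ t) 1
      (∫ τ in (0 : ℝ)..t, Ad V (F x₀ (clamp τ)) (A' τ x₀))) := by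
  have : IsManifold 𝓘(ℝ, V) ∞ G := isManifold_of_lieGroup
  obtain ⟨η, hη, C, hC, h⟩ := exists_orderedExp_quotient V G
  set φ := extChartAt 𝓘(ℝ, V) (1 : G)
  have hAp : ∀ p, Continuous (fun t => A t p) := fun p => hA.comp (Continuous.prodMk_left p)
  have hAd : Continuous (fun q : ℝ × ℝ => Ad V (F x₀ (clamp q.1))) :=
    (continuous_Ad.comp (hF x₀).continuous_clamp).comp continuous_fst
  set c : ℝ → ℝ → V := fun τ x => Ad V (F x₀ (clamp τ)) (A τ x - A τ x₀) with hc
  set c' : ℝ → ℝ → V := fun τ x => Ad V (F x₀ (clamp τ)) (A' τ x) with hc'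
  have hcc : Continuous (fun q : ℝ × ℝ => c q.1 q.2) :=
    hAd.clm_apply (hA.sub ((hAp x₀).comp continuous_fst))
  have hcc' : Continuous (fun q : ℝ × ℝ => c' q.1 q.2) := hAd.clm_apply hA'
  have hcd : ∀ τ x, HasDerivAt (fun x => c τ x) (c' τ x) x := fun τ x =>
    (Ad V (F x₀ (clamp τ))).hasFDerivAt.comp_hasDerivAt x ((hd τ x).sub_const _)
  have hI := hasDerivAt_integral_of_continuous hcc hcc' hcd 0 t x₀
  obtain ⟨M, hM⟩ := (isCompact_Icc.prod (isCompact_closedBall x₀ 1)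
    (s := Icc (0 : ℝ) 1)).exists_bound_of_continuousOn hcc'.continuousOn
  have hM0 : 0 ≤ M := (norm_nonneg _).trans (hM (0, x₀) ⟨by simp, by simp⟩)
  -- The coefficient of the quotient is linearly small in x − x₀, so the quadratic error becomes
  -- O(|x − x₀|²) and has zero derivative; only the integral contributes.
  have hcM : ∀ x ∈ Metric.closedBall x₀ 1, ∀ τ ∈ Icc (0 : ℝ) 1, ‖c τ x‖ ≤ M * |x - x₀| := by
    intro x hx τ hτ
    have h1 := (convex_closedBall x₀ 1).norm_image_sub_le_of_norm_hasDerivWithin_le (C := M)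
      (fun y _ => (hcd τ y).hasDerivWithinAt) (fun y hy => hM (τ, y) ⟨hτ, hy⟩)
      (Metric.mem_closedBall_self zero_le_one) hx
    simpa [hc] using h1
  have hsmall : ∀ᶠ x in nhds x₀, x ∈ Metric.closedBall x₀ 1 ∧ M * |x - x₀| ≤ η := by
    refine Filter.Eventually.and (Metric.closedBall_mem_nhds x₀ one_pos) ?_
    have h1 : Continuous (fun x : ℝ => M * |x - x₀|) := by fun_prop
    filter_upwards [h1.continuousAt.eventually_lt (continuousAt_const (y := η))
      (by simpa using hη)] with x hx using hx.le
  have hmain : ∀ᶠ x in nhds x₀, F x t * (F x₀ t)⁻¹ ∈ φ.source ∧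
      ‖φ (F x t * (F x₀ t)⁻¹) - φ 1 - ∫ τ in (0 : ℝ)..t, c τ x‖ ≤ C * (M * |x - x₀|) ^ 2 := by
    filter_upwards [hsmall] with x hx
    exact h _ _ (hAp x₀) (hAp x) _ _ (hF x₀) (hF x) (M * |x - x₀|) (by positivity) hx.2
      (hcM x hx.1) t ht
  have hR : HasDerivAt (fun x => φ (F x t * (F x₀ t)⁻¹) - φ 1 - ∫ τ in (0 : ℝ)..t, c τ x) 0 x₀ := by
    have hO : (fun x => φ (F x t * (F x₀ t)⁻¹) - φ 1 - ∫ τ in (0 : ℝ)..t, c τ x)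
        =O[nhds x₀] fun x => ‖x - x₀‖ ^ 2 := by
      refine Asymptotics.IsBigO.of_bound (C * M ^ 2) ?_
      filter_upwards [hmain] with x hx
      refine hx.2.trans (le_of_eq ?_)
      rw [norm_pow, norm_norm, Real.norm_eq_abs]
      ring
    simpa using (hO.hasFDerivAt one_lt_two).hasDerivAt
  have hφ : HasDerivAt (fun x => φ (F x t * (F x₀ t)⁻¹)) (∫ τ in (0 : ℝ)..t, c' τ x₀) x₀ := by
    have h1 := (hR.add hI).add_const (φ 1)
    rw [zero_add] at h1
    refine h1.congr_of_eventuallyEq (Filter.Eventually.of_forall fun x => ?_)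
    simp only [Pi.add_apply]
    abel
  have hφ0 : φ (F x₀ t * (F x₀ t)⁻¹) = φ 1 := by rw [mul_inv_cancel]
  have hq := HasVel.comp (F := fun x => φ (F x t * (F x₀ t)⁻¹)) (s := univ) (t := x₀)
    (mdifferentiableAt_chart_symm (p₀ := (1 : G)) (by rw [hφ0]; exact mem_extChartAt_target _))
    (hasVel_iff_hasDerivWithinAt.2 hφ.hasDerivWithinAt)
  rw [hφ0, td_chart_symm_self] at hq
  have h2 := HasVel.comp (mdifferentiableAt_mul_right (V := V) (F x₀ t) _) hq
  rw [hφ0, extChartAt_to_inv] at h2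
  have hset : ∀ᶠ x in nhds x₀, φ.symm (φ (F x t * (F x₀ t)⁻¹)) * F x₀ t = F x t := by
    filter_upwards [hmain] with x hx
    rw [φ.left_inv hx.1, inv_mul_cancel_right]
  have h3 : HasVel V (fun x => F x t) {x | φ.symm (φ (F x t * (F x₀ t)⁻¹)) * F x₀ t = F x t} x₀ _ :=
    HasVel.congr (h2.mono (subset_univ _)) (fun x hx => Eq.symm hx)
      (by rw [hφ0, extChartAt_to_inv, one_mul])
  exact h3.congr_nhds (by rw [nhdsWithin_univ]; exact hset)

end Parameters

/-! ## Representations of a Lie group and their derivatives -/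

section Rep

variable {V W : Type*} [NormedAddCommGroup V] [NormedSpace ℝ V]
  [NormedAddCommGroup W] [NormedSpace ℝ W]
  {G : Type*} [TopologicalSpace G] [ChartedSpace V G] [Group G] [LieGroup 𝓘(ℝ, V) ∞ G]
  {ρ : G → W →L[ℝ] W}

theorem td_clm_comp {X M : Type*} [NormedAddCommGroup X] [NormedSpace ℝ X]
    [TopologicalSpace M] [ChartedSpace X M] (L : V →L[ℝ] W) {f : M → V} {x : M}
    (hf : MDifferentiableAt 𝓘(ℝ, X) 𝓘(ℝ, V) f x) (v : X) :
    td X W (fun y => L (f y)) x v = L (td X V f x v) := by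
  rw [td_comp (L.mdifferentiableAt) hf, td_eq_fderiv, L.fderiv]

theorem td_sub {X M : Type*} [NormedAddCommGroup X] [NormedSpace ℝ X]
    [TopologicalSpace M] [ChartedSpace X M] {f g : M → V} {x : M}
    (hf : MDifferentiableAt 𝓘(ℝ, X) 𝓘(ℝ, V) f x) (hg : MDifferentiableAt 𝓘(ℝ, X) 𝓘(ℝ, V) g x)
    (v : X) : td X V (fun y => f y - g y) x v = td X V f x v - td X V g x v :=
  DFunLike.congr_fun ((hf.hasMFDerivAt.sub hg.hasMFDerivAt).mfderiv) v

omit [Group G] [LieGroup 𝓘(ℝ, V) ∞ G] in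
theorem td_clm_apply {g : G} (hρ : MDifferentiableAt 𝓘(ℝ, V) 𝓘(ℝ, W →L[ℝ] W) ρ g) (a : V) (u : W) :
    td V W (fun k => ρ k u) g a = td V (W →L[ℝ] W) ρ g a u :=
  td_clm_comp (ContinuousLinearMap.apply ℝ W u) hρ a

theorem td_rep_left (hρ : MDifferentiable 𝓘(ℝ, V) 𝓘(ℝ, W →L[ℝ] W) ρ)
    (hmul : ∀ g h u, ρ (g * h) u = ρ g (ρ h u)) (g : G) (a : V) (u : W) :
    td V (W →L[ℝ] W) ρ g (td V V (fun k : G => g * k) 1 a) u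
      = ρ g (td V (W →L[ℝ] W) ρ 1 a u) := by
  have h0 : MDifferentiable 𝓘(ℝ, V) 𝓘(ℝ, W) (fun k => ρ k u) := fun k =>
    (ContinuousLinearMap.apply ℝ W u).mdifferentiableAt.comp k (hρ k)
  have h1 := td_comp (x := (1 : G)) (f := fun k : G => g * k) (g := fun k => ρ k u)
    (h0 _) (mdifferentiableAt_mul_left (V := V) g _) a
  simp only [mul_one, hmul] at h1
  rw [td_clm_comp _ (h0 1), td_clm_apply (hρ _), td_clm_apply (hρ _)] at h1
  exact h1.symm

theorem td_rep_right (hρ : MDifferentiable 𝓘(ℝ, V) 𝓘(ℝ, W →L[ℝ] W) ρ)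
    (hmul : ∀ g h u, ρ (g * h) u = ρ g (ρ h u)) (g : G) (a : V) (u : W) :
    td V (W →L[ℝ] W) ρ g (td V V (fun k : G => k * g) 1 a) u
      = td V (W →L[ℝ] W) ρ 1 a (ρ g u) := by
  have h0 : ∀ u, MDifferentiable 𝓘(ℝ, V) 𝓘(ℝ, W) (fun k => ρ k u) := fun u k =>
    (ContinuousLinearMap.apply ℝ W u).mdifferentiableAt.comp k (hρ k)
  have h1 := td_comp (x := (1 : G)) (f := fun k : G => k * g) (g := fun k => ρ k u)
    (h0 u _) (mdifferentiableAt_mul_right (V := V) g _) a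
  simp only [one_mul, hmul] at h1
  rw [td_clm_apply (hρ _), td_clm_apply (hρ _)] at h1
  exact h1.symm

/-- A right translate of a tangent vector is the left translate of its image under Ad_{g⁻¹};
computing the derivative of ρ both ways gives the equivariance. -/
theorem td_rep_Ad (hρ : MDifferentiable 𝓘(ℝ, V) 𝓘(ℝ, W →L[ℝ] W) ρ)
    (hmul : ∀ g h u, ρ (g * h) u = ρ g (ρ h u)) (g : G) (a : V) (u : W) :
    td V (W →L[ℝ] W) ρ 1 (Ad V g a) (ρ g u) = ρ g (td V (W →L[ℝ] W) ρ 1 a u) := by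
  rw [← td_rep_right hρ hmul, ← td_mul_left_Ad, Ad_inv_Ad, td_rep_left hρ hmul]

theorem hasDerivWithinAt_rep_left (hρ : MDifferentiable 𝓘(ℝ, V) 𝓘(ℝ, W →L[ℝ] W) ρ)
    (hmul : ∀ g h u, ρ (g * h) u = ρ g (ρ h u)) {F : ℝ → G} {s : Set ℝ} {t : ℝ} {a : V}
    (hF : HasLD V F s t a) {u : ℝ → W} {u' : W} (hu : HasDerivWithinAt u u' s t) :
    HasDerivWithinAt (fun τ => ρ (F τ) (u τ))
      (ρ (F t) (td V (W →L[ℝ] W) ρ 1 a (u t) + u')) s t := by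
  have h1 := hasVel_iff_hasDerivWithinAt.1 (HasVel.comp (hρ _) hF)
  have h2 := h1.clm_apply hu
  rwa [td_rep_left hρ hmul, ← map_add] at h2

theorem hasDerivWithinAt_rep_right (hρ : MDifferentiable 𝓘(ℝ, V) 𝓘(ℝ, W →L[ℝ] W) ρ)
    (hmul : ∀ g h u, ρ (g * h) u = ρ g (ρ h u)) {F : ℝ → G} {s : Set ℝ} {t : ℝ} {a : V}
    (hF : HasVel V F s t (td V V (fun k : G => k * F t) 1 a)) {u : ℝ → W} {u' : W}
    (hu : HasDerivWithinAt u u' s t) :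
    HasDerivWithinAt (fun τ => ρ (F τ) (u τ))
      (td V (W →L[ℝ] W) ρ 1 a (ρ (F t) (u t)) + ρ (F t) u') s t := by
  have h1 := hasVel_iff_hasDerivWithinAt.1 (HasVel.comp (hρ _) hF)
  have h2 := h1.clm_apply hu
  rwa [td_rep_right hρ hmul] at h2

theorem mdifferentiable_Ad : MDifferentiable 𝓘(ℝ, V) 𝓘(ℝ, V →L[ℝ] V) (fun g : G => Ad V g) :=
  contMDiff_Ad.mdifferentiable (by simp)

/-- The adjoint representation of the Lie algebra as a bilinear map. -/
def adL (V : Type*) [NormedAddCommGroup V] [NormedSpace ℝ V]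
    (G : Type*) [TopologicalSpace G] [ChartedSpace V G] [Group G] : V →L[ℝ] V →L[ℝ] V :=
  td V (V →L[ℝ] V) (fun g : G => Ad V g) 1

theorem adL_apply (X Y : V) : adL V G X Y = adV V (G := G) X Y :=
  (td_clm_apply (mdifferentiable_Ad _) X Y).symm

theorem adL_swap (X Y : V) : adL V G X Y = -adL V G Y X := by
  rw [adL_apply, adL_apply, adV_swap]

theorem lieBr_eq_adL (X Y : V) : lieBr G X Y = adL V G X Y := by
  rw [lieBr_eq_adV, adL_apply]

end Rep

/-! ## The differential 2-crossed module -/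

namespace LieTwoCrossedModule

variable {VG VE VL : Type*}
    [NormedAddCommGroup VG] [NormedSpace ℝ VG]
    [NormedAddCommGroup VE] [NormedSpace ℝ VE]
    [NormedAddCommGroup VL] [NormedSpace ℝ VL]
    {G E L : Type*}
    [TopologicalSpace G] [ChartedSpace VG G] [Group G]
    [TopologicalSpace E] [ChartedSpace VE E] [Group E]
    [TopologicalSpace L] [ChartedSpace VL L] [Group L]
    (H : LieTwoCrossedModule VG VE VL G E L)

/-- Expanding {e, 1 · 1} gives X = X · X for X = {e, 1}, once {1, 1} = 1 is read off from {δ(1),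
δ(1)}. This normalisation is what allows the lifting to be differentiated at the identity with
values in the Lie algebra. -/
theorem lift_one_right (e : E) : H.lift e 1 = 1 := by
  have h1 : H.lift 1 1 = 1 := by simpa using H.lift_bdL 1 1
  have h := H.lift_mul_right e 1 1
  simp only [mul_one, mul_inv_cancel, inv_one, map_one, h1] at h
  exact left_eq_mul.1 h

theorem lift_one_left (f : E) : H.lift 1 f = 1 := by
  have h := H.lift_mul_left 1 1 f
  simp only [one_mul, inv_one, mul_one, map_one, MulAut.one_apply] at h
  exact left_eq_mul.1 h

theorem actEL_one (e : E) : H.actEL e 1 = 1 := by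
  simp [actEL, H.lift_one_left]

/-- Since ∂δ = 1, the action inside δ{δ(l)⁻¹, e} is trivial, and the product with δ(l) collapses to
a conjugate. -/
theorem bdL_actEL (e : E) (l : L) : H.bdL (H.actEL e l) = e * H.bdL l * e⁻¹ := by
  have : H.bdE (H.bdL l)⁻¹ = 1 := by rw [map_inv, H.bdE_bdL, inv_one]
  rw [actEL, map_mul, H.bdL_lift, this, map_one, MulAut.one_apply]
  group

variable [LieGroup 𝓘(ℝ, VG) ∞ G] [LieGroup 𝓘(ℝ, VE) ∞ E] [LieGroup 𝓘(ℝ, VL) ∞ L]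

/-- The action of `G` on the Lie algebra of `E`, by continuous linear maps. -/
def repE (g : G) : VE →L[ℝ] VE := td VE VE (fun e : E => H.actE g e) 1

/-- The action of `G` on the Lie algebra of `L`, by continuous linear maps. -/
def repL (g : G) : VL →L[ℝ] VL := td VL VL (fun l : L => H.actL g l) 1

/-- The action of `E` on the Lie algebra of `L`, by continuous linear maps. -/
def repEL (e : E) : VL →L[ℝ] VL := td VL VL (fun l : L => H.actEL e l) 1

/-- The differential of `δ`. -/
def tdL : VL →L[ℝ] VE := td VL VE H.bdL 1

/-- The differential of `∂`. -/
def tdE : VE →L[ℝ] VG := td VE VG H.bdE 1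

theorem mdifferentiable_bdL : MDifferentiable 𝓘(ℝ, VL) 𝓘(ℝ, VE) H.bdL :=
  H.smooth_bdL.mdifferentiable (by simp)

theorem mdifferentiable_bdE : MDifferentiable 𝓘(ℝ, VE) 𝓘(ℝ, VG) H.bdE :=
  H.smooth_bdE.mdifferentiable (by simp)

theorem mdifferentiable_actE (g : G) :
    MDifferentiable 𝓘(ℝ, VE) 𝓘(ℝ, VE) (fun e : E => H.actE g e) :=
  (H.smooth_actE.comp (contMDiff_const.prodMk contMDiff_id)).mdifferentiable (by simp)

theorem mdifferentiable_actL (g : G) :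
    MDifferentiable 𝓘(ℝ, VL) 𝓘(ℝ, VL) (fun l : L => H.actL g l) :=
  (H.smooth_actL.comp (contMDiff_const.prodMk contMDiff_id)).mdifferentiable (by simp)

theorem contMDiff_actEL :
    ContMDiff (𝓘(ℝ, VE).prod 𝓘(ℝ, VL)) 𝓘(ℝ, VL) ∞ (fun p : E × L => H.actEL p.1 p.2) :=
  contMDiff_snd.mul (H.smooth_lift.comp ((H.smooth_bdL.comp contMDiff_snd).inv.prodMk contMDiff_fst))

theorem contMDiff_repE : ContMDiff 𝓘(ℝ, VG) 𝓘(ℝ, VE →L[ℝ] VE) ∞ H.repE := by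
  have : IsManifold 𝓘(ℝ, VG) ∞ G := isManifold_of_lieGroup
  have : IsManifold 𝓘(ℝ, VE) ∞ E := isManifold_of_lieGroup
  exact contMDiff_td (Φ := fun (g : G) (e : E) => H.actE g e) (c := 1) H.smooth_actE (by simp)

theorem contMDiff_repL : ContMDiff 𝓘(ℝ, VG) 𝓘(ℝ, VL →L[ℝ] VL) ∞ H.repL := by
  have : IsManifold 𝓘(ℝ, VG) ∞ G := isManifold_of_lieGroup
  have : IsManifold 𝓘(ℝ, VL) ∞ L := isManifold_of_lieGroup
  exact contMDiff_td (Φ := fun (g : G) (l : L) => H.actL g l) (c := 1) H.smooth_actL (by simp)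

theorem contMDiff_repEL : ContMDiff 𝓘(ℝ, VE) 𝓘(ℝ, VL →L[ℝ] VL) ∞ H.repEL := by
  have : IsManifold 𝓘(ℝ, VE) ∞ E := isManifold_of_lieGroup
  have : IsManifold 𝓘(ℝ, VL) ∞ L := isManifold_of_lieGroup
  exact contMDiff_td (Φ := fun (e : E) (l : L) => H.actEL e l) (c := 1) H.contMDiff_actEL H.actEL_one

theorem contMDiff_td_lift :
    ContMDiff 𝓘(ℝ, VE) 𝓘(ℝ, VE →L[ℝ] VL) ∞ (fun e : E => td VE VL (fun f : E => H.lift e f) 1) := by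
  have : IsManifold 𝓘(ℝ, VE) ∞ E := isManifold_of_lieGroup
  have : IsManifold 𝓘(ℝ, VL) ∞ L := isManifold_of_lieGroup
  exact contMDiff_td (Φ := fun e f : E => H.lift e f) (c := 1) H.smooth_lift H.lift_one_right

theorem mdifferentiable_repE : MDifferentiable 𝓘(ℝ, VG) 𝓘(ℝ, VE →L[ℝ] VE) H.repE :=
  H.contMDiff_repE.mdifferentiable (by simp)

theorem repE_mul (g h : G) (u : VE) : H.repE (g * h) u = H.repE g (H.repE h u) := by
  have h1 := td_comp (x := (1 : E)) (f := fun e : E => H.actE h e) (g := fun e : E => H.actE g e)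
    (H.mdifferentiable_actE g _) (H.mdifferentiable_actE h _) u
  simp only [map_one] at h1
  unfold repE
  rw [← h1, map_mul]
  rfl

/-- The action of the Lie algebra of `G` on that of `E`, as a bilinear map. -/
def drepE : VG →L[ℝ] VE →L[ℝ] VE := td VG (VE →L[ℝ] VE) H.repE 1

/-- The Peiffer lifting of the differential 2-crossed module, as a bilinear map. -/
def dlift : VE →L[ℝ] VE →L[ℝ] VL :=
  td VE (VE →L[ℝ] VL) (fun e : E => td VE VL (fun f : E => H.lift e f) 1) 1

theorem algActE_eq (X : VG) (u : VE) : H.algActE X u = H.drepE X u :=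
  td_clm_apply (ρ := H.repE) (H.mdifferentiable_repE 1) X u

theorem algLift_eq (u v : VE) : H.algLift u v = H.dlift u v :=
  td_clm_comp (ContinuousLinearMap.apply ℝ VL v)
    (H.contMDiff_td_lift.mdifferentiable (by simp) 1) u

theorem drepE_Ad (g : G) (X : VG) (u : VE) :
    H.drepE (Ad VG g X) (H.repE g u) = H.repE g (H.drepE X u) :=
  td_rep_Ad H.mdifferentiable_repE H.repE_mul g X u

theorem tdE_repE (g : G) (u : VE) : H.tdE (H.repE g u) = Ad VG g (H.tdE u) := by
  have h1 := td_comp (x := (1 : E)) (f := fun e : E => H.actE g e) (g := H.bdE)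
    (H.mdifferentiable_bdE _) (H.mdifferentiable_actE g _) u
  have h2 := td_comp (x := (1 : E)) (f := H.bdE) (g := fun h : G => g * h * g⁻¹)
    (mdifferentiableAt_conj (V := VG) g _) (H.mdifferentiable_bdE _) u
  simp only [map_one] at h1 h2
  simp only [H.bdE_act] at h1
  exact h1.symm.trans h2

theorem tdL_repL (g : G) (x : VL) : H.tdL (H.repL g x) = H.repE g (H.tdL x) := by
  have h1 := td_comp (x := (1 : L)) (f := fun l : L => H.actL g l) (g := H.bdL)
    (H.mdifferentiable_bdL _) (H.mdifferentiable_actL g _) x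
  have h2 := td_comp (x := (1 : L)) (f := H.bdL) (g := fun e : E => H.actE g e)
    (H.mdifferentiable_actE g _) (H.mdifferentiable_bdL _) x
  simp only [map_one] at h1 h2
  simp only [H.bdL_act] at h1
  exact h1.symm.trans h2

theorem tdL_repEL (e : E) (x : VL) : H.tdL (H.repEL e x) = Ad VE e (H.tdL x) := by
  have hs : MDifferentiable 𝓘(ℝ, VL) 𝓘(ℝ, VL) (fun l : L => H.actEL e l) :=
    (H.contMDiff_actEL.comp (contMDiff_const.prodMk contMDiff_id)).mdifferentiable (by simp)
  have h1 := td_comp (x := (1 : L)) (f := fun l : L => H.actEL e l) (g := H.bdL)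
    (H.mdifferentiable_bdL _) (hs _) x
  have h2 := td_comp (x := (1 : L)) (f := H.bdL) (g := fun h : E => e * h * e⁻¹)
    (mdifferentiableAt_conj (V := VE) e _) (H.mdifferentiable_bdL _) x
  simp only [H.actEL_one, map_one] at h1 h2
  simp only [H.bdL_actEL] at h1
  exact h1.symm.trans h2

theorem td_peiffer (e : E) (v : VE) :
    td VE VE (fun f : E => e * f * e⁻¹ * H.actE (H.bdE e) f⁻¹) 1 v
      = Ad VE e v - H.repE (H.bdE e) v := by
  have hK : MDifferentiableAt 𝓘(ℝ, VE) 𝓘(ℝ, VE) (fun f : E => H.actE (H.bdE e) f⁻¹) 1 :=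
    (H.mdifferentiable_actE _ _).comp _ (mdifferentiableAt_inv (V := VE) 1)
  have h1 := td_comp₂ (f := fun x y : E => x * y) (F := fun f : E => e * f * e⁻¹)
    (K := fun f : E => H.actE (H.bdE e) f⁻¹) (q := (1 : E)) (mdifferentiableAt_mul _)
    (mdifferentiableAt_conj (V := VE) e 1) hK v
  have h2 := td_comp (x := (1 : E)) (f := fun f : E => f⁻¹) (g := fun f : E => H.actE (H.bdE e) f)
    (H.mdifferentiable_actE _ _) (mdifferentiableAt_inv (V := VE) 1) v
  simp only [inv_one, map_one, mul_one, one_mul, mul_inv_cancel] at h1 h2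
  rw [td_id, td_id, h2, td_inv_one, map_neg, ← sub_eq_add_neg] at h1
  exact h1

/-- Differentiating δ{e, f} = ⟨e, f⟩ in f at 1 gives Ad_e(v) − ∂(e) ▷ v (`td_peiffer`); a further
differentiation in e gives the formula. This is how action terms are exchanged for brackets in the
two-dimensional step. -/
theorem tdL_dlift (u v : VE) :
    H.tdL (H.dlift u v) = adL VE E u v - H.drepE (H.tdE u) v := by
  have hd : MDifferentiableAt 𝓘(ℝ, VE) 𝓘(ℝ, VL)
      (fun e : E => td VE VL (fun f : E => H.lift e f) 1 v) 1 :=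
    (ContinuousLinearMap.apply ℝ VL v).mdifferentiableAt.comp (1 : E)
      (H.contMDiff_td_lift.mdifferentiable (by simp) 1)
  rw [← algLift_eq]
  have h1 := td_clm_comp H.tdL hd u
  refine h1.symm.trans ?_
  have h2 : (fun e : E => H.tdL (td VE VL (fun f : E => H.lift e f) 1 v))
      = fun e : E => Ad VE e v - H.repE (H.bdE e) v := by
    funext e
    have hl : MDifferentiable 𝓘(ℝ, VE) 𝓘(ℝ, VL) (fun f : E => H.lift e f) :=
      (H.smooth_lift.comp (contMDiff_const.prodMk contMDiff_id)).mdifferentiable (by simp)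
    have h3 := td_comp (x := (1 : E)) (f := fun f : E => H.lift e f) (g := H.bdL)
      (H.mdifferentiable_bdL _) (hl _) v
    simp only [H.lift_one_right] at h3
    refine h3.symm.trans ?_
    simp only [H.bdL_lift]
    exact H.td_peiffer e v
  have hR : MDifferentiable 𝓘(ℝ, VG) 𝓘(ℝ, VE) (fun g => H.repE g v) := fun g =>
    (ContinuousLinearMap.apply ℝ VE v).mdifferentiableAt.comp g (H.mdifferentiable_repE g)
  have hRb : MDifferentiableAt 𝓘(ℝ, VE) 𝓘(ℝ, VE) (fun e : E => H.repE (H.bdE e) v) 1 :=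
    (hR _).comp _ (H.mdifferentiable_bdE 1)
  rw [h2, td_sub (mdifferentiable_Ad_apply v 1) hRb,
    td_comp (g := fun g => H.repE g v) (hR _) (H.mdifferentiable_bdE 1), map_one,
    td_clm_apply (H.mdifferentiable_repE _), td_clm_apply (mdifferentiable_Ad _)]
  rfl

end LieTwoCrossedModule

/-! ### Variation of the 1-dimensional holonomy and of transported densities -/

namespace LieTwoCrossedModule

variable {VG VE VL : Type*}
    [NormedAddCommGroup VG] [NormedSpace ℝ VG] [CompleteSpace VG]
    [NormedAddCommGroup VE] [NormedSpace ℝ VE] [CompleteSpace VE]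
    [NormedAddCommGroup VL] [NormedSpace ℝ VL] [CompleteSpace VL]
    {G E L : Type*}
    [TopologicalSpace G] [ChartedSpace VG G] [Group G]
    [TopologicalSpace E] [ChartedSpace VE E] [Group E]
    [TopologicalSpace L] [ChartedSpace VL L] [Group L]
    [LieGroup 𝓘(ℝ, VG) ∞ G] [LieGroup 𝓘(ℝ, VE) ∞ E] [LieGroup 𝓘(ℝ, VL) ∞ L]
    (H : LieTwoCrossedModule VG VE VL G E L)

/-- The variation of the 1-dimensional holonomy expressed through the curvature. -/
theorem integral_Ad_variation {A A' B B' : ℝ → VG} {μ : ℝ → VE} (hA' : Continuous A')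
    (hμ : Continuous μ) (hB : ∀ t, HasDerivAt B (B' t) t) (hB0 : B 0 = 0)
    (hcurv : ∀ t, H.tdE (μ t) = B' t - A' t + adL VG G (A t) (B t))
    {F : ℝ → G} (hF : IsOrderedExp A 0 F) {t : ℝ} (ht : t ∈ Icc (0 : ℝ) 1) :
    ∫ τ in (0 : ℝ)..t, Ad VG (F (clamp τ)) (A' τ)
      = Ad VG (F t) (B t) - H.tdE (∫ τ in (0 : ℝ)..t, H.repE (F (clamp τ)) (μ τ)) := by
  have hAd : Continuous (fun τ => Ad VG (F (clamp τ))) := continuous_Ad.comp hF.continuous_clamp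
  have hR : Continuous (fun τ => H.repE (F (clamp τ))) :=
    H.contMDiff_repE.continuous.comp hF.continuous_clamp
  have hsub : Icc (0 : ℝ) t ⊆ Icc 0 1 := Icc_subset_Icc_right ht.2
  -- The derivative of Ad_F(B) is Ad_F([A, B] + B'), and the curvature condition says [A, B] + B' =
  -- A' + ∂(μ). Integrating this from 0, where B = 0, gives the claim.
  have hd : ∀ τ ∈ Icc 0 t, HasDerivWithinAt (fun τ => Ad VG (F τ) (B τ))
      (Ad VG (F (clamp τ)) (A' τ) + H.tdE (H.repE (F (clamp τ)) (μ τ))) (Icc 0 t) τ := by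
    intro τ hτ
    have h1 := hasDerivWithinAt_rep_left mdifferentiable_Ad Ad_mul ((hF.2 τ (hsub hτ)).mono hsub)
      (hB τ).hasDerivWithinAt
    rw [clamp_of_mem (hsub hτ), H.tdE_repE, ← map_add, hcurv]
    have h2 : A' τ + (B' τ - A' τ + adL VG G (A τ) (B τ))
        = td VG (VG →L[ℝ] VG) (fun g : G => Ad VG g) 1 (A τ) (B τ) + B' τ := by
      rw [adL]; abel
    rw [h2]
    exact h1
  have hc1 : Continuous (fun τ => Ad VG (F (clamp τ)) (A' τ)) := hAd.clm_apply hA'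
  have hc2 : Continuous (fun τ => H.repE (F (clamp τ)) (μ τ)) := hR.clm_apply hμ
  have hc3 : Continuous (fun τ => H.tdE (H.repE (F (clamp τ)) (μ τ))) := H.tdE.continuous.comp hc2
  have h := integral_eq_sub_of_hasDerivWithinAt ht.1 hd (hc1.add hc3).continuousOn
  rw [intervalIntegral.integral_add (hc1.intervalIntegrable _ _) (hc3.intervalIntegrable _ _),
    hB0, map_zero, sub_zero, ContinuousLinearMap.intervalIntegral_comp_comm _
      (hc2.intervalIntegrable _ _)] at h
  rw [← h]
  abel

/-- The derivative of the transported density with respect to a parameter. -/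
theorem hasDerivAt_transport {A A' B B' : ℝ → ℝ → VG} {μ ν ν' : ℝ → ℝ → VE}
    (hA : Continuous (fun q : ℝ × ℝ => A q.1 q.2)) (hA' : Continuous (fun q : ℝ × ℝ => A' q.1 q.2))
    (hd : ∀ t y, HasDerivAt (fun y => A t y) (A' t y) y)
    (hB : ∀ t y, HasDerivAt (fun t => B t y) (B' t y) t) (hB0 : ∀ y, B 0 y = 0)
    (hμ : Continuous (fun q : ℝ × ℝ => μ q.1 q.2))
    (hcurv : ∀ t y, H.tdE (μ t y) = B' t y - A' t y + adL VG G (A t y) (B t y))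
    (hν : ∀ t y, HasDerivAt (fun y => ν t y) (ν' t y) y)
    {F : ℝ → ℝ → G} (hF : ∀ y, IsOrderedExp (fun t => A t y) 0 (F y))
    {t : ℝ} (ht : t ∈ Icc (0 : ℝ) 1) (y : ℝ) :
    HasDerivAt (fun y => H.repE (F y t) (ν t y))
      (H.repE (F y t) (H.drepE (B t y) (ν t y) + ν' t y)
        - H.drepE (H.tdE (∫ τ in (0 : ℝ)..t, H.repE (F y (clamp τ)) (μ τ y)))
            (H.repE (F y t) (ν t y))) y := by
  have h1 := hasVel_orderedExp_param hA hA' hd hF ht y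
  have h2 := hasDerivWithinAt_rep_right H.mdifferentiable_repE H.repE_mul h1
    (hν t y).hasDerivWithinAt
  rw [hasDerivWithinAt_univ] at h2
  refine h2.congr_deriv ?_
  have hvar := H.integral_Ad_variation (A := fun t => A t y) (A' := fun t => A' t y)
    (B := fun t => B t y) (B' := fun t => B' t y) (μ := fun t => μ t y)
    (hA'.comp (Continuous.prodMk_left y)) (hμ.comp (Continuous.prodMk_left y))
    (fun t => hB t y) (hB0 y) (fun t => hcurv t y) (hF y) ht
  rw [hvar]
  change H.drepE _ _ + _ = _
  -- Equivariance turns the action of Ad_g(B) on g ▷ ν into g ▷ (B ▷ ν), the connection term of a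
  -- covariant derivative.
  rw [map_sub, _root_.sub_apply, H.drepE_Ad, map_add]
  abel

end LieTwoCrossedModule

/-! ## Connection forms on the cube -/

/-- The components, on the parameter space of a 3-path `(t, s, x)`, of a connection with values in
a 2-crossed module, pulled back along a good 3-path. -/
structure CubeForms
    {VG VE VL : Type*}
    [NormedAddCommGroup VG] [NormedSpace ℝ VG]
    [NormedAddCommGroup VE] [NormedSpace ℝ VE]
    [NormedAddCommGroup VL] [NormedSpace ℝ VL]
    {G E L : Type*}
    [TopologicalSpace G] [ChartedSpace VG G] [Group G]
    [TopologicalSpace E] [ChartedSpace VE E] [Group E]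
    [TopologicalSpace L] [ChartedSpace VL L] [Group L]
    [LieGroup 𝓘(ℝ, VG) ∞ G] [LieGroup 𝓘(ℝ, VE) ∞ E] [LieGroup 𝓘(ℝ, VL) ∞ L]
    (H : LieTwoCrossedModule VG VE VL G E L) where
  /-- the components of the 1-form -/
  At : ℝ × ℝ × ℝ → VG
  As : ℝ × ℝ × ℝ → VG
  Ax : ℝ × ℝ × ℝ → VG
  /-- the components of the 2-form -/
  mts : ℝ × ℝ × ℝ → VE
  mtx : ℝ × ℝ × ℝ → VE
  msx : ℝ × ℝ × ℝ → VE
  /-- the component of the 3-form -/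
  th : ℝ × ℝ × ℝ → VL
  smooth_At : ContDiff ℝ 1 At
  smooth_As : ContDiff ℝ 1 As
  smooth_Ax : ContDiff ℝ 1 Ax
  smooth_mts : ContDiff ℝ 1 mts
  smooth_mtx : ContDiff ℝ 1 mtx
  smooth_msx : ContDiff ℝ 1 msx
  continuous_th : Continuous th
  curv_ts : ∀ q, H.tdE (mts q)
    = fderiv ℝ As q (1, 0, 0) - fderiv ℝ At q (0, 1, 0) + adL VG G (At q) (As q)
  curv_tx : ∀ q, H.tdE (mtx q)
    = fderiv ℝ Ax q (1, 0, 0) - fderiv ℝ At q (0, 0, 1) + adL VG G (At q) (Ax q)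
  curv_tsx : ∀ q, H.tdL (th q)
    = fderiv ℝ msx q (1, 0, 0) - fderiv ℝ mtx q (0, 1, 0) + fderiv ℝ mts q (0, 0, 1)
      + (H.drepE (At q) (msx q) - H.drepE (As q) (mtx q) + H.drepE (Ax q) (mts q))
  As_zero : ∀ s x, As (0, s, x) = 0
  Ax_zero : ∀ s x, Ax (0, s, x) = 0
  msx_zero : ∀ s x, msx (0, s, x) = 0
  msx_one : ∀ s x, msx (1, s, x) = 0
  mtx_zero : ∀ t x, mtx (t, 0, x) = 0
  mtx_one : ∀ t x, mtx (t, 1, x) = 0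

section Partial

variable {V : Type*} [NormedAddCommGroup V] [NormedSpace ℝ V] {f : ℝ × ℝ × ℝ → V}

theorem hasDerivAt_partial_t (hf : ContDiff ℝ 1 f) (t s x : ℝ) :
    HasDerivAt (fun t => f (t, s, x)) (fderiv ℝ f (t, s, x) (1, 0, 0)) t := by
  have h := (hf.differentiable (by simp) (t, s, x)).hasFDerivAt
  exact h.comp_hasDerivAt (f := fun t : ℝ => (t, s, x)) t
    ((hasDerivAt_id t).prodMk ((hasDerivAt_const t s).prodMk (hasDerivAt_const t x)))

theorem hasDerivAt_partial_s (hf : ContDiff ℝ 1 f) (t s x : ℝ) :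
    HasDerivAt (fun s => f (t, s, x)) (fderiv ℝ f (t, s, x) (0, 1, 0)) s := by
  have h := (hf.differentiable (by simp) (t, s, x)).hasFDerivAt
  exact h.comp_hasDerivAt (f := fun s : ℝ => (t, s, x)) s
    ((hasDerivAt_const s t).prodMk ((hasDerivAt_id s).prodMk (hasDerivAt_const s x)))

theorem hasDerivAt_partial_x (hf : ContDiff ℝ 1 f) (t s x : ℝ) :
    HasDerivAt (fun x => f (t, s, x)) (fderiv ℝ f (t, s, x) (0, 0, 1)) x := by
  have h := (hf.differentiable (by simp) (t, s, x)).hasFDerivAt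
  exact h.comp_hasDerivAt (f := fun x : ℝ => (t, s, x)) x
    ((hasDerivAt_const x t).prodMk ((hasDerivAt_const x s).prodMk (hasDerivAt_id x)))

theorem continuous_partial (hf : ContDiff ℝ 1 f) (v : ℝ × ℝ × ℝ) :
    Continuous (fun q => fderiv ℝ f q v) :=
  (hf.continuous_fderiv (by simp)).clm_apply continuous_const

end Partial

/-! ### Densities, their integrals, and the induced connection on the (s, x)-square -/

namespace CubeForms

variable {VG VE VL : Type*}
    [NormedAddCommGroup VG] [NormedSpace ℝ VG] [CompleteSpace VG]
    [NormedAddCommGroup VE] [NormedSpace ℝ VE] [CompleteSpace VE]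
    [NormedAddCommGroup VL] [NormedSpace ℝ VL] [CompleteSpace VL]
    {G E L : Type*}
    [TopologicalSpace G] [ChartedSpace VG G] [Group G]
    [TopologicalSpace E] [ChartedSpace VE E] [Group E]
    [TopologicalSpace L] [ChartedSpace VL L] [Group L]
    [LieGroup 𝓘(ℝ, VG) ∞ G] [LieGroup 𝓘(ℝ, VE) ∞ E] [LieGroup 𝓘(ℝ, VL) ∞ L]
    {H : LieTwoCrossedModule VG VE VL G E L} (K : CubeForms H)

/-- The 1-dimensional holonomy along the `t`-lines. -/
def g (s x : ℝ) : ℝ → G := orderedExp G (fun t => K.At (t, s, x)) 0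

theorem isOrderedExp_g (s x : ℝ) : IsOrderedExp (fun t => K.At (t, s, x)) 0 (K.g s x) :=
  isOrderedExp_orderedExp
    (K.smooth_At.continuous.comp (Continuous.prodMk_left (s, x))).continuousOn (by simp)

theorem continuous_g : Continuous (fun q : ℝ × ℝ × ℝ => K.g q.2.1 q.2.2 (clamp q.1)) :=
  continuous_orderedExp_param (A := fun t (p : ℝ × ℝ) => K.At (t, p)) (F := fun p => K.g p.1 p.2)
    K.smooth_At.continuous (fun p => K.isOrderedExp_g p.1 p.2)

/-- The transport `g ▷ : 𝔢 → 𝔢`. -/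
def tr (q : ℝ × ℝ × ℝ) : VE →L[ℝ] VE := H.repE (K.g q.2.1 q.2.2 (clamp q.1))

@[fun_prop]
theorem continuous_tr : Continuous K.tr := H.contMDiff_repE.continuous.comp K.continuous_g

/-- The density `g ▷ m(∂ₜ, ∂ₛ)`. -/
def ns (q : ℝ × ℝ × ℝ) : VE := K.tr q (K.mts q)

/-- The density `g ▷ m(∂ₜ, ∂ₓ)`. -/
def nx (q : ℝ × ℝ × ℝ) : VE := K.tr q (K.mtx q)

/-- The primitive of `ns` in the variable `t`. -/
def Ns (q : ℝ × ℝ × ℝ) : VE := ∫ τ in (0 : ℝ)..q.1, K.ns (τ, q.2)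

/-- The primitive of `nx` in the variable `t`. -/
def Nx (q : ℝ × ℝ × ℝ) : VE := ∫ τ in (0 : ℝ)..q.1, K.nx (τ, q.2)

@[fun_prop]
theorem continuous_ns : Continuous K.ns := K.continuous_tr.clm_apply K.smooth_mts.continuous

@[fun_prop]
theorem continuous_nx : Continuous K.nx := K.continuous_tr.clm_apply K.smooth_mtx.continuous

@[fun_prop]
theorem continuous_Ns : Continuous K.Ns :=
  intervalIntegral.continuous_parametric_intervalIntegral_of_continuous
    (f := fun (q : ℝ × ℝ × ℝ) τ => K.ns (τ, q.2)) (by unfold Function.uncurry; fun_prop)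
    continuous_fst

@[fun_prop]
theorem continuous_Nx : Continuous K.Nx :=
  intervalIntegral.continuous_parametric_intervalIntegral_of_continuous
    (f := fun (q : ℝ × ℝ × ℝ) τ => K.nx (τ, q.2)) (by unfold Function.uncurry; fun_prop)
    continuous_fst

/-- Clamping of the variable `t`. -/
def ct (q : ℝ × ℝ × ℝ) : ℝ × ℝ × ℝ := (clamp q.1, q.2)

@[fun_prop]
theorem continuous_ct : Continuous ct := (continuous_clamp.comp continuous_fst).prodMk continuous_snd

/-- The derivative of `ns` with respect to `x`. -/
def dxns (q : ℝ × ℝ × ℝ) : VE :=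
  K.tr q (H.drepE (K.Ax (ct q)) (K.mts q) + fderiv ℝ K.mts q (0, 0, 1))
    - H.drepE (H.tdE (K.Nx (ct q))) (K.ns q)

/-- The derivative of `nx` with respect to `s`. -/
def dsnx (q : ℝ × ℝ × ℝ) : VE :=
  K.tr q (H.drepE (K.As (ct q)) (K.mtx q) + fderiv ℝ K.mtx q (0, 1, 0))
    - H.drepE (H.tdE (K.Ns (ct q))) (K.nx q)

@[fun_prop]
theorem continuous_dxns : Continuous K.dxns := by
  have h1 := K.smooth_Ax.continuous
  have h2 := K.smooth_mts.continuous
  have h3 := continuous_partial K.smooth_mts (0, 0, 1)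
  unfold dxns
  fun_prop

@[fun_prop]
theorem continuous_dsnx : Continuous K.dsnx := by
  have h1 := K.smooth_As.continuous
  have h2 := K.smooth_mtx.continuous
  have h3 := continuous_partial K.smooth_mtx (0, 1, 0)
  unfold dsnx
  fun_prop

/-- Only the holonomy in `ns` is clamped in t, not the form. The transport formula is therefore
applied at `clamp t` with a ν that ignores its first argument, so the formula holds for every real
t. -/
theorem hasDerivAt_ns_x (t s x : ℝ) :
    HasDerivAt (fun x => K.ns (t, s, x)) (K.dxns (t, s, x)) x := by
  have hl : Continuous (fun q : ℝ × ℝ => (q.1, s, q.2)) := by fun_prop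
  exact H.hasDerivAt_transport (A := fun t x => K.At (t, s, x))
    (A' := fun t x => fderiv ℝ K.At (t, s, x) (0, 0, 1)) (B := fun t x => K.Ax (t, s, x))
    (B' := fun t x => fderiv ℝ K.Ax (t, s, x) (1, 0, 0)) (μ := fun t x => K.mtx (t, s, x))
    (ν := fun _ x => K.mts (t, s, x)) (ν' := fun _ x => fderiv ℝ K.mts (t, s, x) (0, 0, 1))
    (F := fun x => K.g s x) (t := clamp t)
    (K.smooth_At.continuous.comp hl) ((continuous_partial K.smooth_At _).comp hl)
    (fun t x => hasDerivAt_partial_x K.smooth_At t s x)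
    (fun t x => hasDerivAt_partial_t K.smooth_Ax t s x) (fun x => K.Ax_zero s x)
    (K.smooth_mtx.continuous.comp hl) (fun t x => K.curv_tx (t, s, x))
    (fun _ x => hasDerivAt_partial_x K.smooth_mts t s x) (fun x => K.isOrderedExp_g s x)
    (clamp_mem t) x

theorem hasDerivAt_nx_s (t s x : ℝ) :
    HasDerivAt (fun s => K.nx (t, s, x)) (K.dsnx (t, s, x)) s := by
  have hl : Continuous (fun q : ℝ × ℝ => (q.1, q.2, x)) := by fun_prop
  exact H.hasDerivAt_transport (A := fun t s => K.At (t, s, x))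
    (A' := fun t s => fderiv ℝ K.At (t, s, x) (0, 1, 0)) (B := fun t s => K.As (t, s, x))
    (B' := fun t s => fderiv ℝ K.As (t, s, x) (1, 0, 0)) (μ := fun t s => K.mts (t, s, x))
    (ν := fun _ s => K.mtx (t, s, x)) (ν' := fun _ s => fderiv ℝ K.mtx (t, s, x) (0, 1, 0))
    (F := fun s => K.g s x) (t := clamp t)
    (K.smooth_At.continuous.comp hl) ((continuous_partial K.smooth_At _).comp hl)
    (fun t s => hasDerivAt_partial_s K.smooth_At t s x)
    (fun t s => hasDerivAt_partial_t K.smooth_As t s x) (fun s => K.As_zero s x)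
    (K.smooth_mts.continuous.comp hl) (fun t s => K.curv_ts (t, s, x))
    (fun _ s => hasDerivAt_partial_s K.smooth_mtx t s x) (fun s => K.isOrderedExp_g s x)
    (clamp_mem t) s

/-- The integrand of the 3-form `∮_ω θ - ∮_ω m * m`. -/
def dens (q : ℝ × ℝ × ℝ) : VL :=
  H.repL (K.g q.2.1 q.2.2 (clamp q.1)) (K.th q)
    - (H.dlift (K.Ns q) (K.nx q) - H.dlift (K.Nx q) (K.ns q))

@[fun_prop]
theorem continuous_repL_g :
    Continuous (fun q : ℝ × ℝ × ℝ => H.repL (K.g q.2.1 q.2.2 (clamp q.1))) :=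
  H.contMDiff_repL.continuous.comp K.continuous_g

@[fun_prop]
theorem continuous_dens : Continuous K.dens := by
  have h := K.continuous_th
  unfold dens
  fun_prop

/-- The coefficient of the 2-dimensional holonomy. -/
def a (s x : ℝ) : VE := ∫ t in (0 : ℝ)..1, K.ns (t, s, x)

/-- The analogue of `a` for the variable `x`. -/
def b (s x : ℝ) : VE := ∫ t in (0 : ℝ)..1, K.nx (t, s, x)

/-- The derivative of `a` with respect to `x`. -/
def a' (s x : ℝ) : VE := ∫ t in (0 : ℝ)..1, K.dxns (t, s, x)

/-- The derivative of `b` with respect to `s`. -/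
def b' (s x : ℝ) : VE := ∫ t in (0 : ℝ)..1, K.dsnx (t, s, x)

/-- The 3-form `∮_ω θ - ∮_ω m * m` evaluated on `(∂ₛ, ∂ₓ)`. -/
def B (s x : ℝ) : VL := ∫ t in (0 : ℝ)..1, K.dens (t, s, x)

theorem continuous_integral_cube {V : Type*} [NormedAddCommGroup V] [NormedSpace ℝ V]
    {f : ℝ × ℝ × ℝ → V} (hf : Continuous f) :
    Continuous (fun p : ℝ × ℝ => ∫ t in (0 : ℝ)..1, f (t, p.1, p.2)) :=
  intervalIntegral.continuous_parametric_intervalIntegral_of_continuous'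
    (f := fun (p : ℝ × ℝ) t => f (t, p.1, p.2)) (by unfold Function.uncurry; fun_prop) 0 1

theorem continuous_a : Continuous (fun p : ℝ × ℝ => K.a p.1 p.2) :=
  continuous_integral_cube K.continuous_ns

theorem continuous_a' : Continuous (fun p : ℝ × ℝ => K.a' p.1 p.2) :=
  continuous_integral_cube K.continuous_dxns

theorem continuous_b' : Continuous (fun p : ℝ × ℝ => K.b' p.1 p.2) :=
  continuous_integral_cube K.continuous_dsnx

theorem continuous_B : Continuous (fun p : ℝ × ℝ => K.B p.1 p.2) :=
  continuous_integral_cube K.continuous_dens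

theorem hasDerivAt_a (s x : ℝ) : HasDerivAt (fun x => K.a s x) (K.a' s x) x :=
  hasDerivAt_integral_of_continuous (f := fun t x => K.ns (t, s, x))
    (f' := fun t x => K.dxns (t, s, x)) (by fun_prop) (by fun_prop)
    (fun t x => K.hasDerivAt_ns_x t s x) 0 1 x

theorem hasDerivAt_b (s x : ℝ) : HasDerivAt (fun s => K.b s x) (K.b' s x) s :=
  hasDerivAt_integral_of_continuous (f := fun t s => K.nx (t, s, x))
    (f' := fun t s => K.dsnx (t, s, x)) (by fun_prop) (by fun_prop)
    (fun t s => K.hasDerivAt_nx_s t s x) 0 1 s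

theorem b_zero (x : ℝ) : K.b 0 x = 0 := by
  simp [b, nx, K.mtx_zero]

theorem b_one (x : ℝ) : K.b 1 x = 0 := by
  simp [b, nx, K.mtx_one]

/-- The derivative in `t` of `g ▷ m(∂ₛ, ∂ₓ)`. -/
def dtm (q : ℝ × ℝ × ℝ) : VE :=
  K.tr q (H.drepE (K.At q) (K.msx q) + fderiv ℝ K.msx q (1, 0, 0))

@[fun_prop]
theorem continuous_dtm : Continuous K.dtm := by
  have h1 := K.smooth_At.continuous
  have h2 := K.smooth_msx.continuous
  have h3 := continuous_partial K.smooth_msx (1, 0, 0)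
  unfold dtm
  fun_prop

/-- The integrand is the t-derivative of g ▷ m(∂_s, ∂_x), which vanishes at both ends because J is
constant on the faces t = 0 and t = 1. -/
theorem integral_dtm (s x : ℝ) : ∫ t in (0 : ℝ)..1, K.dtm (t, s, x) = 0 := by
  have hd : ∀ t ∈ Icc (0 : ℝ) 1, HasDerivWithinAt (fun t => H.repE (K.g s x t) (K.msx (t, s, x)))
      (K.dtm (t, s, x)) (Icc 0 1) t := by
    intro t ht
    have h := hasDerivWithinAt_rep_left H.mdifferentiable_repE H.repE_mul
      ((K.isOrderedExp_g s x).2 t ht) (hasDerivAt_partial_t K.smooth_msx t s x).hasDerivWithinAt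
    rw [dtm, tr, clamp_of_mem ht]
    exact h
  rw [integral_eq_sub_of_hasDerivWithinAt zero_le_one hd (by fun_prop), K.msx_zero, K.msx_one]
  simp

theorem ct_of_mem {t : ℝ} (ht : t ∈ Icc (0 : ℝ) 1) (p : ℝ × ℝ) : ct (t, p) = (t, p) := by
  rw [ct, clamp_of_mem ht]

/-- The covariant derivatives of m in the s- and x-directions are what the 2-curvature identity
leaves after its t-term is split off as `dtm`. The terms ∂(Ns) ▷ nx and ∂(Nx) ▷ ns are completed by
`tdL_dlift` to δ of the Peiffer terms in `dens`, at the cost of two brackets. -/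
theorem dxns_sub_dsnx {t : ℝ} (ht : t ∈ Icc (0 : ℝ) 1) (p : ℝ × ℝ) :
    K.dxns (t, p) - K.dsnx (t, p) = H.tdL (K.dens (t, p)) - K.dtm (t, p)
      + (adL VE E (K.Ns (t, p)) (K.nx (t, p)) + adL VE E (K.ns (t, p)) (K.Nx (t, p))) := by
  have h1 : K.tr (t, p) (H.tdL (K.th (t, p)))
      = H.tdL (H.repL (K.g p.1 p.2 (clamp t)) (K.th (t, p))) := (H.tdL_repL _ _).symm
  rw [K.curv_tsx] at h1
  rw [dxns, dsnx, ct_of_mem ht, dens, map_sub, ← h1, map_sub, H.tdL_dlift, H.tdL_dlift, dtm,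
    adL_swap (K.ns (t, p))]
  simp only [map_add, map_sub]
  abel

theorem hasDerivAt_Ns (t s x : ℝ) : HasDerivAt (fun t => K.Ns (t, s, x)) (K.ns (t, s, x)) t := by
  have hc : Continuous (fun t => K.ns (t, s, x)) := by fun_prop
  exact (hc.integral_hasStrictDerivAt 0 t).hasDerivAt

theorem hasDerivAt_Nx (t s x : ℝ) : HasDerivAt (fun t => K.Nx (t, s, x)) (K.nx (t, s, x)) t := by
  have hc : Continuous (fun t => K.nx (t, s, x)) := by fun_prop
  exact (hc.integral_hasStrictDerivAt 0 t).hasDerivAt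

/-- Leibniz rule for [Ns, Nx], which is zero at t = 0 and equals [a, b] at t = 1. -/
theorem integral_adL (s x : ℝ) :
    ∫ t in (0 : ℝ)..1, (adL VE E (K.Ns (t, s, x)) (K.nx (t, s, x))
      + adL VE E (K.ns (t, s, x)) (K.Nx (t, s, x))) = adL VE E (K.a s x) (K.b s x) := by
  have hd : ∀ t ∈ Icc (0 : ℝ) 1, HasDerivWithinAt
      (fun t => adL VE E (K.Ns (t, s, x)) (K.Nx (t, s, x)))
      (adL VE E (K.Ns (t, s, x)) (K.nx (t, s, x)) + adL VE E (K.ns (t, s, x)) (K.Nx (t, s, x)))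
      (Icc 0 1) t := by
    intro t _
    have h1 := (adL VE E).hasFDerivAt.comp_hasDerivAt t (K.hasDerivAt_Ns t s x)
    have h2 := (h1.clm_apply (K.hasDerivAt_Nx t s x)).hasDerivWithinAt (s := Icc 0 1)
    rw [add_comm] at h2
    exact h2
  rw [integral_eq_sub_of_hasDerivWithinAt zero_le_one hd (by fun_prop)]
  simp [Ns, Nx, a, b]

/-- Integral over t of `dxns_sub_dsnx`: the square carries a connection with components a, b, and
δ(B) measures its failure to be flat. -/
theorem tdL_B (s x : ℝ) :
    H.tdL (K.B s x) = K.a' s x - K.b' s x - adL VE E (K.a s x) (K.b s x) := by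
  have hii : ∀ {f : ℝ × ℝ × ℝ → VE}, Continuous f →
      IntervalIntegrable (fun t => f (t, s, x)) MeasureTheory.volume 0 1 := fun hf =>
    (hf.comp (by fun_prop : Continuous fun t : ℝ => (t, s, x))).intervalIntegrable _ _
  have h1 : ∫ t in (0 : ℝ)..1, (K.dxns (t, s, x) - K.dsnx (t, s, x))
      = ∫ t in (0 : ℝ)..1, (H.tdL (K.dens (t, s, x)) - K.dtm (t, s, x)
      + (adL VE E (K.Ns (t, s, x)) (K.nx (t, s, x))
        + adL VE E (K.ns (t, s, x)) (K.Nx (t, s, x)))) := by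
    refine intervalIntegral.integral_congr fun t ht => ?_
    rw [uIcc_of_le zero_le_one] at ht
    exact K.dxns_sub_dsnx ht (s, x)
  have hd : Continuous (fun q => H.tdL (K.dens q)) := by fun_prop
  have hdd : Continuous (fun q => H.tdL (K.dens q) - K.dtm q) := by fun_prop
  have had : Continuous (fun q => adL VE E (K.Ns q) (K.nx q) + adL VE E (K.ns q) (K.Nx q)) := by
    fun_prop
  have hdens : IntervalIntegrable (fun t => K.dens (t, s, x)) MeasureTheory.volume 0 1 :=
    (K.continuous_dens.comp (by fun_prop : Continuous fun t : ℝ => (t, s, x))).intervalIntegrable _ _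
  rw [intervalIntegral.integral_sub (hii K.continuous_dxns) (hii K.continuous_dsnx),
    intervalIntegral.integral_add (hii hdd) (hii had),
    intervalIntegral.integral_sub (hii hd) (hii K.continuous_dtm), K.integral_dtm, K.integral_adL,
    ContinuousLinearMap.intervalIntegral_comp_comm _ hdens] at h1
  rw [a', b', B, h1]
  abel

/-! ### The 2-dimensional holonomy -/

/-- The 2-dimensional holonomy. -/
def e (x : ℝ) : ℝ → E := orderedExp E (fun s => K.a s x) 0

theorem isOrderedExp_e (x : ℝ) : IsOrderedExp (fun s => K.a s x) 0 (K.e x) :=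
  isOrderedExp_orderedExp (K.continuous_a.comp (Continuous.prodMk_left x)).continuousOn (by simp)

theorem continuous_e : Continuous (fun p : ℝ × ℝ => K.e p.2 (clamp p.1)) :=
  continuous_orderedExp_param (A := fun s x => K.a s x) (F := fun x => K.e x) K.continuous_a
    K.isOrderedExp_e

/-- The coefficient of the 3-dimensional holonomy, up to sign. -/
def c (x : ℝ) : VL := ∫ s in (0 : ℝ)..1, H.repEL (K.e x (clamp s)) (K.B s x)

theorem continuous_c_integrand :
    Continuous (fun p : ℝ × ℝ => H.repEL (K.e p.2 (clamp p.1)) (K.B p.1 p.2)) :=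
  (H.contMDiff_repEL.continuous.comp K.continuous_e).clm_apply K.continuous_B

theorem continuous_c : Continuous K.c := by
  have h := K.continuous_c_integrand.comp continuous_swap
  exact intervalIntegral.continuous_parametric_intervalIntegral_of_continuous'
    (f := fun x s => H.repEL (K.e x (clamp s)) (K.B s x)) h 0 1

/-- By `tdL_B`, Ad_e(δ(B)) differs from Ad_e(∂_x a) by Ad_e([a, b] + ∂_s b), the s-derivative of
Ad_e(b). Its integral vanishes because b is zero on the sides s = 0 and s = 1. -/
theorem integral_Ad_a' (x : ℝ) :
    ∫ s in (0 : ℝ)..1, Ad VE (K.e x (clamp s)) (K.a' s x) = H.tdL (K.c x) := by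
  have hl : Continuous (fun s : ℝ => (s, x)) := Continuous.prodMk_left x
  have he : Continuous (fun s => K.e x (clamp s)) := (K.isOrderedExp_e x).continuous_clamp
  have hAd : Continuous (fun s => Ad VE (K.e x (clamp s))) :=
    (continuous_Ad (V := VE) (G := E)).comp he
  have ha : Continuous (fun s => K.a s x) := by
    have h := K.continuous_a.comp hl
    exact h
  have ha' : Continuous (fun s => K.a' s x) := by
    have h := K.continuous_a'.comp hl
    exact h
  have hb' : Continuous (fun s => K.b' s x) := by
    have h := K.continuous_b'.comp hl
    exact h
  have hb : Continuous (fun s => K.b s x) :=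
    continuous_iff_continuousAt.2 fun s => (K.hasDerivAt_b s x).continuousAt
  have hd : ∀ s ∈ Icc (0 : ℝ) 1, HasDerivWithinAt (fun s => Ad VE (K.e x s) (K.b s x))
      (Ad VE (K.e x (clamp s)) (adL VE E (K.a s x) (K.b s x) + K.b' s x)) (Icc 0 1) s := by
    intro s hs
    have h := hasDerivWithinAt_rep_left mdifferentiable_Ad Ad_mul
      ((K.isOrderedExp_e x).2 s hs) (K.hasDerivAt_b s x).hasDerivWithinAt
    rw [clamp_of_mem hs]
    exact h
  have hc2 : Continuous
      (fun s => Ad VE (K.e x (clamp s)) (adL VE E (K.a s x) (K.b s x) + K.b' s x)) :=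
    hAd.clm_apply ((((adL VE E).continuous.comp ha).clm_apply hb).add hb')
  have h0 := integral_eq_sub_of_hasDerivWithinAt zero_le_one hd hc2.continuousOn
  rw [K.b_zero, K.b_one, map_zero, map_zero, sub_zero] at h0
  have hc1 : Continuous (fun s => Ad VE (K.e x (clamp s)) (K.a' s x)) :=
    hAd.clm_apply ha'
  have hcc : IntervalIntegrable (fun s => H.repEL (K.e x (clamp s)) (K.B s x))
      MeasureTheory.volume 0 1 := (K.continuous_c_integrand.comp hl).intervalIntegrable _ _
  rw [c, ← ContinuousLinearMap.intervalIntegral_comp_comm _ hcc]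
  have h1 : ∀ s, H.tdL (H.repEL (K.e x (clamp s)) (K.B s x))
      = Ad VE (K.e x (clamp s)) (K.a' s x)
        - Ad VE (K.e x (clamp s)) (adL VE E (K.a s x) (K.b s x) + K.b' s x) := by
    intro s
    have h2 : K.a' s x - K.b' s x - adL VE E (K.a s x) (K.b s x)
        = K.a' s x - (adL VE E (K.a s x) (K.b s x) + K.b' s x) := by abel
    rw [H.tdL_repEL, K.tdL_B, h2, map_sub]
  simp only [h1]
  rw [intervalIntegral.integral_sub (hc1.intervalIntegrable _ _) (hc2.intervalIntegrable _ _), h0,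
    sub_zero]

theorem hasLD_e (x : ℝ) :
    HasLD VE (fun x => K.e x 1) univ x (Ad VE (K.e x 1)⁻¹ (H.tdL (K.c x))) := by
  rw [← hasVel_mul_right_iff, ← K.integral_Ad_a' x]
  exact hasVel_orderedExp_param (A := fun s x => K.a s x) (A' := fun s x => K.a' s x)
    K.continuous_a K.continuous_a' K.hasDerivAt_a (F := fun x => K.e x) K.isOrderedExp_e
    (right_mem_Icc.2 zero_le_one) x

/-- The non-abelian Stokes theorem on the cube. -/
theorem stokes {x₀ x : ℝ} (hx₀ : x₀ ∈ Icc (0 : ℝ) 1) (hx : x ∈ Icc (0 : ℝ) 1) {l : ℝ → L}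
    (hl : IsOrderedExp (fun x => -K.c x) x₀ l) :
    (H.bdL (l x))⁻¹ * K.e x₀ 1 = K.e x 1 := by
  have : IsManifold 𝓘(ℝ, VE) ∞ E := isManifold_of_lieGroup
  have hv : ∀ y ∈ Icc (0 : ℝ) 1, HasVel VE (fun y => H.bdL (l y) * K.e y 1) (Icc 0 1) y 0 := by
    intro y hy
    have h1 := HasLD.map (F := l) (a := -K.c y) (hl.2 y hy : HasLD VL l (Icc 0 1) y (-K.c y))
      H.bdL H.mdifferentiable_bdL
    have h2 := h1.mul ((K.hasLD_e y).mono (subset_univ _))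
    -- The coefficient −c of l and the variation δ(c) of e are conjugated by the same element and
    -- cancel.
    have h3 : Ad VE (K.e y 1)⁻¹ (td VL VE H.bdL 1 (-K.c y))
        + Ad VE (K.e y 1)⁻¹ (H.tdL (K.c y)) = 0 := by
      rw [← map_add]
      change Ad VE (K.e y 1)⁻¹ (H.tdL (-K.c y) + _) = 0
      rw [map_neg, neg_add_cancel, map_zero]
    rw [h3] at h2
    unfold HasLD at h2
    rwa [map_zero] at h2
  have h := eq_of_hasVel_zero (convex_Icc 0 1) hv hx₀ hx
  rw [hl.1, map_one, one_mul] at h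
  rw [h, inv_mul_cancel_left]

end CubeForms

/-! ### Pull-back of differential forms and naturality of the exterior derivative -/

section Pullback

variable {VM : Type*} [NormedAddCommGroup VM] [NormedSpace ℝ VM]
  {M : Type*} [TopologicalSpace M] [ChartedSpace VM M]
  {V : Type*} [NormedAddCommGroup V] [NormedSpace ℝ V] {k : ℕ}
  {W : Type*} [NormedAddCommGroup W] [NormedSpace ℝ W]

/-- The value of a form at a point, on the model space. -/
def DiffForm.val (α : DiffForm VM M V k) (p : M) : VM [⋀^Fin k]→L[ℝ] V := α.toFun p

/-- The pull-back of a differential form along a map defined on a vector space. -/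
def pullForm (α : DiffForm VM M V k) (f : W → M) (q : W) : W [⋀^Fin k]→L[ℝ] V :=
  (α.val (f q)).compContinuousLinearMap (td W VM f q)

theorem pullForm_apply (α : DiffForm VM M V k) (f : W → M) (q : W) (v : Fin k → W) :
    pullForm α f q v = α.val (f q) (fun i => td W VM f q (v i)) := rfl

theorem chartForm_apply (α : DiffForm VM M V k) (p₀ : M) (y : VM) (v : Fin k → VM) :
    chartForm α.toFun p₀ y v = α.val ((extChartAt 𝓘(ℝ, VM) p₀).symm y)
      (fun i => td VM VM (extChartAt 𝓘(ℝ, VM) p₀).symm y (v i)) := rfl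

theorem extD_apply (α : DiffForm VM M V k) (p : M) (v : Fin (k + 1) → VM) :
    extD α p v = extDeriv (chartForm α.toFun p) (extChartAt 𝓘(ℝ, VM) p p)
      (fun i => td VM VM (extChartAt 𝓘(ℝ, VM) p) p (v i)) := rfl

theorem contDiffAt_chartForm (α : DiffForm VM M V k) (p : M) :
    ContDiffAt ℝ ∞ (chartForm α.toFun p) (extChartAt 𝓘(ℝ, VM) p p) :=
  (α.smooth p).contDiffAt ((isOpen_extChartAt_target p).mem_nhds (mem_extChartAt_target p))

/-- Smoothness of the value of a smooth form, pulled back by a smooth family of linear maps. -/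
theorem ContDiffAt.alternating_comp_apply {a : W → VM [⋀^Fin k]→L[ℝ] V} {D : W → W →L[ℝ] VM}
    {q : W} {n : WithTop ℕ∞} (ha : ContDiffAt ℝ n a q) (hD : ContDiffAt ℝ n D q) (v : Fin k → W) :
    ContDiffAt ℝ n (fun q => a q (fun i => D q (v i))) q := by
  have h1 : ContDiffAt ℝ n (fun q => (a q).toContinuousMultilinearMap) q :=
    (ContinuousAlternatingMap.toContinuousMultilinearMapLI (𝕜 := ℝ) (E := VM) (F := V)
      (ι := Fin k)).contDiff.contDiffAt.comp q ha
  have h2 : ContDiffAt ℝ n (fun q =>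
      ContinuousMultilinearMap.compContinuousLinearMapContinuousMultilinear ℝ (fun _ : Fin k => W)
        (fun _ => VM) V (fun _ => D q)) q :=
    (ContinuousMultilinearMap.contDiff _).contDiffAt.comp q (contDiffAt_pi.2 fun _ => hD)
  exact (ContinuousMultilinearMap.apply ℝ (fun _ : Fin k => W) V v).contDiff.contDiffAt.comp q
    (h2.clm_apply h1)

theorem eventually_mem_chart_source {W : Type*} [TopologicalSpace W] {f : W → M} (hf : Continuous f)
    (q : W) :
    ∀ᶠ q' in nhds q, f q' ∈ (extChartAt 𝓘(ℝ, VM) (f q)).source :=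
  hf.continuousAt.preimage_mem_nhds (extChartAt_source_mem_nhds (f q))

variable {f : W → M} [IsManifold 𝓘(ℝ, VM) ∞ M] (hf : ContMDiff 𝓘(ℝ, W) 𝓘(ℝ, VM) ∞ f)

include hf

theorem fderiv_chart_comp {p₀ : M} {q : W} (hq : f q ∈ (extChartAt 𝓘(ℝ, VM) p₀).source) (v : W) :
    fderiv ℝ (fun q => extChartAt 𝓘(ℝ, VM) p₀ (f q)) q v
      = td VM VM (extChartAt 𝓘(ℝ, VM) p₀) (f q) (td W VM f q v) := by
  rw [← td_eq_fderiv]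
  exact td_comp (mdifferentiableAt_chart hq) ((hf q).mdifferentiableAt (by simp)) v

theorem contDiffAt_chart_comp {p₀ : M} {q : W} (hq : f q ∈ (extChartAt 𝓘(ℝ, VM) p₀).source) :
    ContDiffAt ℝ ∞ (fun q => extChartAt 𝓘(ℝ, VM) p₀ (f q)) q := by
  rw [extChartAt_source] at hq
  exact contMDiffAt_iff_contDiffAt.1
    (ContMDiffAt.comp (I' := 𝓘(ℝ, VM)) q (contMDiffAt_extChartAt' hq) (hf q))

/-- The derivative of the inverse chart built into `chartForm` cancels that of the chart in the
chain rule. Near a point the pull-back is thus one between vector spaces, from which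
differentiability and naturality of d are inherited. -/
theorem pullForm_eq_chart (α : DiffForm VM M V k) {p₀ : M} {q : W}
    (hq : f q ∈ (extChartAt 𝓘(ℝ, VM) p₀).source) :
    pullForm α f q = (chartForm α.toFun p₀ (extChartAt 𝓘(ℝ, VM) p₀ (f q))).compContinuousLinearMap
      (fderiv ℝ (fun q => extChartAt 𝓘(ℝ, VM) p₀ (f q)) q) := by
  have hy := (extChartAt 𝓘(ℝ, VM) p₀).map_source hq
  have hleft := (extChartAt 𝓘(ℝ, VM) p₀).left_inv hq
  ext v
  have h1 : ∀ v, td VM VM (extChartAt 𝓘(ℝ, VM) p₀).symm (extChartAt 𝓘(ℝ, VM) p₀ (f q))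
      (fderiv ℝ (fun q => extChartAt 𝓘(ℝ, VM) p₀ (f q)) q v) = td W VM f q v := by
    intro v
    have h := td_chart_symm_td_chart hy (td W VM f q v)
    rw [hleft] at h
    rw [fderiv_chart_comp hf hq, h]
  have h2 := DFunLike.congr_fun (congrArg α.val hleft) (fun i => td W VM f q (v i))
  rw [pullForm_apply, ← h2, ContinuousAlternatingMap.compContinuousLinearMap_apply,
    chartForm_apply]
  exact congrArg _ (funext fun i => (h1 (v i)).symm)

theorem pullForm_eventuallyEq_chart (α : DiffForm VM M V k) (q : W) :
    pullForm α f =ᶠ[nhds q] fun q' =>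
      (chartForm α.toFun (f q) (extChartAt 𝓘(ℝ, VM) (f q) (f q'))).compContinuousLinearMap
        (fderiv ℝ (fun q' => extChartAt 𝓘(ℝ, VM) (f q) (f q')) q') := by
  filter_upwards [eventually_mem_chart_source (VM := VM) hf.continuous q] with q' hq'
  exact pullForm_eq_chart hf α hq'

theorem differentiableAt_pullForm (α : DiffForm VM M V k) (q : W) :
    DifferentiableAt ℝ (pullForm α f) q := by
  have hc := contDiffAt_chart_comp hf (mem_extChartAt_source (I := 𝓘(ℝ, VM)) (f q))
  refine DifferentiableAt.congr_of_eventuallyEq ?_ (pullForm_eventuallyEq_chart hf α q)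
  refine DifferentiableAt.continuousAlternatingMapCompContinuousLinearMap ?_ ?_
  · exact ((contDiffAt_chartForm α (f q)).differentiableAt (by simp)).comp q
      (hc.differentiableAt (by simp))
  · exact (hc.fderiv_right (m := 1) (by norm_cast)).differentiableAt (by simp)

theorem contDiff_pullForm_apply (α : DiffForm VM M V k) (v : Fin k → W) :
    ContDiff ℝ ∞ (fun q => pullForm α f q v) := by
  refine contDiff_iff_contDiffAt.2 fun q => ?_
  have hc := contDiffAt_chart_comp hf (mem_extChartAt_source (I := 𝓘(ℝ, VM)) (f q))
  have h := ContDiffAt.alternating_comp_apply ((contDiffAt_chartForm α (f q)).comp q hc)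
    (hc.fderiv_right (m := ∞) (by norm_cast)) v
  refine h.congr_of_eventuallyEq ?_
  filter_upwards [pullForm_eventuallyEq_chart hf α q] with q' hq'
  rw [hq']
  rfl

/-- The chart chosen here is the one at f q, the same in which `extD` is computed at that point, so
naturality between vector spaces suffices and no change of chart arises. -/
theorem extDeriv_pullForm (α : DiffForm VM M V k) (q : W) (v : Fin (k + 1) → W) :
    extDeriv (pullForm α f) q v = extD α (f q) (fun i => td W VM f q (v i)) := by
  have hs := mem_extChartAt_source (I := 𝓘(ℝ, VM)) (f q)
  have hc := contDiffAt_chart_comp hf hs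
  rw [(pullForm_eventuallyEq_chart hf α q).extDeriv_eq,
    extDeriv_pullback (f := fun q' => extChartAt 𝓘(ℝ, VM) (f q) (f q'))
      ((contDiffAt_chartForm α (f q)).differentiableAt (by simp)) (hc.of_le (m := 2)
      (by norm_cast)) (by simp), extD_apply]
  exact congrArg _ (funext fun i => fderiv_chart_comp hf hs (v i))

theorem extDeriv_pullForm_one (α : DiffForm VM M V 1) (q u v : W) :
    extD α (f q) ![td W VM f q u, td W VM f q v]
      = fderiv ℝ (fun q => pullForm α f q ![v]) q u
        - fderiv ℝ (fun q => pullForm α f q ![u]) q v := by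
  have h := extDeriv_pullForm hf α q ![u, v]
  have e : (fun i => td W VM f q (![u, v] i)) = ![td W VM f q u, td W VM f q v] := by
    funext i; fin_cases i <;> rfl
  have e0 : (0 : Fin 2).removeNth ![u, v] = ![v] := by funext i; fin_cases i; rfl
  have e1 : (1 : Fin 2).removeNth ![u, v] = ![u] := by funext i; fin_cases i; rfl
  rw [e, extDeriv_apply (differentiableAt_pullForm hf α q), Fin.sum_univ_two, e0, e1] at h
  refine h.symm.trans ?_
  simp [sub_eq_add_neg]

theorem extDeriv_pullForm_two (α : DiffForm VM M V 2) (q u v w : W) :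
    extD α (f q) ![td W VM f q u, td W VM f q v, td W VM f q w]
      = fderiv ℝ (fun q => pullForm α f q ![v, w]) q u
        - fderiv ℝ (fun q => pullForm α f q ![u, w]) q v
        + fderiv ℝ (fun q => pullForm α f q ![u, v]) q w := by
  have h := extDeriv_pullForm hf α q ![u, v, w]
  have e : (fun i => td W VM f q (![u, v, w] i))
      = ![td W VM f q u, td W VM f q v, td W VM f q w] := by
    funext i; fin_cases i <;> rfl
  have e0 : (0 : Fin 3).removeNth ![u, v, w] = ![v, w] := by funext i; fin_cases i <;> rfl
  have e1 : (1 : Fin 3).removeNth ![u, v, w] = ![u, w] := by funext i; fin_cases i <;> rfl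
  have e2 : (2 : Fin 3).removeNth ![u, v, w] = ![u, v] := by funext i; fin_cases i <;> rfl
  rw [e, extDeriv_apply (differentiableAt_pullForm hf α q), Fin.sum_univ_three, e0, e1, e2] at h
  refine h.symm.trans ?_
  simp [sub_eq_add_neg]

end Pullback

/-! ### Smooth extension of a good 3-path to the whole parameter space -/

/-- A smooth retraction-like map of the line to `[0,1]`, equal to the identity away from the
ends of the interval. -/
theorem exists_smooth_retraction {ε : ℝ} (hε : 0 < ε) (hε' : ε ≤ 1 / 2) :
    ∃ κ : ℝ → ℝ, ContDiff ℝ ∞ κ ∧ (∀ t, κ t ∈ Icc (0 : ℝ) 1) ∧ κ 0 = 0 ∧ κ 1 = 1 ∧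
      ∀ t, κ t = t ∨ (t ≤ ε ∧ κ t ≤ ε) ∨ (1 - ε ≤ t ∧ 1 - ε ≤ κ t) := by
  -- In t a b + (1 − b) the cutoff a forces the value 0 for t ≤ 0, and b forces the value 1 for t ≥
  -- 1; in the middle both cutoffs are 1 and t is unchanged.
  set a : ℝ → ℝ := fun t => Real.smoothTransition (t / ε) with ha
  set b : ℝ → ℝ := fun t => Real.smoothTransition ((1 - t) / ε) with hb
  have a0 : ∀ t ≤ 0, a t = 0 := fun t ht =>
    Real.smoothTransition.zero_of_nonpos (div_nonpos_of_nonpos_of_nonneg ht hε.le)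
  have a1 : ∀ t, ε ≤ t → a t = 1 := fun t ht =>
    Real.smoothTransition.one_of_one_le ((one_le_div hε).2 ht)
  have b0 : ∀ t, 1 ≤ t → b t = 0 := fun t ht =>
    Real.smoothTransition.zero_of_nonpos
      (div_nonpos_of_nonpos_of_nonneg (sub_nonpos.2 ht) hε.le)
  have b1 : ∀ t, t ≤ 1 - ε → b t = 1 := fun t ht =>
    Real.smoothTransition.one_of_one_le ((one_le_div hε).2 (by linarith))
  have an : ∀ t, 0 ≤ a t := fun t => Real.smoothTransition.nonneg _
  have al : ∀ t, a t ≤ 1 := fun t => Real.smoothTransition.le_one _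
  have bn : ∀ t, 0 ≤ b t := fun t => Real.smoothTransition.nonneg _
  have bl : ∀ t, b t ≤ 1 := fun t => Real.smoothTransition.le_one _
  have hlow : ∀ t ≤ ε, t * a t * b t + (1 - b t) ∈ Icc (0 : ℝ) ε := by
    intro t ht
    rw [b1 t (by linarith)]
    rcases le_total t 0 with h | h
    · rw [a0 t h]; simp [hε.le]
    · have := mul_nonneg h (an t)
      have := mul_le_mul_of_nonneg_left (al t) h
      constructor <;> linarith
  have hhigh : ∀ t, 1 - ε ≤ t → t * a t * b t + (1 - b t) ∈ Icc (1 - ε) 1 := by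
    intro t ht
    rw [a1 t (by linarith)]
    rcases le_total t 1 with h | h
    · have := mul_nonneg (sub_nonneg.2 h) (bn t)
      have := mul_le_mul_of_nonneg_left (bl t) (sub_nonneg.2 h)
      constructor <;> linarith
    · rw [b0 t h]; simp [hε.le]
  have hmid : ∀ t, ε ≤ t → t ≤ 1 - ε → t * a t * b t + (1 - b t) = t := by
    intro t h1 h2
    rw [a1 t h1, b1 t h2]; ring
  refine ⟨fun t => t * a t * b t + (1 - b t), ?_, fun t => ?_, ?_, ?_, fun t => ?_⟩
  · have ca : ContDiff ℝ ∞ a :=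
      Real.smoothTransition.contDiff.comp (contDiff_id.div_const ε)
    have cb : ContDiff ℝ ∞ b :=
      Real.smoothTransition.contDiff.comp ((contDiff_const.sub contDiff_id).div_const ε)
    exact ((contDiff_id.mul ca).mul cb).add (contDiff_const.sub cb)
  · rcases le_total t ε with h | h
    · exact ⟨(hlow t h).1, (hlow t h).2.trans (by linarith)⟩
    rcases le_total (1 - ε) t with h' | h'
    · exact ⟨le_trans (by linarith) (hhigh t h').1, (hhigh t h').2⟩
    · change t * a t * b t + (1 - b t) ∈ _
      rw [hmid t h h']
      constructor <;> linarith
  · simp [b1 0 (by linarith)]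
  · simp [b0 1 le_rfl]
  · rcases le_total t ε with h | h
    · exact Or.inr (Or.inl ⟨h, (hlow t h).2⟩)
    rcases le_total (1 - ε) t with h' | h'
    · exact Or.inr (Or.inr ⟨h', (hhigh t h').1⟩)
    · exact Or.inl (hmid t h h')

section Paths

variable {VM : Type*} [NormedAddCommGroup VM] [NormedSpace ℝ VM]
  {M : Type*} [TopologicalSpace M] [ChartedSpace VM M]

/-- A good 3-path extends to a smooth map on the whole parameter space. -/
theorem IsGoodThreePath.exists_extension {J : ℝ → ℝ → ℝ → M} (hJ : IsGoodThreePath VM J) :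
    ∃ f : ℝ × ℝ × ℝ → M, ContMDiff 𝓘(ℝ, ℝ × ℝ × ℝ) 𝓘(ℝ, VM) ∞ f ∧
      (∀ t ∈ Icc (0 : ℝ) 1, ∀ s ∈ Icc (0 : ℝ) 1, ∀ x ∈ Icc (0 : ℝ) 1, f (t, s, x) = J t s x) ∧
      (∀ s x, f (0, s, x) = f (0, 0, 0)) ∧ (∀ s x, f (1, s, x) = f (1, 0, 0)) ∧
      (∀ t x, f (t, 0, x) = f (t, 0, 0)) ∧ (∀ t x, f (t, 1, x) = f (t, 1, 0)) := by
  obtain ⟨ε₀, hε₀, hprod⟩ := hJ.product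
  obtain ⟨κ, hκ, hmem, h0, h1, hcase⟩ :=
    -- Inside a collar of width at most ε₀ the path does not depend on the coordinate, so wherever κ
    -- moves a point, J has the same value before and after. Hence J composed with κ in each
    -- variable is smooth everywhere and still equals J on the cube.
    exists_smooth_retraction (ε := min ε₀ (1 / 2)) (by positivity) (min_le_right _ _)
  have hle := min_le_left ε₀ (1 / 2)
  have ht : ∀ t ∈ Icc (0 : ℝ) 1, ∀ s ∈ Icc (0 : ℝ) 1, ∀ x ∈ Icc (0 : ℝ) 1,
      J (κ t) s x = J t s x := by
    intro t ht s hs x hx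
    rcases hcase t with h | ⟨h, h'⟩ | ⟨h, h'⟩
    · rw [h]
    · rw [(hprod t ht s hs x hx).1 (by linarith), (hprod _ (hmem t) s hs x hx).1 (by linarith)]
    · rw [(hprod t ht s hs x hx).2.1 (by linarith), (hprod _ (hmem t) s hs x hx).2.1 (by linarith)]
  have hs : ∀ t ∈ Icc (0 : ℝ) 1, ∀ s ∈ Icc (0 : ℝ) 1, ∀ x ∈ Icc (0 : ℝ) 1,
      J t (κ s) x = J t s x := by
    intro t ht s hs x hx
    rcases hcase s with h | ⟨h, h'⟩ | ⟨h, h'⟩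
    · rw [h]
    · rw [(hprod t ht s hs x hx).2.2.1 (by linarith),
        (hprod t ht _ (hmem s) x hx).2.2.1 (by linarith)]
    · rw [(hprod t ht s hs x hx).2.2.2.1 (by linarith),
        (hprod t ht _ (hmem s) x hx).2.2.2.1 (by linarith)]
  have hx : ∀ t ∈ Icc (0 : ℝ) 1, ∀ s ∈ Icc (0 : ℝ) 1, ∀ x ∈ Icc (0 : ℝ) 1,
      J t s (κ x) = J t s x := by
    intro t ht s hs x hx
    rcases hcase x with h | ⟨h, h'⟩ | ⟨h, h'⟩
    · rw [h]
    · rw [(hprod t ht s hs x hx).2.2.2.2.1 (by linarith),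
        (hprod t ht s hs _ (hmem x)).2.2.2.2.1 (by linarith)]
    · rw [(hprod t ht s hs x hx).2.2.2.2.2 (by linarith),
        (hprod t ht s hs _ (hmem x)).2.2.2.2.2 (by linarith)]
  refine ⟨fun q => J (κ q.1) (κ q.2.1) (κ q.2.2), ?_, ?_, ?_, ?_, ?_, ?_⟩
  · have hc : ContDiff ℝ ∞ (fun q : ℝ × ℝ × ℝ => (κ q.1, κ q.2.1, κ q.2.2)) :=
      (hκ.comp contDiff_fst).prodMk ((hκ.comp (contDiff_fst.comp contDiff_snd)).prodMk
        (hκ.comp (contDiff_snd.comp contDiff_snd)))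
    exact hJ.smooth.comp_contMDiff hc.contMDiff fun q => ⟨hmem _, hmem _, hmem _⟩
  · intro t ht' s hs' x hx'
    exact (ht t ht' _ (hmem _) _ (hmem _)).trans
      ((hs t ht' s hs' _ (hmem _)).trans (hx t ht' s hs' x hx'))
  · intro s x
    simp only [h0]
    rw [hJ.source _ (hmem _) _ (hmem _)]
  · intro s x
    simp only [h0, h1]
    rw [hJ.target _ (hmem _) _ (hmem _)]
  · intro t x
    simp only [h0]
    rw [hJ.good_zero _ (hmem _) _ (hmem _)]
  · intro t x
    simp only [h0, h1]
    rw [hJ.good_one _ (hmem _) _ (hmem _)]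

/-- Derivatives within [0,1] are unique, also at its ends, so the one-sided velocities of J can be
computed from the smooth extension. -/
theorem velocity_eq_td {f : ℝ × ℝ × ℝ → M} (hf : ContMDiff 𝓘(ℝ, ℝ × ℝ × ℝ) 𝓘(ℝ, VM) ∞ f)
    {γ : ℝ → M} {c : ℝ → ℝ × ℝ × ℝ} {v : ℝ × ℝ × ℝ} {t : ℝ} (hc : HasDerivAt c v t)
    (ht : t ∈ Icc (0 : ℝ) 1) (hγ : ∀ τ ∈ Icc (0 : ℝ) 1, f (c τ) = γ τ) :
    velocity VM γ t = td (ℝ × ℝ × ℝ) VM f (c t) v := by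
  have h1 : HasVel (ℝ × ℝ × ℝ) c (Icc 0 1) t v :=
    hasVel_iff_hasDerivWithinAt.2 hc.hasDerivWithinAt
  have h2 : HasVel VM γ (Icc 0 1) t (td (ℝ × ℝ × ℝ) VM f (c t) v) :=
    (HasVel.comp ((hf (c t)).mdifferentiableAt (by simp)) h1).congr
      (fun τ hτ => (hγ τ hτ).symm) (hγ t ht).symm
  have hu : UniqueMDiffWithinAt 𝓘(ℝ, ℝ) (Icc (0 : ℝ) 1) t :=
    (uniqueDiffOn_Icc zero_lt_one t ht).uniqueMDiffWithinAt
  have h3 := HasMFDerivWithinAt.mfderivWithin h2 hu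
  have h4 := DFunLike.congr_fun h3 (1 : ℝ)
  exact h4.trans (one_smul ℝ _)

theorem td_eq_zero_of_const {f : ℝ × ℝ × ℝ → M}
    (hf : ContMDiff 𝓘(ℝ, ℝ × ℝ × ℝ) 𝓘(ℝ, VM) ∞ f) {c : ℝ → ℝ × ℝ × ℝ} {v : ℝ × ℝ × ℝ} {t : ℝ}
    (hc : HasDerivAt c v t) {p : M} (hp : ∀ τ, f (c τ) = p) :
    td (ℝ × ℝ × ℝ) VM f (c t) v = 0 := by
  have h := td_comp (V := ℝ) (W := ℝ × ℝ × ℝ) (U := VM) (g := f) (f := c) (x := t)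
    ((hf (c t)).mdifferentiableAt (by simp)) hc.differentiableAt.mdifferentiableAt 1
  rw [td_eq_fderiv, fderiv_apply_one_eq_deriv, hc.deriv] at h
  rw [← h, funext hp]
  exact td_const _ _ _

end Paths

/-! ### The connection pulled back to the cube -/

section Cube

variable {VM VG VE VL : Type*}
    [NormedAddCommGroup VM] [NormedSpace ℝ VM]
    [NormedAddCommGroup VG] [NormedSpace ℝ VG] [CompleteSpace VG]
    [NormedAddCommGroup VE] [NormedSpace ℝ VE] [CompleteSpace VE]
    [NormedAddCommGroup VL] [NormedSpace ℝ VL] [CompleteSpace VL]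
    {M : Type*} [TopologicalSpace M] [ChartedSpace VM M]
    {G E L : Type*}
    [TopologicalSpace G] [ChartedSpace VG G] [Group G]
    [TopologicalSpace E] [ChartedSpace VE E] [Group E]
    [TopologicalSpace L] [ChartedSpace VL L] [Group L]
    [LieGroup 𝓘(ℝ, VG) ∞ G] [LieGroup 𝓘(ℝ, VE) ∞ E] [LieGroup 𝓘(ℝ, VL) ∞ L]
    {H : LieTwoCrossedModule VG VE VL G E L}
    {om : DiffForm VM M VG 1} {m : DiffForm VM M VE 2} {θ : DiffForm VM M VL 3}

section

variable {W : Type*} [NormedAddCommGroup W] [NormedSpace ℝ W] {V : Type*} [NormedAddCommGroup V]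
  [NormedSpace ℝ V] {f : W → M}

theorem pullForm_apply_one (α : DiffForm VM M V 1) (q u : W) :
    pullForm α f q ![u] = α (f q) ![td W VM f q u] := by
  rw [pullForm_apply]
  exact congrArg (α.val (f q)) (by funext i; fin_cases i; rfl)

theorem pullForm_apply_two (α : DiffForm VM M V 2) (q u v : W) :
    pullForm α f q ![u, v] = α (f q) ![td W VM f q u, td W VM f q v] := by
  rw [pullForm_apply]
  exact congrArg (α.val (f q)) (by funext i; fin_cases i <;> rfl)

theorem pullForm_apply_three (α : DiffForm VM M V 3) (q u v w : W) :
    pullForm α f q ![u, v, w] = α (f q) ![td W VM f q u, td W VM f q v, td W VM f q w] := by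
  rw [pullForm_apply]
  exact congrArg (α.val (f q)) (by funext i; fin_cases i <;> rfl)

variable [IsManifold 𝓘(ℝ, VM) ∞ M] (hconn : H.IsConnection om m θ) (hf : ContMDiff 𝓘(ℝ, W) 𝓘(ℝ, VM) ∞ f)
include hconn hf

theorem pullForm_curvature (q u v : W) :
    H.tdE (pullForm m f q ![u, v]) = fderiv ℝ (fun q => pullForm om f q ![v]) q u
      - fderiv ℝ (fun q => pullForm om f q ![u]) q v
      + adL VG G (pullForm om f q ![u]) (pullForm om f q ![v]) := by
  have h : H.tdE (m (f q) ![td W VM f q u, td W VM f q v])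
      = extD om (f q) ![td W VM f q u, td W VM f q v]
        + lieBr G (om (f q) ![td W VM f q u]) (om (f q) ![td W VM f q v]) :=
    hconn.1 (f q) (td W VM f q u) (td W VM f q v)
  rw [extDeriv_pullForm_one hf, lieBr_eq_adL] at h
  rw [pullForm_apply_two, pullForm_apply_one, pullForm_apply_one]
  exact h

theorem pullForm_twoCurvature (q u v w : W) :
    H.tdL (pullForm θ f q ![u, v, w]) = fderiv ℝ (fun q => pullForm m f q ![v, w]) q u
      - fderiv ℝ (fun q => pullForm m f q ![u, w]) q v
      + fderiv ℝ (fun q => pullForm m f q ![u, v]) q w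
      + (H.drepE (pullForm om f q ![u]) (pullForm m f q ![v, w])
        - H.drepE (pullForm om f q ![v]) (pullForm m f q ![u, w])
        + H.drepE (pullForm om f q ![w]) (pullForm m f q ![u, v])) := by
  have h : H.tdL (θ (f q) ![td W VM f q u, td W VM f q v, td W VM f q w])
      = extD m (f q) ![td W VM f q u, td W VM f q v, td W VM f q w]
        + (H.algActE (om (f q) ![td W VM f q u]) (m (f q) ![td W VM f q v, td W VM f q w])
          - H.algActE (om (f q) ![td W VM f q v]) (m (f q) ![td W VM f q u, td W VM f q w])
          + H.algActE (om (f q) ![td W VM f q w]) (m (f q) ![td W VM f q u, td W VM f q v])) :=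
    hconn.2 (f q) (td W VM f q u) (td W VM f q v) (td W VM f q w)
  rw [extDeriv_pullForm_two hf, H.algActE_eq, H.algActE_eq,
    H.algActE_eq] at h
  simp only [pullForm_apply_three]
  rw [pullForm_apply_two m q v w, pullForm_apply_two m q u w, pullForm_apply_two m q u v,
    pullForm_apply_one, pullForm_apply_one, pullForm_apply_one]
  exact h

end

/-- The components of the pull-back of a connection along a good 3-path. -/
def cubeForms [IsManifold 𝓘(ℝ, VM) ∞ M] (hconn : H.IsConnection om m θ) {f : ℝ × ℝ × ℝ → M}
    (hf : ContMDiff 𝓘(ℝ, ℝ × ℝ × ℝ) 𝓘(ℝ, VM) ∞ f)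
    (h₀ : ∀ s x, f (0, s, x) = f (0, 0, 0)) (h₁ : ∀ s x, f (1, s, x) = f (1, 0, 0))
    (k₀ : ∀ t x, f (t, 0, x) = f (t, 0, 0)) (k₁ : ∀ t x, f (t, 1, x) = f (t, 1, 0)) :
    CubeForms H where
  At q := pullForm om f q ![(1, 0, 0)]
  As q := pullForm om f q ![(0, 1, 0)]
  Ax q := pullForm om f q ![(0, 0, 1)]
  mts q := pullForm m f q ![(1, 0, 0), (0, 1, 0)]
  mtx q := pullForm m f q ![(1, 0, 0), (0, 0, 1)]
  msx q := pullForm m f q ![(0, 1, 0), (0, 0, 1)]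
  th q := pullForm θ f q ![(1, 0, 0), (0, 1, 0), (0, 0, 1)]
  smooth_At := (contDiff_pullForm_apply hf om _).of_le (by norm_cast)
  smooth_As := (contDiff_pullForm_apply hf om _).of_le (by norm_cast)
  smooth_Ax := (contDiff_pullForm_apply hf om _).of_le (by norm_cast)
  smooth_mts := (contDiff_pullForm_apply hf m _).of_le (by norm_cast)
  smooth_mtx := (contDiff_pullForm_apply hf m _).of_le (by norm_cast)
  smooth_msx := (contDiff_pullForm_apply hf m _).of_le (by norm_cast)
  continuous_th := (contDiff_pullForm_apply hf θ _).continuous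
  curv_ts q := pullForm_curvature hconn hf q _ _
  curv_tx q := pullForm_curvature hconn hf q _ _
  curv_tsx q := pullForm_twoCurvature hconn hf q _ _ _
  As_zero s x := by
    refine (om.val (f (0, s, x))).map_coord_zero 0 ?_
    exact td_eq_zero_of_const hf (c := fun s => (0, s, x))
      ((hasDerivAt_const s 0).prodMk ((hasDerivAt_id s).prodMk (hasDerivAt_const s x)))
      fun s => h₀ s x
  Ax_zero s x := by
    refine (om.val (f (0, s, x))).map_coord_zero 0 ?_
    exact td_eq_zero_of_const hf (c := fun x => (0, s, x))
      ((hasDerivAt_const x 0).prodMk ((hasDerivAt_const x s).prodMk (hasDerivAt_id x)))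
      fun x => h₀ s x
  msx_zero s x := by
    refine (m.val (f (0, s, x))).map_coord_zero 0 ?_
    exact td_eq_zero_of_const hf (c := fun s => (0, s, x))
      ((hasDerivAt_const s 0).prodMk ((hasDerivAt_id s).prodMk (hasDerivAt_const s x)))
      fun s => h₀ s x
  msx_one s x := by
    refine (m.val (f (1, s, x))).map_coord_zero 0 ?_
    exact td_eq_zero_of_const hf (c := fun s => (1, s, x))
      ((hasDerivAt_const s 1).prodMk ((hasDerivAt_id s).prodMk (hasDerivAt_const s x)))
      fun s => h₁ s x
  mtx_zero t x := by
    refine (m.val (f (t, 0, x))).map_coord_zero 1 ?_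
    exact td_eq_zero_of_const hf (c := fun x => (t, 0, x))
      ((hasDerivAt_const x t).prodMk ((hasDerivAt_const x 0).prodMk (hasDerivAt_id x)))
      fun x => k₀ t x
  mtx_one t x := by
    refine (m.val (f (t, 1, x))).map_coord_zero 1 ?_
    exact td_eq_zero_of_const hf (c := fun x => (t, 1, x))
      ((hasDerivAt_const x t).prodMk ((hasDerivAt_const x 1).prodMk (hasDerivAt_id x)))
      fun x => k₁ t x

/-- The components `K` are those of the pull-back of `om`, `m`, `θ` along the 3-path `J`. -/
structure CubeForms.IsPullback (K : CubeForms H) (om : DiffForm VM M VG 1) (m : DiffForm VM M VE 2)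
    (θ : DiffForm VM M VL 3) (J : ℝ → ℝ → ℝ → M) : Prop where
  At_eq : ∀ t ∈ Icc (0 : ℝ) 1, ∀ s ∈ Icc (0 : ℝ) 1, ∀ x ∈ Icc (0 : ℝ) 1,
    om (J t s x) ![velocity VM (fun t' => J t' s x) t] = K.At (t, s, x)
  mts_eq : ∀ t ∈ Icc (0 : ℝ) 1, ∀ s ∈ Icc (0 : ℝ) 1, ∀ x ∈ Icc (0 : ℝ) 1,
    m (J t s x) ![velocity VM (fun t' => J t' s x) t, velocity VM (fun s' => J t s' x) s]
      = K.mts (t, s, x)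
  mtx_eq : ∀ t ∈ Icc (0 : ℝ) 1, ∀ s ∈ Icc (0 : ℝ) 1, ∀ x ∈ Icc (0 : ℝ) 1,
    m (J t s x) ![velocity VM (fun t' => J t' s x) t, velocity VM (fun x' => J t s x') x]
      = K.mtx (t, s, x)
  th_eq : ∀ t ∈ Icc (0 : ℝ) 1, ∀ s ∈ Icc (0 : ℝ) 1, ∀ x ∈ Icc (0 : ℝ) 1,
    θ (J t s x) ![velocity VM (fun t' => J t' s x) t, velocity VM (fun s' => J t s' x) s,
      velocity VM (fun x' => J t s x') x] = K.th (t, s, x)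

/-- Reduces the geometry to functions on ℝ³. The extension f supplies globally defined components
and `IsPullback` records their agreement with the original data on the cube, the only place where
the holonomies see them. -/
theorem IsGoodThreePath.exists_cubeForms [IsManifold 𝓘(ℝ, VM) ∞ M] (hconn : H.IsConnection om m θ)
    {J : ℝ → ℝ → ℝ → M} (hJ : IsGoodThreePath VM J) :
    ∃ K : CubeForms H, K.IsPullback om m θ J := by
  obtain ⟨f, hf, hfJ, h₀, h₁, k₀, k₁⟩ := hJ.exists_extension
  have vt : ∀ t ∈ Icc (0 : ℝ) 1, ∀ s ∈ Icc (0 : ℝ) 1, ∀ x ∈ Icc (0 : ℝ) 1,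
      velocity VM (fun t' => J t' s x) t = td (ℝ × ℝ × ℝ) VM f (t, s, x) (1, 0, 0) :=
    fun t ht s hs x hx => velocity_eq_td hf (c := fun t => (t, s, x))
      ((hasDerivAt_id t).prodMk ((hasDerivAt_const t s).prodMk (hasDerivAt_const t x))) ht
      fun τ hτ => hfJ τ hτ s hs x hx
  have vs : ∀ t ∈ Icc (0 : ℝ) 1, ∀ s ∈ Icc (0 : ℝ) 1, ∀ x ∈ Icc (0 : ℝ) 1,
      velocity VM (fun s' => J t s' x) s = td (ℝ × ℝ × ℝ) VM f (t, s, x) (0, 1, 0) :=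
    fun t ht s hs x hx => velocity_eq_td hf (c := fun s => (t, s, x))
      ((hasDerivAt_const s t).prodMk ((hasDerivAt_id s).prodMk (hasDerivAt_const s x))) hs
      fun τ hτ => hfJ t ht τ hτ x hx
  have vx : ∀ t ∈ Icc (0 : ℝ) 1, ∀ s ∈ Icc (0 : ℝ) 1, ∀ x ∈ Icc (0 : ℝ) 1,
      velocity VM (fun x' => J t s x') x = td (ℝ × ℝ × ℝ) VM f (t, s, x) (0, 0, 1) :=
    fun t ht s hs x hx => velocity_eq_td hf (c := fun x => (t, s, x))
      ((hasDerivAt_const x t).prodMk ((hasDerivAt_const x s).prodMk (hasDerivAt_id x))) hx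
      fun τ hτ => hfJ t ht s hs τ hτ
  refine ⟨cubeForms hconn hf h₀ h₁ k₀ k₁, ?_, ?_, ?_, ?_⟩
  · intro t ht s hs x hx
    change om.val (J t s x) _ = pullForm om f (t, s, x) _
    rw [vt t ht s hs x hx, pullForm_apply_one, hfJ t ht s hs x hx]
    rfl
  · intro t ht s hs x hx
    change m.val (J t s x) _ = pullForm m f (t, s, x) _
    rw [vt t ht s hs x hx, vs t ht s hs x hx, pullForm_apply_two, hfJ t ht s hs x hx]
    rfl
  · intro t ht s hs x hx
    change m.val (J t s x) _ = pullForm m f (t, s, x) _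
    rw [vt t ht s hs x hx, vx t ht s hs x hx, pullForm_apply_two, hfJ t ht s hs x hx]
    rfl
  · intro t ht s hs x hx
    change θ.val (J t s x) _ = pullForm θ f (t, s, x) _
    rw [vt t ht s hs x hx, vs t ht s hs x hx, vx t ht s hs x hx, pullForm_apply_three,
      hfJ t ht s hs x hx]
    rfl

end Cube

/-! ### Identification of the holonomies of J with those on the cube -/

namespace CubeForms

section Linking

variable {VM VG VE VL : Type*}
    [NormedAddCommGroup VM] [NormedSpace ℝ VM]
    [NormedAddCommGroup VG] [NormedSpace ℝ VG] [CompleteSpace VG]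
    [NormedAddCommGroup VE] [NormedSpace ℝ VE] [CompleteSpace VE]
    [NormedAddCommGroup VL] [NormedSpace ℝ VL] [CompleteSpace VL]
    {M : Type*} [TopologicalSpace M] [ChartedSpace VM M]
    {G E L : Type*}
    [TopologicalSpace G] [ChartedSpace VG G] [Group G]
    [TopologicalSpace E] [ChartedSpace VE E] [Group E]
    [TopologicalSpace L] [ChartedSpace VL L] [Group L]
    [LieGroup 𝓘(ℝ, VG) ∞ G] [LieGroup 𝓘(ℝ, VE) ∞ E] [LieGroup 𝓘(ℝ, VL) ∞ L]
    {H : LieTwoCrossedModule VG VE VL G E L}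
    {om : DiffForm VM M VG 1} {m : DiffForm VM M VE 2} {θ : DiffForm VM M VL 3}
    {J : ℝ → ℝ → ℝ → M} {K : CubeForms H}

theorem eqOn_integral {V : Type*} [NormedAddCommGroup V] [NormedSpace ℝ V] {f g : ℝ → V}
    (h : EqOn f g (Icc 0 1)) {t : ℝ} (ht : t ∈ Icc (0 : ℝ) 1) :
    ∫ τ in (0 : ℝ)..t, f τ = ∫ τ in (0 : ℝ)..t, g τ := by
  refine intervalIntegral.integral_congr fun τ hτ => ?_
  rw [uIcc_of_le ht.1] at hτ
  exact h ⟨hτ.1, hτ.2.trans ht.2⟩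

variable (hK : K.IsPullback om m θ J)
include hK

theorem IsPullback.continuousOn_coeff₁ {s x : ℝ} (hs : s ∈ Icc (0 : ℝ) 1)
    (hx : x ∈ Icc (0 : ℝ) 1) :
    ContinuousOn (LieTwoCrossedModule.coeff₁ om (fun t => J t s x)) (Icc 0 1) :=
  (K.smooth_At.continuous.comp (Continuous.prodMk_left (s, x))).continuousOn.congr
    fun t ht => hK.At_eq t ht s hs x hx

theorem IsPullback.hol₁_eq {t s x : ℝ} (ht : t ∈ Icc (0 : ℝ) 1) (hs : s ∈ Icc (0 : ℝ) 1)
    (hx : x ∈ Icc (0 : ℝ) 1) :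
    LieTwoCrossedModule.hol₁ G om (fun t => J t s x) 0 t = K.g s x (clamp t) := by
  rw [clamp_of_mem ht]
  exact orderedExp_congr (hK.continuousOn_coeff₁ hs hx) (fun t ht => hK.At_eq t ht s hs x hx)
    (by simp) ht

theorem IsPullback.density₂_ts {t s x : ℝ} (ht : t ∈ Icc (0 : ℝ) 1) (hs : s ∈ Icc (0 : ℝ) 1)
    (hx : x ∈ Icc (0 : ℝ) 1) :
    H.density₂ om m (fun a b => J a b x) t s = K.ns (t, s, x) := by
  rw [LieTwoCrossedModule.density₂, hK.hol₁_eq ht hs hx, hK.mts_eq t ht s hs x hx]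
  rfl

theorem IsPullback.density₂_tx {t s x : ℝ} (ht : t ∈ Icc (0 : ℝ) 1) (hs : s ∈ Icc (0 : ℝ) 1)
    (hx : x ∈ Icc (0 : ℝ) 1) :
    H.density₂ om m (fun a b => J a s b) t x = K.nx (t, s, x) := by
  rw [LieTwoCrossedModule.density₂, hK.hol₁_eq ht hs hx, hK.mtx_eq t ht s hs x hx]
  rfl

theorem IsPullback.coeff₂_eq {s x : ℝ} (hs : s ∈ Icc (0 : ℝ) 1) (hx : x ∈ Icc (0 : ℝ) 1) :
    H.coeff₂ om m (fun t s => J t s x) s = K.a s x :=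
  eqOn_integral (fun _ ht => hK.density₂_ts ht hs hx) (by simp)

theorem IsPullback.continuousOn_coeff₂ {x : ℝ} (hx : x ∈ Icc (0 : ℝ) 1) :
    ContinuousOn (H.coeff₂ om m (fun t s => J t s x)) (Icc 0 1) :=
  (K.continuous_a.comp (Continuous.prodMk_left x)).continuousOn.congr
    fun _ hs => hK.coeff₂_eq hs hx

theorem IsPullback.hol₂_eq {s x : ℝ} (hs : s ∈ Icc (0 : ℝ) 1) (hx : x ∈ Icc (0 : ℝ) 1) :
    H.hol₂ om m (fun t s => J t s x) 0 s = K.e x (clamp s) := by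
  rw [clamp_of_mem hs]
  exact orderedExp_congr (hK.continuousOn_coeff₂ hx) (fun s hs => hK.coeff₂_eq hs hx) (by simp) hs

/-- Both integrands are continuous once the holonomies are clamped, so the two separately defined
integrals may be merged into the single one of `B`. -/
theorem IsPullback.loop_eq {s x : ℝ} (hs : s ∈ Icc (0 : ℝ) 1) (hx : x ∈ Icc (0 : ℝ) 1) :
    H.loopθ om θ J s x - H.loopmm om m J s x = K.B s x := by
  have hl : Continuous (fun t : ℝ => (t, s, x)) := Continuous.prodMk_left (s, x)
  have h1 : H.loopθ om θ J s x
      = ∫ t in (0 : ℝ)..1, H.repL (K.g s x (clamp t)) (K.th (t, s, x)) := by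
    refine eqOn_integral (fun t ht => ?_) (by simp)
    rw [LieTwoCrossedModule.density₃, hK.hol₁_eq ht hs hx, hK.th_eq t ht s hs x hx]
    rfl
  have h2 : H.loopmm om m J s x
      = ∫ t in (0 : ℝ)..1, (H.dlift (K.Ns (t, s, x)) (K.nx (t, s, x))
        - H.dlift (K.Nx (t, s, x)) (K.ns (t, s, x))) := by
    refine eqOn_integral (fun t ht => ?_) (by simp)
    have e1 : ∫ t' in (0 : ℝ)..t, H.density₂ om m (fun a b => J a b x) t' s = K.Ns (t, s, x) :=
      eqOn_integral (fun t' ht' => hK.density₂_ts ht' hs hx) ht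
    have e2 : ∫ t' in (0 : ℝ)..t, H.density₂ om m (fun a b => J a s b) t' x = K.Nx (t, s, x) :=
      eqOn_integral (fun t' ht' => hK.density₂_tx ht' hs hx) ht
    simp only [e1, e2, hK.density₂_ts ht hs hx, hK.density₂_tx ht hs hx, H.algLift_eq]
  have c1 : Continuous (fun t => H.repL (K.g s x (clamp t)) (K.th (t, s, x))) :=
    (K.continuous_repL_g.comp hl).clm_apply (K.continuous_th.comp hl)
  have c2 : Continuous (fun t => H.dlift (K.Ns (t, s, x)) (K.nx (t, s, x))
      - H.dlift (K.Nx (t, s, x)) (K.ns (t, s, x))) := by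
    fun_prop
  rw [h1, h2, ← intervalIntegral.integral_sub (c1.intervalIntegrable _ _)
    (c2.intervalIntegrable _ _)]
  rfl

theorem IsPullback.coeff₃_eq {x : ℝ} (hx : x ∈ Icc (0 : ℝ) 1) :
    H.coeff₃ om m θ J x = -K.c x := by
  have h : ∀ s ∈ Icc (0 : ℝ) 1, H.grpActEL (H.hol₂ om m (fun t' s' => J t' s' x) 0 s)
      (H.loopθ om θ J s x - H.loopmm om m J s x) = H.repEL (K.e x (clamp s)) (K.B s x) := by
    intro s hs
    rw [hK.hol₂_eq hs hx, hK.loop_eq hs hx]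
    rfl
  rw [LieTwoCrossedModule.coeff₃, eqOn_integral h (by simp), c]

theorem IsPullback.continuousOn_coeff₃ : ContinuousOn (H.coeff₃ om m θ J) (Icc 0 1) :=
  K.continuous_c.neg.continuousOn.congr fun _ hx => hK.coeff₃_eq hx

theorem IsPullback.stokes {x x' : ℝ} (hx : x ∈ Icc (0 : ℝ) 1) (hx' : x' ∈ Icc (0 : ℝ) 1) :
    (H.bdL (H.hol₃ om m θ J x x'))⁻¹ * H.hol₂ om m (fun t s => J t s x) 0 1
      = H.hol₂ om m (fun t s => J t s x') 0 1 := by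
  have h1 : (1 : ℝ) ∈ Icc (0 : ℝ) 1 := by simp
  have hl : IsOrderedExp (fun x => -K.c x) x (H.hol₃ om m θ J x) :=
    (isOrderedExp_orderedExp hK.continuousOn_coeff₃ hx).congr_coeff fun _ hy => hK.coeff₃_eq hy
  rw [hK.hol₂_eq h1 hx, hK.hol₂_eq h1 hx', clamp_of_mem h1]
  exact K.stokes hx hx' hl

end Linking

end CubeForms

end HigherHolonomy

end

theorem mainTheorem10
    {VM VG VE VL : Type*}
    [NormedAddCommGroup VM] [NormedSpace ℝ VM] [FiniteDimensional ℝ VM]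
    [NormedAddCommGroup VG] [NormedSpace ℝ VG] [FiniteDimensional ℝ VG]
    [NormedAddCommGroup VE] [NormedSpace ℝ VE] [FiniteDimensional ℝ VE]
    [NormedAddCommGroup VL] [NormedSpace ℝ VL] [FiniteDimensional ℝ VL]
    {M : Type*} [TopologicalSpace M] [ChartedSpace VM M] [IsManifold 𝓘(ℝ, VM) ∞ M]
    {G E L : Type*}
    [TopologicalSpace G] [ChartedSpace VG G] [Group G] [LieGroup 𝓘(ℝ, VG) ∞ G]
    [TopologicalSpace E] [ChartedSpace VE E] [Group E] [LieGroup 𝓘(ℝ, VE) ∞ E]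
    [TopologicalSpace L] [ChartedSpace VL L] [Group L] [LieGroup 𝓘(ℝ, VL) ∞ L]
    (H : HigherHolonomy.LieTwoCrossedModule VG VE VL G E L)
    (om : HigherHolonomy.DiffForm VM M VG 1)
    (m : HigherHolonomy.DiffForm VM M VE 2)
    (θ : HigherHolonomy.DiffForm VM M VL 3)
    (hconn : H.IsConnection om m θ)
    (J : ℝ → ℝ → ℝ → M) (hJ : HigherHolonomy.IsGoodThreePath VM J) :
    (∀ s ∈ Icc (0 : ℝ) 1, ∀ x ∈ Icc (0 : ℝ) 1, ∀ t₀ ∈ Icc (0 : ℝ) 1,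
      HigherHolonomy.WellPosed G
        (HigherHolonomy.LieTwoCrossedModule.coeff₁ om (fun t => J t s x)) t₀) ∧
    (∀ x ∈ Icc (0 : ℝ) 1, ∀ s₀ ∈ Icc (0 : ℝ) 1,
      HigherHolonomy.WellPosed E (H.coeff₂ om m (fun t s => J t s x)) s₀) ∧
    (∀ x₀ ∈ Icc (0 : ℝ) 1,
      HigherHolonomy.WellPosed L (H.coeff₃ om m θ J) x₀) ∧
    ∀ x ∈ Icc (0 : ℝ) 1, ∀ x' ∈ Icc (0 : ℝ) 1,
      (H.bdL (H.hol₃ om m θ J x x'))⁻¹ * H.hol₂ om m (fun t s => J t s x) 0 1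
        = H.hol₂ om m (fun t s => J t s x') 0 1 := by
  -- Finite dimension of the groups enters through completeness of their model spaces, as required
  -- by Picard–Lindelöf.
  have : CompleteSpace VG := FiniteDimensional.complete ℝ VG
  have : CompleteSpace VE := FiniteDimensional.complete ℝ VE
  have : CompleteSpace VL := FiniteDimensional.complete ℝ VL
  obtain ⟨K, hK⟩ := hJ.exists_cubeForms hconn
  exact ⟨fun s hs x hx t₀ ht₀ =>
      HigherHolonomy.wellPosed_of_continuousOn G (hK.continuousOn_coeff₁ hs hx) ht₀,
    fun x hx s₀ hs₀ =>
      HigherHolonomy.wellPosed_of_continuousOn E (hK.continuousOn_coeff₂ hx) hs₀,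
    fun x₀ hx₀ => HigherHolonomy.wellPosed_of_continuousOn L hK.continuousOn_coeff₃ hx₀,
    fun x hx x' hx' => hK.stokes hx hx'⟩
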